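/- Let $(\mathbf M,\mathbf g)$ be a smooth oriented four-dimensional Lorentzian manifold of signature $(-,+,+,+)$ with vanishing Ricci curvature, with Levi-Civita connection $\mathbf D$, volume form $\in_{\alpha\beta\mu\nu}$, and curvature tensor $\mathbf R_{\alpha\beta\mu\nu}$ (with the sign for which every Killing field $K$ satisfies $\mathbf D_\mu\mathbf D_\alpha K_\beta=\mathbf R_{\lambda\mu\alpha\beta}K^\lambda$). Let $\mathbf T$ be a smooth Killing vector field, $\mathbf D_\alpha\mathbf T_\beta+\mathbf D_\beta\mathbf T_\alpha=0$. Put $F_{\alpha\beta}=\mathbf D_\alpha\mathbf T_\beta$, ${}^*F_{\alpha\beta}=\frac12\in_{\alpha\beta}{}^{\mu\nu}F_{\mu\nu}$, ${}^*\mathbf R_{\alpha\beta\gamma\delta}=\frac12\in_{\alpha\beta}{}^{\mu\nu}\mathbf R_{\mu\nu\gamma\delta}$, $$\mathcal F_{\alpha\beta}=F_{\alpha\beta}+i\,{}^*F_{\alpha\beta},\quad \mathcal F^2=\mathcal F_{\alpha\beta}\mathcal F^{\alpha\beta},\quad \mathcal R_{\alpha\beta\gamma\delta}=\mathbf R_{\alpha\beta\gamma\delta}+i\,{}^*\mathbf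 R_{\alpha\beta\gamma\delta},\quad \sigma_\mu=2\mathbf T^\alpha\mathcal F_{\alpha\mu},$$ $$\mathcal I_{\alpha\beta\mu\nu}=\tfrac14\big(\mathbf g_{\alpha\mu}\mathbf g_{\beta\nu}-\mathbf g_{\alpha\nu}\mathbf g_{\beta\mu}+i\in_{\alpha\beta\mu\nu}\big),\qquad \mathcal Q_{\alpha\beta\mu\nu}=\mathcal F_{\alpha\beta}\mathcal F_{\mu\nu}-\tfrac13\mathcal F^2\mathcal I_{\alpha\beta\mu\nu}.$$ For a complex-valued function $h$ on $\mathbf M$ let $\mathcal S_{\alpha\beta\mu\nu}=\mathcal R_{\alpha\beta\mu\nu}+6h^{-1}\mathcal Q_{\alpha\beta\mu\nu}$ and $E_\rho=\mathbf D_\rho h+\sigma_\rho$. (1) At every point at which $h$ is differentiable and nonzero, the tensor field $\mathcal S$ is differentiable and $$\mathbf D^\alpha\mathcal S_{\alpha\beta\mu\nu}=-6h^{-1}\mathbf T^\sigma\mathcal S_{\sigma\rho\gamma\delta}\Big[\mathcal F_\beta{}^\rho\,\delta^\gamma_\mu\,\delta^\delta_\nu+\tfrac23\,\mathcal I^\rho{}_{\beta\mu\nu}\,\mathcal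 F^{\gamma\delta}\Big]-6h^{-2}E^\rho\mathcal Q_{\rho\beta\mu\nu}.$$ (2) Let $U\subset\mathbf M$ be open and let $\sigma$ be an Ernst potential on $U$, i.e. a differentiable complex-valued function with $\mathbf D_\mu\sigma=\sigma_\mu$ on $U$. Then for $h=1-\sigma$, at every point of $U$ where $\sigma\neq1$, $\mathcal S$ is differentiable, $E_\rho=0$, the last term above vanishes, and $$\mathbf D^\alpha\mathcal S_{\alpha\beta\mu\nu}=-6h^{-1}\mathbf T^\sigma\mathcal S_{\sigma\rho\gamma\delta}\Big[\mathcal F_\beta{}^\rho\,\delta^\gamma_\mu\,\delta^\delta_\nu+\tfrac23\,\mathcal I^\rho{}_{\beta\mu\nu}\,\mathcal F^{\gamma\delta}\Big].$$ -/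

import Mathlib

open scoped Manifold ContDiff Topology

noncomputable section

/-- The model space `ℝ⁴`. -/
abbrev E4 : Type := EuclideanSpace ℝ (Fin 4)

/-! ### Tensor calculus in coordinates

Tensor fields are given by their components on (an open subset of) `ℝ⁴`. Below `G` is the matrix of
components `g_{αβ}` of a metric, `ep` the components `ε_{αβμν}` of its volume form, `t` the
contravariant components `T^α` of a vector field. -/

namespace Coord

/-- The partial derivative `∂_i f`. -/
def pd {V : Type*} [NormedAddCommGroup V] [NormedSpace ℝ V] (i : Fin 4) (f : E4 → V) (y : E4) : V :=
  fderiv ℝ f y (EuclideanSpace.single i (1 : ℝ))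

variable (G : E4 → Matrix (Fin 4) (Fin 4) ℝ)

/-- The inverse metric `g^{αβ}`. -/
def gInv (y : E4) (a b : Fin 4) : ℝ := (G y)⁻¹ a b

/-- The Christoffel symbols `Γ^k_{ij}` of the Levi-Civita connection. -/
def christoffel (k i j : Fin 4) (y : E4) : ℝ :=
  (1 / 2 : ℝ) * ∑ l, gInv G y k l *
    (pd i (fun z => G z j l) y + pd j (fun z => G z i l) y - pd l (fun z => G z i j) y)

/-- The curvature
`R^k_{lij} = ∂_i Γ^k_{jl} - ∂_j Γ^k_{il} + Γ^k_{im} Γ^m_{jl} - Γ^k_{jm} Γ^m_{il}`. -/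
def riemannUp (k l i j : Fin 4) (y : E4) : ℝ :=
  pd i (christoffel G k j l) y - pd j (christoffel G k i l) y
    + ∑ m, (christoffel G k i m y * christoffel G m j l y
        - christoffel G k j m y * christoffel G m i l y)

/-- The curvature tensor `R_{klij} = g_{km} R^m_{lij}`. A Killing field `K` satisfies
`D_μ D_α K_β = R_{λμαβ} K^λ` with this sign. -/
def riemann (k l i j : Fin 4) (y : E4) : ℝ := ∑ m, G y k m * riemannUp G m l i j y

/-- The Ricci tensor `R_{lj} = R^k_{lkj}`. -/
def ricci (l j : Fin 4) (y : E4) : ℝ := ∑ k, riemannUp G k l k j y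

/-- The covariant derivative `D_ρ S_{αβμν}` of a complex covariant 4-tensor. -/
def covD (S : Fin 4 → Fin 4 → Fin 4 → Fin 4 → E4 → ℂ) (r a b m n : Fin 4) (y : E4) : ℂ :=
  pd r (S a b m n) y
    - ∑ l, ((christoffel G l r a y : ℂ) * S l b m n y + (christoffel G l r b y : ℂ) * S a l m n y
        + (christoffel G l r m y : ℂ) * S a b l n y + (christoffel G l r n y : ℂ) * S a b m l y)

/-- The divergence `D^α S_{αβμν} = g^{αρ} D_ρ S_{αβμν}` of a complex covariant 4-tensor. -/
def divergence (S : Fin 4 → Fin 4 → Fin 4 → Fin 4 → E4 → ℂ) (b m n : Fin 4) (y : E4) : ℂ :=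
  ∑ a, ∑ r, (gInv G y a r : ℂ) * covD G S r a b m n y

/-- The tensor `D_α T_β`, where `T_β = g_{βγ} T^γ`. -/
def covDLower (t : Fin 4 → E4 → ℝ) (a b : Fin 4) (y : E4) : ℝ :=
  pd a (fun z => ∑ c, G z b c * t c z) y
    - ∑ k, christoffel G k a b y * ∑ c, G y k c * t c y

variable (ep : Fin 4 → Fin 4 → Fin 4 → Fin 4 → E4 → ℝ)

/-- The Hodge dual `⋆w_{αβ} = ½ ε_{αβ}^{μν} w_{μν}` of a 2-form at the point `y`. -/
def hodge (w : Fin 4 → Fin 4 → ℝ) (a b : Fin 4) (y : E4) : ℝ :=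
  (1 / 2 : ℝ) * ∑ m, ∑ n, ∑ m', ∑ n',
    ep a b m' n' y * gInv G y m' m * gInv G y n' n * w m n

/-- `𝓡 = R + i ⋆R`, with `⋆R` the left Hodge dual. -/
def RR (a b m n : Fin 4) (y : E4) : ℂ :=
  (riemann G a b m n y : ℂ)
    + Complex.I * (hodge G ep (fun c d => riemann G c d m n y) a b y : ℂ)

/-- `𝓘_{αβμν} = (g_{αμ} g_{βν} - g_{αν} g_{βμ} + i ε_{αβμν}) / 4`. -/
def II (a b m n : Fin 4) (y : E4) : ℂ :=
  ((G y a m * G y b n - G y a n * G y b m : ℝ) + Complex.I * (ep a b m n y : ℂ)) / 4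

variable (t : Fin 4 → E4 → ℝ)

/-- `𝓕 = F + i ⋆F`, where `F_{αβ} = D_α T_β`. -/
def FF (a b : Fin 4) (y : E4) : ℂ :=
  (covDLower G t a b y : ℂ)
    + Complex.I * (hodge G ep (fun c d => covDLower G t c d y) a b y : ℂ)

/-- `𝓕^{αβ}`. -/
def FFup (a b : Fin 4) (y : E4) : ℂ :=
  ∑ c, ∑ d, (gInv G y a c : ℂ) * (gInv G y b d : ℂ) * FF G ep t c d y

/-- `𝓕_α^β`. -/
def FFmixed (a b : Fin 4) (y : E4) : ℂ := ∑ c, (gInv G y b c : ℂ) * FF G ep t a c y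

/-- `𝓕² = 𝓕_{αβ} 𝓕^{αβ}`. -/
def FFsq (y : E4) : ℂ := ∑ a, ∑ b, FF G ep t a b y * FFup G ep t a b y

/-- The Ernst 1-form `σ_μ = 2 T^α 𝓕_{αμ}`. -/
def ernst (m : Fin 4) (y : E4) : ℂ := 2 * ∑ a, (t a y : ℂ) * FF G ep t a m y

/-- `𝓠_{αβμν} = 𝓕_{αβ} 𝓕_{μν} - ⅓ 𝓕² 𝓘_{αβμν}`. -/
def QQ (a b m n : Fin 4) (y : E4) : ℂ :=
  FF G ep t a b y * FF G ep t m n y - (1 / 3 : ℂ) * FFsq G ep t y * II G ep a b m n y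

/-- `𝓢 = 𝓡 + 6 h⁻¹ 𝓠`. -/
def SS (h : E4 → ℂ) (a b m n : Fin 4) (y : E4) : ℂ :=
  RR G ep a b m n y + 6 * (h y)⁻¹ * QQ G ep t a b m n y

/-- `E_ρ = D_ρ h + σ_ρ`. -/
def EE (h : E4 → ℂ) (r : Fin 4) (y : E4) : ℂ := pd r h y + ernst G ep t r y

/-- `-6 h⁻¹ T^σ 𝓢_{σργδ} [𝓕_β^ρ δ^γ_μ δ^δ_ν + ⅔ 𝓘^ρ_{βμν} 𝓕^{γδ}]`. -/
def mainTerm (h : E4 → ℂ) (b m n : Fin 4) (y : E4) : ℂ :=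
  -6 * (h y)⁻¹ * ∑ s, ∑ r, ∑ c, ∑ d, (t s y : ℂ) * SS G ep t h s r c d y *
    (FFmixed G ep t b r y * (if c = m then 1 else 0) * (if d = n then 1 else 0)
      + (2 / 3 : ℂ) * (∑ l, (gInv G y r l : ℂ) * II G ep l b m n y) * FFup G ep t c d y)

/-- `-6 h⁻² E^ρ 𝓠_{ρβμν}`. -/
def errorTerm (h : E4 → ℂ) (b m n : Fin 4) (y : E4) : ℂ :=
  -6 * ((h y) ^ 2)⁻¹ * ∑ r, (∑ l, (gInv G y r l : ℂ) * EE G ep t h l y) * QQ G ep t r b m n y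

end Coord

/-! ### Four-dimensional Lorentzian manifolds -/

section Spacetime

variable {M : Type*} [TopologicalSpace M] [ChartedSpace E4 M]

/-- The coordinate vector `∂_i` of the chart `e` at the point with coordinates `y`. -/
def coordVec (e : OpenPartialHomeomorph M E4) (y : E4) (i : Fin 4) :
    TangentSpace (𝓡 4) (e.symm y) :=
  mfderiv (𝓡 4) (𝓡 4) e.symm y (EuclideanSpace.single i (1 : ℝ) : E4)

/-- The components `g_{ij}` in the chart `e`, as functions of the coordinates. -/
def metricComp (g : ∀ p : M, TangentSpace (𝓡 4) p →L[ℝ] TangentSpace (𝓡 4) p →L[ℝ] ℝ)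
    (e : OpenPartialHomeomorph M E4) (y : E4) : Matrix (Fin 4) (Fin 4) ℝ :=
  Matrix.of fun i j => g (e.symm y) (coordVec e y i) (coordVec e y j)

/-- The components of a field of 4-forms in the chart `e`. -/
def formComp (ε : ∀ p : M, TangentSpace (𝓡 4) p [⋀^Fin 4]→ₗ[ℝ] ℝ)
    (e : OpenPartialHomeomorph M E4) (a b m n : Fin 4) (y : E4) : ℝ :=
  ε (e.symm y) ![coordVec e y a, coordVec e y b, coordVec e y m, coordVec e y n]

/-- The components `T^i` of a vector field in the chart `e`. -/
def vecComp (T : ∀ p : M, TangentSpace (𝓡 4) p)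
    (e : OpenPartialHomeomorph M E4) (i : Fin 4) (y : E4) : ℝ :=
  (show E4 from mfderiv (𝓡 4) (𝓡 4) e (e.symm y) (T (e.symm y))) i

variable [IsManifold (𝓡 4) ∞ M]

/-- `g` is a smooth Lorentzian metric of signature `(-,+,+,+)`. -/
structure IsLorentzMetric
    (g : ∀ p : M, TangentSpace (𝓡 4) p →L[ℝ] TangentSpace (𝓡 4) p →L[ℝ] ℝ) : Prop where
  symm : ∀ p v w, g p v w = g p w v
  exists_frame : ∀ p, ∃ v : Fin 4 → TangentSpace (𝓡 4) p, ∀ i j,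
    g p (v i) (v j) = if i = j then (if i = 0 then -1 else 1) else 0
  smooth : ContMDiff (𝓡 4) ((𝓡 4).prod 𝓘(ℝ, E4 →L[ℝ] E4 →L[ℝ] ℝ)) ∞
    (fun p => Bundle.TotalSpace.mk' (E4 →L[ℝ] E4 →L[ℝ] ℝ)
      (E := fun p : M => TangentSpace (𝓡 4) p →L[ℝ] TangentSpace (𝓡 4) p →L[ℝ] ℝ) p (g p))

/-- `ε` is a smooth volume form of the Lorentzian metric `g`: it takes the values `±1` on
orthonormal frames, that is, `ε(v₀,…,v₃)²` is minus the Gram determinant of `v₀,…,v₃`. -/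
structure IsVolumeForm
    (g : ∀ p : M, TangentSpace (𝓡 4) p →L[ℝ] TangentSpace (𝓡 4) p →L[ℝ] ℝ)
    (ε : ∀ p : M, TangentSpace (𝓡 4) p [⋀^Fin 4]→ₗ[ℝ] ℝ) : Prop where
  sq_eq : ∀ p (v : Fin 4 → TangentSpace (𝓡 4) p),
    (ε p v) ^ 2 = -(Matrix.of fun i j => g p (v i) (v j)).det
  smooth : ∀ e ∈ IsManifold.maximalAtlas (𝓡 4) ∞ M, ∀ a b m n,
    ContDiffOn ℝ ∞ (formComp ε e a b m n) e.target

/-- The Ricci curvature of `g` vanishes. -/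
def IsVacuum (g : ∀ p : M, TangentSpace (𝓡 4) p →L[ℝ] TangentSpace (𝓡 4) p →L[ℝ] ℝ) : Prop :=
  ∀ e ∈ IsManifold.maximalAtlas (𝓡 4) ∞ M, ∀ y ∈ e.target, ∀ i j,
    Coord.ricci (metricComp g e) i j y = 0

/-- `T` is a smooth Killing vector field: `D_α T_β + D_β T_α = 0`. -/
structure IsKilling (g : ∀ p : M, TangentSpace (𝓡 4) p →L[ℝ] TangentSpace (𝓡 4) p →L[ℝ] ℝ)
    (T : ∀ p : M, TangentSpace (𝓡 4) p) : Prop where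
  smooth : ContMDiff (𝓡 4) (𝓡 4).tangent ∞ (fun p => (⟨p, T p⟩ : TangentBundle (𝓡 4) M))
  killing : ∀ e ∈ IsManifold.maximalAtlas (𝓡 4) ∞ M, ∀ y ∈ e.target, ∀ a b,
    Coord.covDLower (metricComp g e) (vecComp T e) a b y
      + Coord.covDLower (metricComp g e) (vecComp T e) b a y = 0

/-- `σ` is an Ernst potential on the open set `U`: `D_μ σ = σ_μ` there. -/
structure IsErnstPotentialOn
    (g : ∀ p : M, TangentSpace (𝓡 4) p →L[ℝ] TangentSpace (𝓡 4) p →L[ℝ] ℝ)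
    (ε : ∀ p : M, TangentSpace (𝓡 4) p [⋀^Fin 4]→ₗ[ℝ] ℝ)
    (T : ∀ p : M, TangentSpace (𝓡 4) p) (U : Set M) (σ : M → ℂ) : Prop where
  mdifferentiableAt : ∀ p ∈ U, MDifferentiableAt (𝓡 4) 𝓘(ℝ, ℂ) σ p
  deriv_eq : ∀ e ∈ IsManifold.maximalAtlas (𝓡 4) ∞ M, ∀ y ∈ e.target, e.symm y ∈ U → ∀ m,
    Coord.pd m (σ ∘ e.symm) y = Coord.ernst (metricComp g e) (formComp ε e) (vecComp T e) m y

end Spacetime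

end

/-! Everything is local, so the proof runs in the coordinates of one chart. Write K(S) for the
contraction T^σ S_{σργδ}[…] on the right-hand side (`killingContraction`); it is linear in S. Three
facts about covariant derivatives and one algebraic identity suffice.

(a) 𝓡 is divergence-free (`divergence_RR`): for R this is the contracted second Bianchi identity
with Ric = 0, and for ⋆R it is the second Bianchi identity itself, read through the Hodge dual.

(b) D_μ 𝓕_{αβ} = T^λ 𝓡_{λμαβ} (`pd_FF`). The real part is the Killing identity. Since the volume
form is parallel, differentiating ⋆F produces the right dual of R, and for a Ricci-flat metric the
left and right duals agree (`starRiemann_pair`). Tracing shows that 𝓕 is divergence-free.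

(c) 𝓘 is parallel (`pd_II`). The product rule then gives D·𝓠 = -K(𝓡) (`divergence_QQ`); the term of
K with 𝓘 comes from differentiating 𝓕².

(d) 6 K(𝓠) = -σ^ρ 𝓠_{ρβμν} (`killingContraction_QQ`). This is pointwise algebra of self-dual
2-forms: the anticommutator of two of them is a multiple of the metric (`IsSelfDual.anticomm`), and
𝓘 acts as the identity on 𝓕 (`sum_II_mul_FFup`).

By (a) and (c), D·𝓢 = -6h⁻¹K(𝓡) - 6h⁻² D^ρh 𝓠_{ρβμν}. Replacing 𝓡 by 𝓢 - 6h⁻¹𝓠 creates 36h⁻²K(𝓠),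
which by (d) is exactly the σ part of the error term with E = Dh + σ. If h = 1 - σ for an Ernst
potential σ, then Dh cancels the Ernst 1-form and E = 0.

The connection and curvature are handled as 4×4 matrices A_i and R_ij, so that most index identities
become noncommutative ring identities; identities with the Levi-Civita symbol are settled by finite
enumeration or expansion. -/

namespace Coord

/-! ### Combinatorics of the Levi-Civita symbol and the linear algebra of 2-forms in dimension four.
-/

/-- The Levi-Civita symbol, normalized by `leviCivita 0 1 2 3 = 1`. -/
def leviCivita (a b c d : Fin 4) : ℤ :=
  Int.sign (((b.val : ℤ) - a.val) * ((c.val : ℤ) - a.val) * ((d.val : ℤ) - a.val) *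
    ((c.val : ℤ) - b.val) * ((d.val : ℤ) - b.val) * ((d.val : ℤ) - c.val))

/-- The symbol is the sign of a Vandermonde product of index differences: transpositions flip it and
repeated indices kill it. All its identities range over finitely many indices and are checked by
enumeration. -/
theorem leviCivita_perm (σ : Equiv.Perm (Fin 4)) :
    leviCivita (σ 0) (σ 1) (σ 2) (σ 3) = Equiv.Perm.sign σ := by
  revert σ; decide +kernel

theorem leviCivita_eq_zero : ∀ a b c d : Fin 4, ¬ Function.Injective ![a, b, c, d] →
    leviCivita a b c d = 0 := by
  decide +kernel

/-- The elementary matrix E_kl acts on the symbol as a derivation and multiplies it by its trace.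
Contracting with a connection matrix gives `trace_mul_leviCivita`, the source of the parallelism of
the volume form and of 𝓘. -/
theorem leviCivita_derivation : ∀ k l a b c d : Fin 4,
    (if k = l then leviCivita a b c d else 0) =
      (if l = a then leviCivita k b c d else 0) + (if l = b then leviCivita a k c d else 0) +
      (if l = c then leviCivita a b k d else 0) + (if l = d then leviCivita a b c k else 0) := by
  decide +kernel

theorem leviCivita_pair_swap : ∀ a b c d : Fin 4, leviCivita c d a b = leviCivita a b c d := by
  decide +kernel

theorem leviCivita_swap_left : ∀ a b c d : Fin 4, leviCivita b a c d = -leviCivita a b c d := by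
  decide +kernel

theorem leviCivita_swap_right : ∀ a b c d : Fin 4, leviCivita a b d c = -leviCivita a b c d := by
  decide +kernel

theorem leviCivita_cycle : ∀ a b c d : Fin 4, leviCivita a c d b = leviCivita a b c d := by
  decide +kernel

theorem leviCivita_contract : ∀ a b m n : Fin 4,
    ∑ c, ∑ d, leviCivita a b c d * leviCivita c d m n =
      2 * ((if a = m then 1 else 0) * (if b = n then 1 else 0) -
        (if a = n then 1 else 0) * (if b = m then 1 else 0)) := by
  decide +kernel

/-- An alternating 4-form on repeated vectors of a family `v`. -/
theorem _root_.AlternatingMap.apply_eq_leviCivita_mul {𝕜 V : Type*} [CommRing 𝕜] [AddCommGroup V]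
    [Module 𝕜 V] (φ : V [⋀^Fin 4]→ₗ[𝕜] 𝕜) (v : Fin 4 → V) (a b c d : Fin 4) :
    φ ![v a, v b, v c, v d] = (leviCivita a b c d : 𝕜) * φ v := by
  have hv : ![v a, v b, v c, v d] = v ∘ ![a, b, c, d] := by
    ext i; fin_cases i <;> rfl
  rw [hv]
  by_cases hinj : Function.Injective ![a, b, c, d]
  · have hbij := Finite.injective_iff_bijective.mp hinj
    have h1 := φ.map_perm v (Equiv.ofBijective _ hbij)
    have h2 := leviCivita_perm (Equiv.ofBijective _ hbij)
    have h3 : leviCivita a b c d = Equiv.Perm.sign (Equiv.ofBijective _ hbij) := h2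
    have h4 : (v ∘ (Equiv.ofBijective _ hbij)) = v ∘ ![a, b, c, d] := rfl
    rw [h4] at h1
    rw [h1, h3, Units.smul_def, zsmul_eq_mul]
  · rw [leviCivita_eq_zero _ _ _ _ hinj, φ.map_eq_zero_of_not_injective]
    · simp
    · intro h; exact hinj h.of_comp

theorem sum_leviCivita_eq_det {𝕜 : Type*} [Field 𝕜] (u : Fin 4 → Fin 4 → 𝕜) :
   ∑ a, ∑ b, ∑ c, ∑ d, (leviCivita a b c d : 𝕜) * (u 0 a * u 1 b * u 2 c * u 3 d) =
     Matrix.det (Matrix.of u) := by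
  -- Index differences reach 3 in absolute value, so the expanded symbol leaves signs of 2 and 3 to
  -- evaluate.
  have h2 : Int.sign 2 = 1 := rfl
  have h3 : Int.sign 3 = 1 := rfl
  simp [Fin.sum_univ_succ, leviCivita, Matrix.det_succ_row_zero, Fin.succAbove, h2, h3]
  ring

/-- `A_a^{a'} A_b^{b'} A_c^{c'} A_d^{d'} [a'b'c'd'] = det A [abcd]`. -/
theorem sum_leviCivita_mul_matrix {𝕜 : Type*} [Field 𝕜] (A : Matrix (Fin 4) (Fin 4) 𝕜)
    (a b c d : Fin 4) :
    ∑ a', ∑ b', ∑ c', ∑ d', (leviCivita a' b' c' d' : 𝕜) * (A a a' * A b b' * A c c' * A d d') =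
      (leviCivita a b c d : 𝕜) * A.det := by
  have h := (Matrix.detRowAlternating (R := 𝕜) (n := Fin 4)).apply_eq_leviCivita_mul A a b c d
  have h2 := sum_leviCivita_eq_det (𝕜 := 𝕜) ![A a, A b, A c, A d]
  exact h2.trans h

variable {𝕜 : Type*} [Field 𝕜]

/-- Cyclic permutations of three indices are even, so the three terms of the cyclic sum contribute
equally; three times the sum is therefore zero. This is how both Bianchi identities act on dual
tensors. -/
theorem sum_leviCivita_cyclic [CharZero 𝕜] (Z : Fin 4 → Fin 4 → Fin 4 → 𝕜)
    (hZ : ∀ a b c, Z a b c + Z b c a + Z c a b = 0) (e : Fin 4) :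
    ∑ a, ∑ b, ∑ c, (leviCivita e a b c : 𝕜) * Z a b c = 0 := by
  have h1 : ∑ a, ∑ b, ∑ c, (leviCivita e a b c : 𝕜) * Z b c a =
      ∑ a, ∑ b, ∑ c, (leviCivita e a b c : 𝕜) * Z a b c := by
    rw [Finset.sum_comm]
    refine Finset.sum_congr rfl fun a _ => ?_
    rw [Finset.sum_comm]
    refine Finset.sum_congr rfl fun b _ => Finset.sum_congr rfl fun c _ => ?_
    rw [leviCivita_cycle e c a b]
  have h2 : ∑ a, ∑ b, ∑ c, (leviCivita e a b c : 𝕜) * Z c a b =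
      ∑ a, ∑ b, ∑ c, (leviCivita e a b c : 𝕜) * Z a b c := by
    have : ∀ a, ∑ b, ∑ c, (leviCivita e a b c : 𝕜) * Z c a b =
      ∑ c, ∑ b, (leviCivita e a b c : 𝕜) * Z c a b := fun a => Finset.sum_comm
    simp only [this]
    rw [Finset.sum_comm]
    refine Finset.sum_congr rfl fun a _ => Finset.sum_congr rfl fun b _ =>
      Finset.sum_congr rfl fun c _ => ?_
    rw [← leviCivita_cycle e a b c]
  have h3 : ∑ a, ∑ b, ∑ c, (leviCivita e a b c : 𝕜) * (Z a b c + Z b c a + Z c a b) = 0 := by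
    simp [hZ]
  simp only [mul_add, Finset.sum_add_distrib, h1, h2] at h3
  linear_combination (1 / 3 : 𝕜) * h3

/-- `star X a b = ½ [abcd] X^{cd}`. -/
def star (X : Matrix (Fin 4) (Fin 4) 𝕜) : Matrix (Fin 4) (Fin 4) 𝕜 :=
  Matrix.of fun a b => (1 / 2 : 𝕜) * ∑ c, ∑ d, (leviCivita a b c d : 𝕜) * X c d

theorem star_apply (X : Matrix (Fin 4) (Fin 4) 𝕜) (a b : Fin 4) :
    star X a b = (1 / 2 : 𝕜) * ∑ c, ∑ d, (leviCivita a b c d : 𝕜) * X c d := rfl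

theorem star_transpose (X : Matrix (Fin 4) (Fin 4) 𝕜) : (star X).transpose = -star X := by
  ext a b
  simp [star_apply, leviCivita_swap_left a b, Finset.sum_neg_distrib]

theorem star_add (X Y : Matrix (Fin 4) (Fin 4) 𝕜) : star (X + Y) = star X + star Y := by
  ext a b
  simp only [star_apply, Matrix.add_apply, mul_add, Finset.sum_add_distrib]

theorem star_smul (k : 𝕜) (X : Matrix (Fin 4) (Fin 4) 𝕜) : star (k • X) = k • star X := by
  ext a b
  simp only [star_apply, Matrix.smul_apply, smul_eq_mul, Finset.mul_sum]
  refine Finset.sum_congr rfl fun c _ => Finset.sum_congr rfl fun d _ => ?_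
  ring

theorem star_neg (X : Matrix (Fin 4) (Fin 4) 𝕜) : star (-X) = -star X := by
  simpa using star_smul (-1) X

/-- A table in six independent components, which makes polynomial identities between 2-forms and
their duals checkable entry by entry. -/
theorem star_eq_of_transpose_eq_neg [CharZero 𝕜] (X : Matrix (Fin 4) (Fin 4) 𝕜)
    (hX : X.transpose = -X) :
    star X = !![0, X 2 3, -X 1 3, X 1 2; -X 2 3, 0, X 0 3, -X 0 2; X 1 3, -X 0 3, 0, X 0 1;
      -X 1 2, X 0 2, -X 0 1, 0] := by
  have h2 : Int.sign 2 = 1 := rfl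
  have h3 : Int.sign 3 = 1 := rfl
  have hX' : ∀ i j, X j i = - X i j := fun i j => congrFun (congrFun hX i) j
  ext s b
  fin_cases s <;> fin_cases b <;>
    simp [star_apply, Fin.sum_univ_succ, leviCivita, h2, h3, hX' 0 1, hX' 0 2,
      hX' 0 3, hX' 1 2, hX' 1 3, hX' 2 3] <;> ring

/-- For 2-vectors `X`, `Y` the anticommutator of `star X` and `Y`, symmetrized, is scalar. -/
theorem star_mul_add_star_mul [CharZero 𝕜] (X Y : Matrix (Fin 4) (Fin 4) 𝕜)
    (hX : X.transpose = -X) (hY : Y.transpose = -Y) (s b : Fin 4) :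
    ∑ r, (star X s r * Y b r + star Y s r * X b r) =
      (if s = b then 1 else 0) * (1 / 2 * ∑ c, ∑ d, star X c d * Y c d) := by
  rw [star_eq_of_transpose_eq_neg X hX, star_eq_of_transpose_eq_neg Y hY]
  have hX' : ∀ i j, X j i = - X i j := fun i j => congrFun (congrFun hX i) j
  have hY' : ∀ i j, Y j i = - Y i j := fun i j => congrFun (congrFun hY i) j
  have hx : ∀ i, X i i = 0 := fun i => self_eq_neg.mp (hX' i i)
  have hy : ∀ i, Y i i = 0 := fun i => self_eq_neg.mp (hY' i i)
  simp only [Fin.sum_univ_four]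
  fin_cases s <;> fin_cases b <;>
    simp [hx, hy, hX' 0 1, hX' 0 2, hX' 0 3, hX' 1 2, hX' 1 3, hX' 2 3, hY' 0 1, hY' 0 2, hY' 0 3,
      hY' 1 2, hY' 1 3, hY' 2 3] <;>
    ring

/-- The left and the right duals of a trace-free double 2-form agree. -/
theorem star_comm_of_trace_eq_zero [CharZero 𝕜]
    (Y : Fin 4 → Fin 4 → Matrix (Fin 4) (Fin 4) 𝕜)
    (h1 : ∀ m n, (Y m n).transpose = -Y m n) (h2 : ∀ m n, Y n m = -Y m n)
    (h0 : ∀ d n, ∑ c, Y c n c d = 0) (a b m n : Fin 4) :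
    star (Y m n) a b = star (Y a b) m n := by
  have h1' : ∀ m n i j, Y m n j i = - Y m n i j := fun m n i j => congrFun (congrFun (h1 m n) i) j
  have h2' : ∀ m n i j, Y n m i j = - Y m n i j := fun m n i j => congrFun (congrFun (h2 m n) i) j
  have h11 : ∀ m n i, Y m n i i = 0 := fun m n i => self_eq_neg.mp (h1' m n i i)
  have h22 : ∀ m i j, Y m m i j = 0 := fun m i j => self_eq_neg.mp (h2' m m i j)
  have t00 := h0 0 0
  have t01 := h0 0 1
  have t02 := h0 0 2
  have t03 := h0 0 3
  have t10 := h0 1 0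
  have t11 := h0 1 1
  have t12 := h0 1 2
  have t13 := h0 1 3
  have t20 := h0 2 0
  have t21 := h0 2 1
  have t22 := h0 2 2
  have t23 := h0 2 3
  have t30 := h0 3 0
  have t31 := h0 3 1
  have t32 := h0 3 2
  have t33 := h0 3 3
  have e1 : ∀ i j, Y i j 1 0 = - Y i j 0 1 := fun i j => h1' i j 0 1
  have e2 : ∀ i j, Y i j 2 0 = - Y i j 0 2 := fun i j => h1' i j 0 2
  have e3 : ∀ i j, Y i j 3 0 = - Y i j 0 3 := fun i j => h1' i j 0 3
  have e4 : ∀ i j, Y i j 2 1 = - Y i j 1 2 := fun i j => h1' i j 1 2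
  have e5 : ∀ i j, Y i j 3 1 = - Y i j 1 3 := fun i j => h1' i j 1 3
  have e6 : ∀ i j, Y i j 3 2 = - Y i j 2 3 := fun i j => h1' i j 2 3
  simp only [Fin.sum_univ_four, h11, h22, e1, e2, e3, e4, e5, e6, h2' 0 1, h2' 0 2, h2' 0 3,
    h2' 1 2, h2' 1 3, h2' 2 3] at t00 t01 t02 t03 t10 t11 t12 t13 t20 t21 t22 t23 t30 t31 t32 t33
  -- By antisymmetry only 36 cases remain, each a linear consequence of the sixteen trace equations.
  -- Conceptually, the trace-free double forms are the 20-dimensional irreducible part of Λ² ⊗ Λ²,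
  -- and that part is symmetric under exchange of the pairs.
  have key : ∀ a b m n : Fin 4, a < b → m < n → star (Y m n) a b = star (Y a b) m n := by
    intro a b m n hab hmn
    rw [star_eq_of_transpose_eq_neg _ (h1 m n), star_eq_of_transpose_eq_neg _ (h1 a b)]
    fin_cases a <;> fin_cases b <;> simp at hab <;>
    fin_cases m <;> fin_cases n <;> simp at hmn <;> simp <;> grind
  have hs : ∀ m n a b, star (Y m n) b a = -star (Y m n) a b := fun m n a b =>
    congrFun (congrFun (star_transpose (Y m n)) a) b
  have hs' : ∀ m n a b, star (Y n m) a b = -star (Y m n) a b := fun m n a b => by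
    rw [h2 m n, star_neg]; rfl
  have hs0 : ∀ m n a, star (Y m n) a a = 0 := fun m n a => self_eq_neg.mp (hs m n a a)
  have hs0' : ∀ m a b, star (Y m m) a b = 0 := fun m a b => self_eq_neg.mp (hs' m m a b)
  rcases lt_trichotomy a b with hab | rfl | hab
  · rcases lt_trichotomy m n with hmn | rfl | hmn
    · exact key a b m n hab hmn
    · rw [hs0, hs0']
    · rw [hs', hs _ _ n m, key a b n m hab hmn]
  · rw [hs0, hs0']
  · rcases lt_trichotomy m n with hmn | rfl | hmn
    · rw [hs m n b a, hs' b a m n, key b a m n hab hmn]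
    · rw [hs0, hs0']
    · rw [hs' n m a b, hs n m b a, hs' b a m n, hs b a n m, key b a n m hab hmn]

end Coord

noncomputable section
namespace Coord

/-! ### Partial derivatives -/

section PartialDerivatives

variable {V : Type*} [NormedAddCommGroup V] [NormedSpace ℝ V] {y : E4} {Ω : Set E4}

theorem pd_congr {f g : E4 → V} (h : f =ᶠ[𝓝 y] g) (i : Fin 4) : pd i f y = pd i g y := by
  rw [pd, pd, h.fderiv_eq]

theorem pd_congr_on {f g : E4 → V} (hΩ : IsOpen Ω) (hy : y ∈ Ω) (h : ∀ z ∈ Ω, f z = g z)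
    (i : Fin 4) : pd i f y = pd i g y :=
  pd_congr (Filter.eventuallyEq_of_mem (hΩ.mem_nhds hy) h) i

theorem pd_const (i : Fin 4) (c : V) : pd i (fun _ => c) y = 0 := by
  simp [pd]

theorem pd_add {f g : E4 → V} (hf : DifferentiableAt ℝ f y) (hg : DifferentiableAt ℝ g y)
    (i : Fin 4) : pd i (fun z => f z + g z) y = pd i f y + pd i g y := by
  simp only [pd]; rw [fderiv_fun_add hf hg]; rfl

theorem pd_sub {f g : E4 → V} (hf : DifferentiableAt ℝ f y) (hg : DifferentiableAt ℝ g y)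
    (i : Fin 4) : pd i (fun z => f z - g z) y = pd i f y - pd i g y := by
  simp only [pd]; rw [fderiv_fun_sub hf hg]; rfl

theorem pd_neg (f : E4 → V) (i : Fin 4) : pd i (fun z => -f z) y = -pd i f y := by
  simp only [pd]; rw [fderiv_fun_neg]; rfl

theorem pd_sum {ι : Type*} (s : Finset ι) {f : ι → E4 → V}
    (hf : ∀ k ∈ s, DifferentiableAt ℝ (f k) y) (i : Fin 4) :
    pd i (fun z => ∑ k ∈ s, f k z) y = ∑ k ∈ s, pd i (f k) y := by
  simp only [pd]; rw [fderiv_fun_sum hf]; simp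

theorem pd_mul {𝕜 : Type*} [NormedField 𝕜] [NormedAlgebra ℝ 𝕜] {f g : E4 → 𝕜}
    (hf : DifferentiableAt ℝ f y) (hg : DifferentiableAt ℝ g y) (i : Fin 4) :
    pd i (fun z => f z * g z) y = pd i f y * g y + f y * pd i g y := by
  simp only [pd]; rw [fderiv_fun_mul hf hg]; simp; ring

theorem pd_const_mul {𝕜 : Type*} [NormedField 𝕜] [NormedAlgebra ℝ 𝕜] {f : E4 → 𝕜}
    (hf : DifferentiableAt ℝ f y) (c : 𝕜) (i : Fin 4) :
    pd i (fun z => c * f z) y = c * pd i f y := by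
  rw [pd_mul (differentiableAt_const c) hf, pd_const, zero_mul, zero_add]

theorem pd_ofReal {f : E4 → ℝ} (hf : DifferentiableAt ℝ f y) (i : Fin 4) :
    pd i (fun z => (f z : ℂ)) y = ((pd i f y : ℝ) : ℂ) := by
  have h := (Complex.ofRealCLM.hasFDerivAt (x := f y)).comp y hf.hasFDerivAt
  simp only [pd]
  have h2 : fderiv ℝ (fun z => (f z : ℂ)) y = _ := h.fderiv
  rw [h2]; rfl

theorem contDiffOn_pd {f : E4 → V} (hΩ : IsOpen Ω) (hf : ContDiffOn ℝ ∞ f Ω) (i : Fin 4) :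
    ContDiffOn ℝ ∞ (pd i f) Ω :=
  (hf.fderiv_of_isOpen hΩ (m := ∞) (by simp)).clm_apply contDiffOn_const

theorem differentiableAt_of_contDiffOn {f : E4 → V} (hΩ : IsOpen Ω) (hf : ContDiffOn ℝ ∞ f Ω)
    (hy : y ∈ Ω) : DifferentiableAt ℝ f y :=
  (hf.contDiffAt (hΩ.mem_nhds hy)).differentiableAt (by simp)

theorem pd_comm {f : E4 → V} (hΩ : IsOpen Ω) (hf : ContDiffOn ℝ ∞ f Ω) (hy : y ∈ Ω) (i j : Fin 4) :
    pd i (pd j f) y = pd j (pd i f) y := by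
  have hs : IsSymmSndFDerivAt ℝ f y :=
    (hf.contDiffAt (hΩ.mem_nhds hy)).isSymmSndFDerivAt
      (by simpa using WithTop.coe_le_coe.2 (le_top : (2 : ℕ∞) ≤ ⊤))
  have hd : DifferentiableAt ℝ (fderiv ℝ f) y :=
    differentiableAt_of_contDiffOn hΩ (hf.fderiv_of_isOpen hΩ (m := ∞) (by simp)) hy
  have key : ∀ i j, pd i (pd j f) y =
      fderiv ℝ (fderiv ℝ f) y (EuclideanSpace.single i 1) (EuclideanSpace.single j 1) := by
    intro i j
    have : pd j f = fun z => fderiv ℝ f z (EuclideanSpace.single j 1) := rfl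
    rw [this, pd, fderiv_clm_apply hd (differentiableAt_const _)]
    simp
  rw [key, key]
  exact hs _ _

end PartialDerivatives

/-! ### Partial derivatives of matrices -/

section MatrixDerivatives

variable {𝕜 : Type*} [NormedField 𝕜] [NormedAlgebra ℝ 𝕜] {y : E4} {Ω : Set E4}

/-- The entrywise partial derivative of a matrix-valued function. -/
def pdMatrix (i : Fin 4) (w : E4 → Matrix (Fin 4) (Fin 4) 𝕜) (y : E4) :
    Matrix (Fin 4) (Fin 4) 𝕜 :=
  Matrix.of fun a b => pd i (fun z => w z a b) y

/-- Entrywise differentiability of a matrix-valued function. -/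
def MatrixDiffAt (w : E4 → Matrix (Fin 4) (Fin 4) 𝕜) (y : E4) : Prop :=
  ∀ a b, DifferentiableAt ℝ (fun z => w z a b) y

/-- Entrywise smoothness of a matrix-valued function. -/
def MatrixSmoothOn (w : E4 → Matrix (Fin 4) (Fin 4) 𝕜) (Ω : Set E4) : Prop :=
  ∀ a b, ContDiffOn ℝ ∞ (fun z => w z a b) Ω

variable {w v : E4 → Matrix (Fin 4) (Fin 4) 𝕜}

theorem pdMatrix_apply (i : Fin 4) (w : E4 → Matrix (Fin 4) (Fin 4) 𝕜) (y : E4) (a b : Fin 4) :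
    pdMatrix i w y a b = pd i (fun z => w z a b) y := rfl

theorem pdMatrix_congr_on (hΩ : IsOpen Ω) (hy : y ∈ Ω) (h : ∀ z ∈ Ω, w z = v z) (i : Fin 4) :
    pdMatrix i w y = pdMatrix i v y := by
  ext a b
  exact pd_congr_on hΩ hy (fun z hz => by rw [h z hz]) i

theorem pdMatrix_const (i : Fin 4) (c : Matrix (Fin 4) (Fin 4) 𝕜) :
    pdMatrix i (fun _ => c) y = 0 := by
  ext a b; exact pd_const i _

theorem pdMatrix_add (hw : MatrixDiffAt w y) (hv : MatrixDiffAt v y) (i : Fin 4) :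
    pdMatrix i (fun z => w z + v z) y = pdMatrix i w y + pdMatrix i v y := by
  ext a b; exact pd_add (hw a b) (hv a b) i

theorem pdMatrix_sub (hw : MatrixDiffAt w y) (hv : MatrixDiffAt v y) (i : Fin 4) :
    pdMatrix i (fun z => w z - v z) y = pdMatrix i w y - pdMatrix i v y := by
  ext a b; exact pd_sub (hw a b) (hv a b) i

theorem pdMatrix_transpose (w : E4 → Matrix (Fin 4) (Fin 4) 𝕜) (i : Fin 4) :
    pdMatrix i (fun z => (w z).transpose) y = (pdMatrix i w y).transpose := rfl

theorem pdMatrix_mul (hw : MatrixDiffAt w y) (hv : MatrixDiffAt v y) (i : Fin 4) :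
    pdMatrix i (fun z => w z * v z) y = pdMatrix i w y * v y + w y * pdMatrix i v y := by
  ext a b
  simp only [pdMatrix_apply, Matrix.add_apply, Matrix.mul_apply]
  rw [pd_sum _ (f := fun k z => w z a k * v z k b) (fun k _ => (hw a k).mul (hv k b)), ← Finset.sum_add_distrib]
  exact Finset.sum_congr rfl fun k _ => pd_mul (hw a k) (hv k b) i

theorem MatrixDiffAt.sub (hw : MatrixDiffAt w y) (hv : MatrixDiffAt v y) :
    MatrixDiffAt (fun z => w z - v z) y := fun a b => (hw a b).sub (hv a b)

theorem MatrixDiffAt.transpose (hw : MatrixDiffAt w y) :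
    MatrixDiffAt (fun z => (w z).transpose) y := fun a b => hw b a

theorem MatrixDiffAt.mul (hw : MatrixDiffAt w y) (hv : MatrixDiffAt v y) :
    MatrixDiffAt (fun z => w z * v z) y := by
  intro a b
  simp only [Matrix.mul_apply]
  exact DifferentiableAt.fun_sum fun k _ => (hw a k).mul (hv k b)

theorem MatrixSmoothOn.diffAt (hw : MatrixSmoothOn w Ω) (hΩ : IsOpen Ω) (hy : y ∈ Ω) :
    MatrixDiffAt w y := fun a b => differentiableAt_of_contDiffOn hΩ (hw a b) hy

theorem MatrixSmoothOn.add (hw : MatrixSmoothOn w Ω) (hv : MatrixSmoothOn v Ω) :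
    MatrixSmoothOn (fun z => w z + v z) Ω := fun a b => (hw a b).add (hv a b)

theorem MatrixSmoothOn.sub (hw : MatrixSmoothOn w Ω) (hv : MatrixSmoothOn v Ω) :
    MatrixSmoothOn (fun z => w z - v z) Ω := fun a b => (hw a b).sub (hv a b)

theorem MatrixSmoothOn.transpose (hw : MatrixSmoothOn w Ω) :
    MatrixSmoothOn (fun z => (w z).transpose) Ω := fun a b => hw b a

theorem MatrixSmoothOn.mul (hw : MatrixSmoothOn w Ω) (hv : MatrixSmoothOn v Ω) :
    MatrixSmoothOn (fun z => w z * v z) Ω := by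
  intro a b
  simp only [Matrix.mul_apply]
  exact ContDiffOn.sum fun k _ => (hw a k).mul (hv k b)

theorem MatrixSmoothOn.pdMatrix (hw : MatrixSmoothOn w Ω) (hΩ : IsOpen Ω) (i : Fin 4) :
    MatrixSmoothOn (pdMatrix i w) Ω := fun a b => contDiffOn_pd hΩ (hw a b) i

theorem pdMatrix_comm (hw : MatrixSmoothOn w Ω) (hΩ : IsOpen Ω) (hy : y ∈ Ω) (i j : Fin 4) :
    pdMatrix i (pdMatrix j w) y = pdMatrix j (pdMatrix i w) y := by
  ext a b; exact pd_comm hΩ (hw a b) hy i j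

end MatrixDerivatives

/-! ### The Levi-Civita connection and its curvature -/

/-- `G` is a smooth nondegenerate symmetric matrix on the open set `Ω`. -/
structure IsMetricOn (G : E4 → Matrix (Fin 4) (Fin 4) ℝ) (Ω : Set E4) : Prop where
  isOpen : IsOpen Ω
  smooth : MatrixSmoothOn G Ω
  symm : ∀ z ∈ Ω, (G z).transpose = G z
  det_ne_zero : ∀ z ∈ Ω, (G z).det ≠ 0

/-- The connection matrix `(A_i)^k_l = Γ^k_{il}`. -/
def conn (G : E4 → Matrix (Fin 4) (Fin 4) ℝ) (i : Fin 4) (y : E4) : Matrix (Fin 4) (Fin 4) ℝ :=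
  Matrix.of fun k l => christoffel G k i l y

/-- The curvature matrix `(R_{ij})^k_l = R^k_{lij}`. -/
def curv (G : E4 → Matrix (Fin 4) (Fin 4) ℝ) (i j : Fin 4) (y : E4) : Matrix (Fin 4) (Fin 4) ℝ :=
  Matrix.of fun k l => riemannUp G k l i j y

theorem conn_apply (G : E4 → Matrix (Fin 4) (Fin 4) ℝ) (i k l : Fin 4) (y : E4) :
    conn G i y k l = christoffel G k i l y := rfl

theorem curv_apply (G : E4 → Matrix (Fin 4) (Fin 4) ℝ) (i j k l : Fin 4) (y : E4) :
    curv G i j y k l = riemannUp G k l i j y := rfl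

theorem riemann_eq (G : E4 → Matrix (Fin 4) (Fin 4) ℝ) (i j k l : Fin 4) (y : E4) :
    riemann G k l i j y = (G y * curv G i j y) k l := by
  rw [Matrix.mul_apply]; rfl

/-- The structure equation R = dA + A ∧ A. In this form the symmetries of the curvature and the
second Bianchi identity reduce to matrix algebra and the symmetry of second derivatives. -/
theorem curv_eq (G : E4 → Matrix (Fin 4) (Fin 4) ℝ) (i j : Fin 4) (y : E4) :
    curv G i j y = pdMatrix i (conn G j) y - pdMatrix j (conn G i) y
      + (conn G i y * conn G j y - conn G j y * conn G i y) := by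
  ext k l
  simp only [curv_apply, riemannUp, Matrix.add_apply, Matrix.sub_apply, Matrix.mul_apply,
    Finset.sum_sub_distrib]
  rfl

namespace IsMetricOn

variable {G : E4 → Matrix (Fin 4) (Fin 4) ℝ} {Ω : Set E4} (hG : IsMetricOn G Ω) {y : E4}
include hG

theorem smooth_inv : MatrixSmoothOn (fun z => (G z)⁻¹) Ω := by
  have hdet : ∀ w : E4 → Matrix (Fin 4) (Fin 4) ℝ, MatrixSmoothOn w Ω →
      ContDiffOn ℝ ∞ (fun z => (w z).det) Ω := by
    intro w hw
    simp only [Matrix.det_apply']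
    exact ContDiffOn.sum fun σ _ => contDiffOn_const.mul (contDiffOn_prod fun i _ => hw _ _)
  intro a b
  simp only [Matrix.inv_def, Matrix.smul_apply, Ring.inverse_eq_inv', smul_eq_mul,
    Matrix.adjugate_apply]
  -- Cramer's rule: an adjugate entry is the determinant of the matrix with one row replaced by a
  -- constant basis vector.
  refine ((hdet _ hG.smooth).inv hG.det_ne_zero).mul (hdet _ fun c d => ?_)
  by_cases h : c = b
  · subst h; simpa using contDiffOn_const
  · simpa [Matrix.updateRow_ne h] using hG.smooth c d

theorem inv_mul (hy : y ∈ Ω) : (G y)⁻¹ * G y = 1 :=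
  Matrix.nonsing_inv_mul _ (hG.det_ne_zero y hy).isUnit

theorem mul_inv (hy : y ∈ Ω) : G y * (G y)⁻¹ = 1 :=
  Matrix.mul_nonsing_inv _ (hG.det_ne_zero y hy).isUnit

theorem symm_apply (hy : y ∈ Ω) (a b : Fin 4) : G y a b = G y b a :=
  congrFun (congrFun (hG.symm y hy) b) a

theorem inv_symm (hy : y ∈ Ω) : ((G y)⁻¹).transpose = (G y)⁻¹ := by
  rw [Matrix.transpose_nonsing_inv, hG.symm y hy]

theorem gInv_symm (hy : y ∈ Ω) (a b : Fin 4) : gInv G y a b = gInv G y b a :=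
  congrFun (congrFun (hG.inv_symm hy) b) a

theorem pd_symm (hy : y ∈ Ω) (i a b : Fin 4) :
    pd i (fun z => G z a b) y = pd i (fun z => G z b a) y :=
  pd_congr_on hG.isOpen hy (fun _ hz => hG.symm_apply hz a b) i

theorem smooth_conn (i : Fin 4) : MatrixSmoothOn (conn G i) Ω := by
  intro k l
  simp only [conn_apply, christoffel, gInv]
  have h := fun i a b => contDiffOn_pd hG.isOpen (hG.smooth a b) i
  exact contDiffOn_const.mul (ContDiffOn.sum fun m _ => (hG.smooth_inv k m).mul
    (((h i l m).add (h l i m)).sub (h m i l)))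

theorem christoffel_symm (hy : y ∈ Ω) (k i j : Fin 4) :
    christoffel G k i j y = christoffel G k j i y := by
  simp only [christoffel]
  congr 1
  refine Finset.sum_congr rfl fun l _ => ?_
  rw [hG.pd_symm hy l i j]
  ring

/-- Lowering the upper index cancels the inverse metric and leaves the Christoffel symbols of the
first kind. -/
theorem sum_mul_christoffel (hy : y ∈ Ω) (m i j : Fin 4) :
    ∑ k, G y m k * christoffel G k i j y = (1 / 2 : ℝ) *
      (pd i (fun z => G z j m) y + pd j (fun z => G z i m) y - pd m (fun z => G z i j) y) := by
  simp only [christoffel, gInv, Finset.mul_sum]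
  rw [Finset.sum_comm]
  have : ∀ l, ∑ k, G y m k * (1 / 2 * ((G y)⁻¹ k l *
      (pd i (fun z => G z j l) y + pd j (fun z => G z i l) y - pd l (fun z => G z i j) y))) =
      (G y * (G y)⁻¹) m l * (1 / 2 * (pd i (fun z => G z j l) y + pd j (fun z => G z i l) y -
        pd l (fun z => G z i j) y)) := by
    intro l
    rw [Matrix.mul_apply, Finset.sum_mul]
    exact Finset.sum_congr rfl fun k _ => by ring
  simp only [this, hG.mul_inv hy, Matrix.one_apply, ite_mul, one_mul, zero_mul]
  simp

/-- The connection is compatible with the metric. -/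
theorem pdMatrix_metric (hy : y ∈ Ω) (i : Fin 4) :
    pdMatrix i G y = (conn G i y).transpose * G y + G y * conn G i y := by
  ext a b
  simp only [Matrix.add_apply, Matrix.mul_apply, Matrix.transpose_apply, conn_apply]
  have h1 : ∑ k, christoffel G k i a y * G y k b = ∑ k, G y b k * christoffel G k i a y :=
    Finset.sum_congr rfl fun k _ => by rw [hG.symm_apply hy k b, mul_comm]
  rw [h1, hG.sum_mul_christoffel hy, hG.sum_mul_christoffel hy, pdMatrix_apply,
    hG.pd_symm hy i b a, hG.pd_symm hy a i b, hG.pd_symm hy b i a]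
  ring

/-- Obtained by differentiating G⁻¹G = 1 and inserting metric compatibility. -/
theorem pdMatrix_inv (hy : y ∈ Ω) (i : Fin 4) :
    pdMatrix i (fun z => (G z)⁻¹) y =
      -(conn G i y * (G y)⁻¹ + (G y)⁻¹ * (conn G i y).transpose) := by
  have h := pdMatrix_mul (hG.smooth_inv.diffAt hG.isOpen hy) (hG.smooth.diffAt hG.isOpen hy) i
  rw [pdMatrix_congr_on hG.isOpen hy (v := fun _ => 1) (fun z hz => hG.inv_mul hz),
    pdMatrix_const, hG.pdMatrix_metric hy] at h
  have h2 := congrArg (· * (G y)⁻¹) h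
  simp only [Matrix.zero_mul, Matrix.add_mul, Matrix.mul_add, Matrix.mul_assoc, hG.mul_inv hy,
    Matrix.mul_one] at h2
  rw [← Matrix.mul_assoc ((G y)⁻¹) (G y), hG.inv_mul hy, Matrix.one_mul] at h2
  refine eq_of_sub_eq_zero (Eq.trans ?_ h2.symm)
  abel

theorem smooth_curv (i j : Fin 4) : MatrixSmoothOn (curv G i j) Ω := by
  have : curv G i j = fun y => _ := funext fun y => curv_eq G i j y
  rw [this]
  have h := hG.smooth_conn
  exact (((h j).pdMatrix hG.isOpen i).sub ((h i).pdMatrix hG.isOpen j)).add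
    (((h i).mul (h j)).sub ((h j).mul (h i)))

omit hG in
theorem curv_antisymm (i j : Fin 4) (y : E4) : curv G j i y = -curv G i j y := by
  rw [curv_eq, curv_eq]; abel

/-- Antisymmetry of the curvature in the first pair of indices. -/
theorem transpose_metric_mul_curv (hy : y ∈ Ω) (i j : Fin 4) :
    (G y * curv G i j y).transpose = -(G y * curv G i j y) := by
  have hGd := hG.smooth.diffAt hG.isOpen hy
  have hAd := fun i => (hG.smooth_conn i).diffAt hG.isOpen hy
  have h2 : ∀ i j, pdMatrix i (pdMatrix j G) y =
      (pdMatrix i (conn G j) y).transpose * G y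
        + (conn G j y).transpose * ((conn G i y).transpose * G y + G y * conn G i y)
      + (((conn G i y).transpose * G y + G y * conn G i y) * conn G j y
        + G y * pdMatrix i (conn G j) y) := by
    intro i j
    rw [pdMatrix_congr_on hG.isOpen hy (fun z hz => hG.pdMatrix_metric hz j),
      pdMatrix_add ((hAd j).transpose.mul hGd) (hGd.mul (hAd j)),
      pdMatrix_mul (hAd j).transpose hGd, pdMatrix_mul hGd (hAd j), pdMatrix_transpose,
      hG.pdMatrix_metric hy]
  -- The two orders of second derivatives of G, both computed from metric compatibility, differ by G
  -- R_ij plus its transpose.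
  have h3 := pdMatrix_comm hG.smooth hG.isOpen hy i j
  rw [h2, h2] at h3
  rw [Matrix.transpose_mul, hG.symm y hy, curv_eq]
  simp only [Matrix.transpose_add, Matrix.transpose_sub, Matrix.transpose_mul, Matrix.mul_add,
    Matrix.add_mul, Matrix.mul_sub, Matrix.sub_mul, Matrix.mul_assoc] at h3 ⊢
  refine eq_of_sub_eq_zero (Eq.trans ?_ (sub_eq_zero.mpr h3))
  abel

/-- The first Bianchi identity. -/
theorem curv_cyclic (hy : y ∈ Ω) (k l i j : Fin 4) :
    curv G i j y k l + curv G j l y k i + curv G l i y k j = 0 := by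
  -- Only vanishing torsion is used: with Γ symmetric, the derivative terms and the quadratic terms
  -- each cancel in cyclic order.
  have hs : ∀ i k a b, pd i (christoffel G k a b) y = pd i (christoffel G k b a) y :=
    fun i k a b => pd_congr_on hG.isOpen hy (fun z hz => hG.christoffel_symm hz k a b) i
  simp only [curv_apply, riemannUp]
  rw [hs i k l j, hs j k i l, hs l k j i]
  have hsum : ∀ a b c : Fin 4 → ℝ, (∀ m, a m + b m + c m = 0) → ∀ A B C : ℝ,
      A - B + ∑ m, a m + (B - C + ∑ m, b m) + (C - A + ∑ m, c m) = 0 := by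
    intro a b c h A B C
    have h' : ∑ m, (a m + b m + c m) = 0 := Finset.sum_eq_zero fun m _ => h m
    simp only [Finset.sum_add_distrib] at h'
    linear_combination h'
  refine hsum _ _ _ (fun m => ?_) _ _ _
  rw [hG.christoffel_symm hy m l i, hG.christoffel_symm hy m j l, hG.christoffel_symm hy m i j]
  ring

/-- The second Bianchi identity, in terms of the connection matrices. -/
theorem pdMatrix_curv_cyclic (hy : y ∈ Ω) (r i j : Fin 4) :
    (pdMatrix r (curv G i j) y + conn G r y * curv G i j y - curv G i j y * conn G r y) +
    (pdMatrix i (curv G j r) y + conn G i y * curv G j r y - curv G j r y * conn G i y) +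
    (pdMatrix j (curv G r i) y + conn G j y * curv G r i y - curv G r i y * conn G j y) = 0 := by
  have hs := hG.smooth_conn
  have hA := fun i => (hs i).diffAt hG.isOpen hy
  have hdA := fun i j => ((hs j).pdMatrix hG.isOpen i).diffAt hG.isOpen hy
  have h : ∀ r i j, pdMatrix r (curv G i j) y =
      pdMatrix r (pdMatrix i (conn G j)) y - pdMatrix r (pdMatrix j (conn G i)) y +
      ((pdMatrix r (conn G i) y * conn G j y + conn G i y * pdMatrix r (conn G j) y) -
      (pdMatrix r (conn G j) y * conn G i y + conn G j y * pdMatrix r (conn G i) y)) := by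
    intro r i j
    rw [pdMatrix_congr_on hG.isOpen hy (fun z _ => curv_eq G i j z),
      pdMatrix_add ((hdA i j).sub (hdA j i)) (((hA i).mul (hA j)).sub ((hA j).mul (hA i))),
      pdMatrix_sub (hdA i j) (hdA j i), pdMatrix_sub ((hA i).mul (hA j)) ((hA j).mul (hA i)),
      pdMatrix_mul (hA i) (hA j), pdMatrix_mul (hA j) (hA i)]
  -- Once the second derivatives of A are matched, what remains is the Jacobi identity for the
  -- connection matrices and the Leibniz terms.
  rw [h, h, h, curv_eq, curv_eq, curv_eq, pdMatrix_comm (hs j) hG.isOpen hy i r,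
    pdMatrix_comm (hs i) hG.isOpen hy j r, pdMatrix_comm (hs r) hG.isOpen hy j i]
  noncomm_ring

end IsMetricOn
end Coord
end

/-! ### Derivatives of determinants and infinitesimal equivariance of the dual. -/

noncomputable section
namespace Coord

/-- The derivative of the determinant in the direction `B W + W A`. -/
theorem sum_leviCivita_deriv {𝕜 : Type*} [Field 𝕜] (W A B W' : Matrix (Fin 4) (Fin 4) 𝕜)
    (h : W' = B * W + W * A) :
    ∑ a, ∑ b, ∑ c, ∑ d, (leviCivita a b c d : 𝕜) *
      (W' 0 a * W 1 b * W 2 c * W 3 d + W 0 a * W' 1 b * W 2 c * W 3 d +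
        W 0 a * W 1 b * W' 2 c * W 3 d + W 0 a * W 1 b * W 2 c * W' 3 d) =
      (A.trace + B.trace) * W.det := by
  have h2 : Int.sign 2 = 1 := rfl
  have h3 : Int.sign 3 = 1 := rfl
  rw [← show _ = W.det from sum_leviCivita_eq_det W]
  have hW : ∀ i j, W' i j = B i 0 * W 0 j + B i 1 * W 1 j + B i 2 * W 2 j + B i 3 * W 3 j +
    (W i 0 * A 0 j + W i 1 * A 1 j + W i 2 * A 2 j + W i 3 * A 3 j) := by
    intro i j; simp [h, Matrix.mul_apply, Fin.sum_univ_four]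
  simp [Fin.sum_univ_succ, leviCivita, h2, h3, Matrix.trace]
  simp only [hW]
  ring

/-- Jacobi's formula in a form that needs no inverse. For the metric, ∂G = AᵀG + GA, so the
derivative of det G is 2 tr A · det G. -/
theorem pd_det {y : E4} {w : E4 → Matrix (Fin 4) (Fin 4) ℝ} (hw : MatrixDiffAt w y)
    (A B : Matrix (Fin 4) (Fin 4) ℝ) (r : Fin 4) (h : pdMatrix r w y = B * w y + w y * A) :
    pd r (fun z => (w z).det) y = (A.trace + B.trace) * (w y).det := by
  rw [← sum_leviCivita_deriv (w y) A B _ h]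
  have h1 : (fun z => (w z).det) = fun z => ∑ a, ∑ b, ∑ c, ∑ d, (leviCivita a b c d : ℝ) *
      (w z 0 a * w z 1 b * w z 2 c * w z 3 d) := funext fun z => (sum_leviCivita_eq_det _).symm
  have hd : ∀ a b c d, DifferentiableAt ℝ (fun z => (leviCivita a b c d : ℝ) *
      (w z 0 a * w z 1 b * w z 2 c * w z 3 d)) y := fun a b c d =>
    ((((hw 0 a).mul (hw 1 b)).mul (hw 2 c)).mul (hw 3 d)).const_mul _
  rw [h1, pd_sum _ fun a _ => .fun_sum fun b _ => .fun_sum fun c _ => .fun_sum fun d _ => hd a b c d]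
  refine Finset.sum_congr rfl fun a _ => ?_
  rw [pd_sum _ fun b _ => .fun_sum fun c _ => .fun_sum fun d _ => hd a b c d]
  refine Finset.sum_congr rfl fun b _ => ?_
  rw [pd_sum _ fun c _ => .fun_sum fun d _ => hd a b c d]
  refine Finset.sum_congr rfl fun c _ => ?_
  rw [pd_sum _ fun d _ => hd a b c d]
  refine Finset.sum_congr rfl fun d _ => ?_
  rw [pd_const_mul (((((hw 0 a).fun_mul (hw 1 b)).fun_mul (hw 2 c)).fun_mul (hw 3 d))),
    pd_mul (((hw 0 a).fun_mul (hw 1 b)).fun_mul (hw 2 c)) (hw 3 d),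
    pd_mul ((hw 0 a).fun_mul (hw 1 b)) (hw 2 c), pd_mul (hw 0 a) (hw 1 b)]
  simp only [pdMatrix_apply]
  ring
theorem sum_rotate {ι 𝕜 : Type*} [Fintype ι] [AddCommMonoid 𝕜] (f : ι → ι → ι → 𝕜) :
    ∑ a, ∑ b, ∑ c, f a b c = ∑ b, ∑ c, ∑ a, f a b c := by
  rw [Finset.sum_comm]
  exact Finset.sum_congr rfl fun b _ => Finset.sum_comm

theorem sum_pair_comm {ι 𝕜 : Type*} [Fintype ι] [AddCommMonoid 𝕜] (f : ι → ι → ι → ι → 𝕜) :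
    ∑ a, ∑ b, ∑ c, ∑ d, f a b c d = ∑ c, ∑ d, ∑ a, ∑ b, f a b c d := by
  simp only [sum_rotate (f _)]
  exact sum_rotate _

theorem trace_mul_leviCivita {𝕜 : Type*} [Field 𝕜] (A : Matrix (Fin 4) (Fin 4) 𝕜)
    (a b c d : Fin 4) : A.trace * (leviCivita a b c d : 𝕜) =
      ∑ k, (A k a * (leviCivita k b c d : 𝕜) + A k b * (leviCivita a k c d : 𝕜) +
        A k c * (leviCivita a b k d : 𝕜) + A k d * (leviCivita a b c k : 𝕜)) := by
  have h : ∀ k l, A k l * (if k = l then (leviCivita a b c d : 𝕜) else 0) =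
      A k l * ((if l = a then (leviCivita k b c d : 𝕜) else 0) +
        (if l = b then (leviCivita a k c d : 𝕜) else 0) +
        (if l = c then (leviCivita a b k d : 𝕜) else 0) +
        (if l = d then (leviCivita a b c k : 𝕜) else 0)) := by
    intro k l
    have := congrArg (Int.cast (R := 𝕜)) (leviCivita_derivation k l a b c d)
    push_cast at this
    rw [this]
  have h2 : ∑ k, ∑ l, _ = ∑ k, ∑ l, _ :=
    Finset.sum_congr rfl fun k _ => Finset.sum_congr rfl fun l _ => h k l
  simpa [mul_add, Finset.sum_add_distrib, Matrix.trace, Finset.sum_mul] using h2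

/-- Infinitesimal GL(4)-equivariance of `star`, which is a map to 2-forms only up to a density. The
trace term on the left is what differentiating the density ε₀₁₂₃ supplies. -/
theorem star_derivation {𝕜 : Type*} [Field 𝕜] (A X : Matrix (Fin 4) (Fin 4) 𝕜) :
    A.trace • star X = star (A * X + X * A.transpose) + A.transpose * star X + star X * A := by
  have hd := trace_mul_leviCivita A
  ext a b
  have h1 : ∑ c, ∑ d, ∑ k, A k c * (leviCivita a b k d : 𝕜) * X c d =
      ∑ c, ∑ d, (leviCivita a b c d : 𝕜) * (A * X) c d := by
    simp only [Matrix.mul_apply, Finset.mul_sum]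
    have : ∀ c, ∑ d, ∑ k, A k c * (leviCivita a b k d : 𝕜) * X c d =
      ∑ k, ∑ d, A k c * (leviCivita a b k d : 𝕜) * X c d := fun c => Finset.sum_comm
    simp only [this]
    rw [Finset.sum_comm]
    refine Finset.sum_congr rfl fun k _ => ?_
    rw [Finset.sum_comm]
    refine Finset.sum_congr rfl fun d _ => Finset.sum_congr rfl fun c _ => by ring
  have h2 : ∑ c, ∑ d, ∑ k, A k d * (leviCivita a b c k : 𝕜) * X c d =
      ∑ c, ∑ d, (leviCivita a b c d : 𝕜) * (X * A.transpose) c d := by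
    simp only [Matrix.mul_apply, Finset.mul_sum, Matrix.transpose_apply]
    refine Finset.sum_congr rfl fun c _ => ?_
    rw [Finset.sum_comm]
    refine Finset.sum_congr rfl fun d _ => Finset.sum_congr rfl fun k _ => by ring
  have h3 : ∑ c, ∑ d, ∑ k, A k a * (leviCivita k b c d : 𝕜) * X c d =
      ∑ k, A k a * ∑ c, ∑ d, (leviCivita k b c d : 𝕜) * X c d := by
    simp only [Finset.mul_sum]
    refine (sum_rotate _).symm.trans ?_
    refine Finset.sum_congr rfl fun k _ => Finset.sum_congr rfl fun c _ =>
      Finset.sum_congr rfl fun d _ => by ring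
  have h4 : ∑ c, ∑ d, ∑ k, A k b * (leviCivita a k c d : 𝕜) * X c d =
      ∑ k, A k b * ∑ c, ∑ d, (leviCivita a k c d : 𝕜) * X c d := by
    simp only [Finset.mul_sum]
    refine (sum_rotate _).symm.trans ?_
    refine Finset.sum_congr rfl fun k _ => Finset.sum_congr rfl fun c _ =>
      Finset.sum_congr rfl fun d _ => by ring
  have h5 : ∑ c, ∑ d, A.trace * (leviCivita a b c d : 𝕜) * X c d =
      A.trace * ∑ c, ∑ d, (leviCivita a b c d : 𝕜) * X c d := by
    simp only [Finset.mul_sum, mul_assoc]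
  simp only [hd, Finset.sum_mul, add_mul, Finset.sum_add_distrib, h1, h2, h3, h4] at h5
  simp only [Matrix.add_apply, Matrix.smul_apply, smul_eq_mul, star_add, star_apply]
  rw [Matrix.mul_apply, Matrix.mul_apply]
  simp only [star_apply, Matrix.transpose_apply]
  have h6 : ∀ k, A k a * (1 / 2 * ∑ c, ∑ d, (leviCivita k b c d : 𝕜) * X c d) =
    1 / 2 * (A k a * ∑ c, ∑ d, (leviCivita k b c d : 𝕜) * X c d) := fun k => by ring
  have h7 : ∀ k, (1 / 2 * ∑ c, ∑ d, (leviCivita a k c d : 𝕜) * X c d) * A k b =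
    1 / 2 * (A k b * ∑ c, ∑ d, (leviCivita a k c d : 𝕜) * X c d) := fun k => by ring
  simp only [h6, h7]
  rw [← Finset.mul_sum, ← Finset.mul_sum]
  linear_combination (-1 / 2 : 𝕜) * h5

/-! ### The Hodge dual of 2-forms -/

/-- `ep` is a smooth volume form of the metric `G` on `Ω`. -/
structure IsVolumeOn (G : E4 → Matrix (Fin 4) (Fin 4) ℝ)
    (ep : Fin 4 → Fin 4 → Fin 4 → Fin 4 → E4 → ℝ) (Ω : Set E4) : Prop where
  smooth : ContDiffOn ℝ ∞ (ep 0 1 2 3) Ω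
  eq_mul : ∀ z ∈ Ω, ∀ a b c d, ep a b c d z = (leviCivita a b c d : ℝ) * ep 0 1 2 3 z
  sq_eq : ∀ z ∈ Ω, ep 0 1 2 3 z ^ 2 = -(G z).det

/-- The Hodge dual of a matrix of components. -/
def hodgeMatrix (G : E4 → Matrix (Fin 4) (Fin 4) ℝ)
    (ep : Fin 4 → Fin 4 → Fin 4 → Fin 4 → E4 → ℝ) (w : Matrix (Fin 4) (Fin 4) ℝ) (y : E4) :
    Matrix (Fin 4) (Fin 4) ℝ :=
  ep 0 1 2 3 y • star ((G y)⁻¹ * w * ((G y)⁻¹).transpose)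

theorem pdMatrix_star {y : E4} {X : E4 → Matrix (Fin 4) (Fin 4) ℝ} (hX : MatrixDiffAt X y)
    (r : Fin 4) : pdMatrix r (fun z => star (X z)) y = star (pdMatrix r X y) := by
  ext a b
  simp only [pdMatrix_apply, star_apply]
  have h : ∀ c d, DifferentiableAt ℝ (fun z => (leviCivita a b c d : ℝ) * X z c d) y :=
    fun c d => (hX c d).const_mul _
  rw [pd_const_mul (.fun_sum fun c _ => .fun_sum fun d _ => h c d),
    pd_sum _ fun c _ => .fun_sum fun d _ => h c d]
  congr 1
  refine Finset.sum_congr rfl fun c _ => ?_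
  rw [pd_sum _ fun d _ => h c d]
  exact Finset.sum_congr rfl fun d _ => pd_const_mul (hX c d) _ r

theorem MatrixSmoothOn.star {Ω : Set E4} {X : E4 → Matrix (Fin 4) (Fin 4) ℝ}
    (hX : MatrixSmoothOn X Ω) : MatrixSmoothOn (fun z => Coord.star (X z)) Ω := by
  intro a b
  simp only [star_apply]
  exact contDiffOn_const.mul (ContDiffOn.sum fun c _ => ContDiffOn.sum fun d _ =>
    contDiffOn_const.mul (hX c d))

variable {G : E4 → Matrix (Fin 4) (Fin 4) ℝ} {ep : Fin 4 → Fin 4 → Fin 4 → Fin 4 → E4 → ℝ}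
  {Ω : Set E4} {y : E4}

theorem hodgeMatrix_add (w v : Matrix (Fin 4) (Fin 4) ℝ) :
    hodgeMatrix G ep (w + v) y = hodgeMatrix G ep w y + hodgeMatrix G ep v y := by
  simp only [hodgeMatrix, Matrix.mul_add, Matrix.add_mul, star_add, smul_add]

theorem hodgeMatrix_smul (k : ℝ) (w : Matrix (Fin 4) (Fin 4) ℝ) :
    hodgeMatrix G ep (k • w) y = k • hodgeMatrix G ep w y := by
  simp only [hodgeMatrix, Matrix.mul_smul, Matrix.smul_mul, star_smul]
  rw [smul_comm]

theorem hodgeMatrix_neg (w : Matrix (Fin 4) (Fin 4) ℝ) :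
    hodgeMatrix G ep (-w) y = -hodgeMatrix G ep w y := by
  simpa using hodgeMatrix_smul (G := G) (ep := ep) (y := y) (-1) w

theorem hodgeMatrix_sub (w v : Matrix (Fin 4) (Fin 4) ℝ) :
    hodgeMatrix G ep (w - v) y = hodgeMatrix G ep w y - hodgeMatrix G ep v y := by
  rw [sub_eq_add_neg, hodgeMatrix_add, hodgeMatrix_neg, ← sub_eq_add_neg]

theorem hodgeMatrix_transpose (w : Matrix (Fin 4) (Fin 4) ℝ) :
    (hodgeMatrix G ep w y).transpose = -hodgeMatrix G ep w y := by
  rw [hodgeMatrix, Matrix.transpose_smul, star_transpose, smul_neg]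

theorem raise_apply {𝕜 : Type*} [CommRing 𝕜] (P w : Matrix (Fin 4) (Fin 4) 𝕜) (a b : Fin 4) :
    (P * w * P.transpose) a b = ∑ m, ∑ n, P a m * P b n * w m n := by
  simp only [Matrix.mul_apply, Finset.sum_mul, Matrix.transpose_apply]
  rw [Finset.sum_comm]
  refine Finset.sum_congr rfl fun n _ => Finset.sum_congr rfl fun m _ => by ring

theorem IsVolumeOn.hodge_eq (hep : IsVolumeOn G ep Ω) (hy : y ∈ Ω)
    (w : Matrix (Fin 4) (Fin 4) ℝ) (a b : Fin 4) :
    hodge G ep w a b y = hodgeMatrix G ep w y a b := by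
  have h : ∀ m n m' n', ep a b m' n' y * gInv G y m' m * gInv G y n' n * w m n =
      ep 0 1 2 3 y * ((leviCivita a b m' n' : ℝ) *
        ((G y)⁻¹ m' m * (G y)⁻¹ n' n * w m n)) := by
    intro m n m' n'
    rw [hep.eq_mul y hy a b m' n', gInv, gInv]; ring
  simp only [hodge, h, hodgeMatrix, Matrix.smul_apply, smul_eq_mul, star_apply, raise_apply,
    Finset.mul_sum]
  rw [sum_pair_comm]
  refine Finset.sum_congr rfl fun c _ => Finset.sum_congr rfl fun d _ =>
    Finset.sum_congr rfl fun m _ => Finset.sum_congr rfl fun n _ => by ring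

theorem IsVolumeOn.ne_zero (hep : IsVolumeOn G ep Ω) (hG : IsMetricOn G Ω) (hy : y ∈ Ω) :
    ep 0 1 2 3 y ≠ 0 := by
  intro h
  have := hep.sq_eq y hy
  rw [h] at this
  exact hG.det_ne_zero y hy (by linarith)

/-- The volume form is parallel. -/
theorem IsVolumeOn.pd_eq (hep : IsVolumeOn G ep Ω) (hG : IsMetricOn G Ω) (hy : y ∈ Ω)
    (r : Fin 4) : pd r (ep 0 1 2 3) y = (conn G r y).trace * ep 0 1 2 3 y := by
  have hd := differentiableAt_of_contDiffOn hG.isOpen hep.smooth hy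
  -- Differentiate ε₀₁₂₃² = -det G, with derivative -2 tr A · det G on the right, and divide by
  -- 2ε₀₁₂₃ ≠ 0.
  have h1 : pd r (fun z => ep 0 1 2 3 z * ep 0 1 2 3 z) y = pd r (fun z => -(G z).det) y :=
    pd_congr_on hG.isOpen hy (fun z hz => by rw [← hep.sq_eq z hz, sq]) r
  rw [pd_mul hd hd, pd_neg, pd_det (hG.smooth.diffAt hG.isOpen hy) _ _ r
    (hG.pdMatrix_metric hy r), Matrix.trace_transpose] at h1
  have h2 := hep.sq_eq y hy
  have h3 := hep.ne_zero hG hy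
  have : ep 0 1 2 3 y * (pd r (ep 0 1 2 3) y - (conn G r y).trace * ep 0 1 2 3 y) = 0 := by
    linear_combination (1 / 2 : ℝ) * h1 - (conn G r y).trace * h2
  rcases mul_eq_zero.mp this with h | h
  · exact absurd h h3
  · linarith

theorem IsVolumeOn.smooth_hodgeMatrix (hep : IsVolumeOn G ep Ω) (hG : IsMetricOn G Ω)
    {w : E4 → Matrix (Fin 4) (Fin 4) ℝ} (hw : MatrixSmoothOn w Ω) :
    MatrixSmoothOn (fun z => hodgeMatrix G ep (w z) z) Ω := by
  intro a b
  exact hep.smooth.mul (((hG.smooth_inv.mul hw).mul hG.smooth_inv.transpose).star a b)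

/-- The Hodge dual commutes with covariant differentiation. -/
theorem IsVolumeOn.pdMatrix_hodgeMatrix (hep : IsVolumeOn G ep Ω) (hG : IsMetricOn G Ω)
    (hy : y ∈ Ω) {w : E4 → Matrix (Fin 4) (Fin 4) ℝ} (hw : MatrixDiffAt w y) (r : Fin 4) :
    pdMatrix r (fun z => hodgeMatrix G ep (w z) z) y =
      hodgeMatrix G ep
        (pdMatrix r w y - (conn G r y).transpose * w y - w y * conn G r y) y
      + (conn G r y).transpose * hodgeMatrix G ep (w y) y
      + hodgeMatrix G ep (w y) y * conn G r y := by
  have hd := differentiableAt_of_contDiffOn hG.isOpen hep.smooth hy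
  have hP := hG.smooth_inv.diffAt hG.isOpen hy
  have hX : MatrixDiffAt (fun z => (G z)⁻¹ * w z * ((G z)⁻¹).transpose) y :=
    (hP.mul hw).mul hP.transpose
  have h1 : pdMatrix r (fun z => hodgeMatrix G ep (w z) z) y =
      pd r (ep 0 1 2 3) y • star ((G y)⁻¹ * w y * ((G y)⁻¹).transpose) + ep 0 1 2 3 y •
        star (pdMatrix r (fun z => (G z)⁻¹ * w z * ((G z)⁻¹).transpose) y) := by
    rw [← pdMatrix_star hX]
    ext a b
    refine pd_mul hd ?_ r
    simp only [star_apply]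
    exact DifferentiableAt.const_mul (.fun_sum fun c _ => .fun_sum fun d _ =>
      (hX c d).const_mul _) _
  rw [h1, hep.pd_eq hG hy, pdMatrix_mul (hP.mul hw) hP.transpose, pdMatrix_mul hP hw,
    pdMatrix_transpose, hG.pdMatrix_inv hy, mul_comm, mul_smul, star_derivation]
  simp only [hodgeMatrix, Matrix.mul_smul, Matrix.smul_mul, ← smul_add]
  congr 1
  -- With X = P w Pᵀ: raising the covariant derivative of w gives ∂X + AX + XAᵀ. The last two terms
  -- are the ones that `star_derivation` produces.
  have h2 : ∀ P A w dw : Matrix (Fin 4) (Fin 4) ℝ, P * (dw - A.transpose * w - w * A) *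
      P.transpose = (A * (P * w * P.transpose) + P * w * P.transpose * A.transpose) +
        ((-(A * P + P * A.transpose) * w + P * dw) * P.transpose +
          P * w * (-(A * P + P * A.transpose)).transpose) := by
    intro P A w dw
    simp only [Matrix.transpose_neg, Matrix.transpose_add, Matrix.transpose_mul,
      Matrix.transpose_transpose]
    noncomm_ring
  rw [h2, star_add _ (_ * _ + _)]
  abel
end Coord
end

noncomputable section
namespace Coord

/-! ### Index form of the curvature identities -/

/-- The covariant derivative `D_r S_{abmn}` of a real covariant 4-tensor. -/
def covDReal (G : E4 → Matrix (Fin 4) (Fin 4) ℝ)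
    (S : Fin 4 → Fin 4 → Fin 4 → Fin 4 → E4 → ℝ) (r a b m n : Fin 4) (y : E4) : ℝ :=
  pd r (S a b m n) y
    - ∑ l, (christoffel G l r a y * S l b m n y + christoffel G l r b y * S a l m n y
        + christoffel G l r m y * S a b l n y + christoffel G l r n y * S a b m l y)

variable {G : E4 → Matrix (Fin 4) (Fin 4) ℝ} {ep : Fin 4 → Fin 4 → Fin 4 → Fin 4 → E4 → ℝ}
  {t : Fin 4 → E4 → ℝ} {Ω : Set E4} {y : E4}

theorem riemann_swap_right (k l i j : Fin 4) (y : E4) :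
    riemann G k l j i y = -riemann G k l i j y := by
  rw [riemann_eq, riemann_eq, IsMetricOn.curv_antisymm i j, Matrix.mul_neg]; rfl

theorem covDReal_riemann_swap_right (hΩ : IsOpen Ω) (hy : y ∈ Ω) (r a b m n : Fin 4) :
    covDReal G (riemann G) r a b n m y = -covDReal G (riemann G) r a b m n y := by
  simp only [covDReal]
  rw [pd_congr_on hΩ hy (fun z _ => riemann_swap_right a b m n z), pd_neg, neg_sub,
    sub_eq_add_neg, sub_eq_add_neg, add_comm, ← Finset.sum_neg_distrib]
  congr 1
  refine Finset.sum_congr rfl fun l _ => ?_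
  rw [riemann_swap_right l b m n, riemann_swap_right a l m n, riemann_swap_right a b l n,
    riemann_swap_right a b m l]
  ring

namespace IsMetricOn

theorem riemann_swap_left (hG : IsMetricOn G Ω) (hy : y ∈ Ω) (k l i j : Fin 4) :
    riemann G l k i j y = -riemann G k l i j y := by
  rw [riemann_eq, riemann_eq]
  exact congrFun (congrFun (hG.transpose_metric_mul_curv hy i j) k) l

theorem riemann_cyclic (hG : IsMetricOn G Ω) (hy : y ∈ Ω) (k l i j : Fin 4) :
    riemann G k l i j y + riemann G k i j l y + riemann G k j l i y = 0 := by
  simp only [riemann, ← Finset.sum_add_distrib, ← mul_add]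
  exact Finset.sum_eq_zero fun m _ => by
    have h := hG.curv_cyclic hy m l i j
    simp only [curv_apply] at h
    rw [h, mul_zero]

/-- The octahedron argument: a combination of four first Bianchi identities, one for each leading
index, reduces to pair symmetry by the two antisymmetries. -/
theorem riemann_pair (hG : IsMetricOn G Ω) (hy : y ∈ Ω) (k l i j : Fin 4) :
    riemann G i j k l y = riemann G k l i j y := by
  have h1 := hG.riemann_cyclic hy k l i j
  have h2 := hG.riemann_cyclic hy l i j k
  have h3 := hG.riemann_cyclic hy i j k l
  have h4 := hG.riemann_cyclic hy j k l i
  have e1 := hG.riemann_swap_left hy k l i j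
  have e2 := hG.riemann_swap_left hy k i l j
  have e3 := riemann_swap_right (G := G) k i j l y
  have e4 := hG.riemann_swap_left hy k j l i
  have e5 := hG.riemann_swap_left hy l i j k
  have e6 := hG.riemann_swap_left hy l j i k
  have e7 := riemann_swap_right (G := G) l j k i y
  have e8 := hG.riemann_swap_left hy i j k l
  linarith

theorem smooth_riemann (hG : IsMetricOn G Ω) (k l i j : Fin 4) :
    ContDiffOn ℝ ∞ (riemann G k l i j) Ω := by
  have : riemann G k l i j = fun y => (G y * curv G i j y) k l :=
    funext fun y => riemann_eq G i j k l y
  rw [this]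
  exact (hG.smooth.mul (hG.smooth_curv i j)) k l

theorem sum_gInv_mul_riemann (hG : IsMetricOn G Ω) (hy : y ∈ Ω) (r l i j : Fin 4) :
    ∑ a, gInv G y r a * riemann G a l i j y = riemannUp G r l i j y := by
  simp only [riemann_eq, gInv]
  rw [← Matrix.mul_apply, ← Matrix.mul_assoc, hG.inv_mul hy, Matrix.one_mul, curv_apply]

theorem sum_gInv_mul_riemann_eq_ricci (hG : IsMetricOn G Ω) (hy : y ∈ Ω) (b n : Fin 4) :
    ∑ a, ∑ r, gInv G y a r * riemann G a b r n y = ricci G b n y := by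
  rw [Finset.sum_comm, ricci]
  refine Finset.sum_congr rfl fun r _ => ?_
  rw [← hG.sum_gInv_mul_riemann hy]
  exact Finset.sum_congr rfl fun a _ => by rw [hG.gInv_symm hy]

theorem pd_gInv (hG : IsMetricOn G Ω) (hy : y ∈ Ω) (m a r : Fin 4) :
    pd m (fun z => gInv G z a r) y =
      -∑ l, (christoffel G a m l y * gInv G y l r + gInv G y a l * christoffel G r m l y) := by
  have h := congrFun (congrFun (hG.pdMatrix_inv hy m) a) r
  rw [Matrix.neg_apply, Matrix.add_apply, Matrix.mul_apply, Matrix.mul_apply,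
    ← Finset.sum_add_distrib] at h
  exact h

/-- Separates the derivative of the curvature as an endomorphism from the corrections on the two
form indices. The first part has zero cyclic sum by `pdMatrix_curv_cyclic`, and the corrections
cancel cyclically because Γ is symmetric. -/
theorem covDReal_riemann_eq (hG : IsMetricOn G Ω) (hy : y ∈ Ω) (r k l i j : Fin 4) :
    covDReal G (riemann G) r k l i j y =
      (G y * (pdMatrix r (curv G i j) y + conn G r y * curv G i j y
        - curv G i j y * conn G r y)) k l
      - ∑ m, (christoffel G m r i y * riemann G k l m j y
        + christoffel G m r j y * riemann G k l i m y) := by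
  have h1 : pd r (riemann G k l i j) y = (pdMatrix r (fun z => G z * curv G i j z) y) k l :=
    pd_congr_on hG.isOpen hy (fun z _ => riemann_eq G i j k l z) r
  have h2 : ∑ m, christoffel G m r k y * riemann G m l i j y =
      ((conn G r y).transpose * (G y * curv G i j y)) k l := by
    rw [Matrix.mul_apply]
    exact Finset.sum_congr rfl fun m _ => by rw [riemann_eq]; rfl
  have h3 : ∑ m, christoffel G m r l y * riemann G k m i j y =
      (G y * curv G i j y * conn G r y) k l := by
    rw [Matrix.mul_apply]
    exact Finset.sum_congr rfl fun m _ => by rw [riemann_eq, mul_comm]; rfl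
  have h4 : pdMatrix r (fun z => G z * curv G i j z) y
      = G y * (pdMatrix r (curv G i j) y + conn G r y * curv G i j y - curv G i j y * conn G r y)
      + (conn G r y).transpose * (G y * curv G i j y) + G y * curv G i j y * conn G r y := by
    rw [pdMatrix_mul (hG.smooth.diffAt hG.isOpen hy) ((hG.smooth_curv i j).diffAt hG.isOpen hy),
      hG.pdMatrix_metric hy]
    noncomm_ring
  simp only [covDReal, h1, Finset.sum_add_distrib, h2, h3]
  rw [h4, Matrix.add_apply, Matrix.add_apply]
  ring

/-- The second Bianchi identity. -/
theorem covDReal_riemann_cyclic (hG : IsMetricOn G Ω) (hy : y ∈ Ω) (r k l i j : Fin 4) :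
    covDReal G (riemann G) r k l i j y + covDReal G (riemann G) i k l j r y
      + covDReal G (riemann G) j k l r i y = 0 := by
  have hmul : ∀ X Y Z : Matrix (Fin 4) (Fin 4) ℝ, X + Y + Z = 0 →
      (G y * X) k l + (G y * Y) k l + (G y * Z) k l = 0 := by
    intro X Y Z h
    rw [← Matrix.add_apply, ← Matrix.add_apply, ← Matrix.mul_add, ← Matrix.mul_add, h]
    simp
  have h := hmul _ _ _ (hG.pdMatrix_curv_cyclic hy r i j)
  rw [hG.covDReal_riemann_eq hy, hG.covDReal_riemann_eq hy, hG.covDReal_riemann_eq hy]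
  have h2 : (∑ m, (christoffel G m r i y * riemann G k l m j y
        + christoffel G m r j y * riemann G k l i m y)) +
      (∑ m, (christoffel G m i j y * riemann G k l m r y
        + christoffel G m i r y * riemann G k l j m y)) +
      (∑ m, (christoffel G m j r y * riemann G k l m i y
        + christoffel G m j i y * riemann G k l r m y)) = 0 := by
    rw [← Finset.sum_add_distrib, ← Finset.sum_add_distrib]
    refine Finset.sum_eq_zero fun m _ => ?_
    rw [hG.christoffel_symm hy m r j, hG.christoffel_symm hy m i r, hG.christoffel_symm hy m j i,
      riemann_swap_right k l m i, riemann_swap_right k l m j, riemann_swap_right k l m r]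
    ring
  linarith

theorem covDReal_riemann_pair (hG : IsMetricOn G Ω) (hy : y ∈ Ω) (r a b m n : Fin 4) :
    covDReal G (riemann G) r m n a b y = covDReal G (riemann G) r a b m n y := by
  simp only [covDReal]
  rw [pd_congr_on hG.isOpen hy (fun z hz => hG.riemann_pair hz a b m n)]
  congr 1
  refine Finset.sum_congr rfl fun l _ => ?_
  rw [hG.riemann_pair hy a b l n, hG.riemann_pair hy a b m l, hG.riemann_pair hy l b m n,
    hG.riemann_pair hy a l m n]
  ring

/-- The trace of the covariant derivative of the curvature of a Ricci-flat metric vanishes. -/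
theorem sum_gInv_mul_covDReal_riemann (hG : IsMetricOn G Ω) (hy : y ∈ Ω)
    (hR : ∀ z ∈ Ω, ∀ i j, ricci G i j z = 0) (m b n : Fin 4) :
    ∑ a, ∑ r, gInv G y a r * covDReal G (riemann G) m a b r n y = 0 := by
  have hg : ∀ a r, DifferentiableAt ℝ (fun z => gInv G z a r) y := fun a r =>
    differentiableAt_of_contDiffOn hG.isOpen (hG.smooth_inv a r) hy
  have hd : ∀ a b r n, DifferentiableAt ℝ (riemann G a b r n) y := fun a b r n =>
    differentiableAt_of_contDiffOn hG.isOpen (hG.smooth_riemann a b r n) hy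
  have h0 : pd m (fun z => ∑ a, ∑ r, gInv G z a r * riemann G a b r n z) y = 0 := by
    rw [pd_congr_on hG.isOpen hy (g := fun _ => 0)
      (fun z hz => by rw [hG.sum_gInv_mul_riemann_eq_ricci hz, hR z hz]), pd_const]
  rw [pd_sum _ fun a _ => .fun_sum fun r _ => (hg a r).fun_mul (hd a b r n)] at h0
  have h1 : ∀ a, pd m (fun z => ∑ r, gInv G z a r * riemann G a b r n z) y =
      ∑ r, ((-∑ l, (christoffel G a m l y * gInv G y l r + gInv G y a l * christoffel G r m l y))
        * riemann G a b r n y + gInv G y a r * pd m (riemann G a b r n) y) := by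
    intro a
    rw [pd_sum _ fun r _ => (hg a r).fun_mul (hd a b r n)]
    exact Finset.sum_congr rfl fun r _ => by rw [pd_mul (hg a r) (hd a b r n), hG.pd_gInv hy]
  simp only [h1] at h0
  -- The derivative of the vanishing Ricci tensor is compared with the trace of DR. Corrections on
  -- the contracted indices (`e1`, `e2`) match the derivative of the inverse metric; those on the
  -- free indices (`e3`, `e4`) are Christoffel symbols times Ricci.
  have e1 : ∑ a, ∑ r, ∑ l, gInv G y a r * (christoffel G l m a y * riemann G l b r n y) =
      ∑ a, ∑ r, ∑ l, christoffel G a m l y * gInv G y l r * riemann G a b r n y := by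
    refine (sum_rotate _).trans (Finset.sum_comm.trans ?_)
    exact Finset.sum_congr rfl fun a _ => Finset.sum_congr rfl fun r _ =>
      Finset.sum_congr rfl fun l _ => by rw [hG.christoffel_symm hy a m l]; ring
  have e2 : ∑ a, ∑ r, ∑ l, gInv G y a r * (christoffel G l m r y * riemann G a b l n y) =
      ∑ a, ∑ r, ∑ l, gInv G y a l * christoffel G r m l y * riemann G a b r n y := by
    refine Finset.sum_congr rfl fun a _ => ?_
    rw [Finset.sum_comm]
    exact Finset.sum_congr rfl fun r _ => Finset.sum_congr rfl fun l _ => by ring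
  have e3 : ∑ a, ∑ r, ∑ l, gInv G y a r * (christoffel G l m b y * riemann G a l r n y) = 0 := by
    rw [← sum_rotate]
    refine Finset.sum_eq_zero fun l _ => ?_
    have : ∑ a, ∑ r, gInv G y a r * (christoffel G l m b y * riemann G a l r n y) =
        christoffel G l m b y * ricci G l n y := by
      rw [← hG.sum_gInv_mul_riemann_eq_ricci hy]
      simp only [Finset.mul_sum]
      exact Finset.sum_congr rfl fun r _ => Finset.sum_congr rfl fun l _ => by ring
    rw [this, hR y hy, mul_zero]
  have e4 : ∑ a, ∑ r, ∑ l, gInv G y a r * (christoffel G l m n y * riemann G a b r l y) = 0 := by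
    rw [← sum_rotate]
    refine Finset.sum_eq_zero fun l _ => ?_
    have : ∑ a, ∑ r, gInv G y a r * (christoffel G l m n y * riemann G a b r l y) =
        christoffel G l m n y * ricci G b l y := by
      rw [← hG.sum_gInv_mul_riemann_eq_ricci hy]
      simp only [Finset.mul_sum]
      exact Finset.sum_congr rfl fun r _ => Finset.sum_congr rfl fun l _ => by ring
    rw [this, hR y hy, mul_zero]
  simp only [covDReal, mul_sub, mul_add, Finset.mul_sum, Finset.sum_sub_distrib,
    Finset.sum_add_distrib, e1, e2, e3, e4]
  simp only [neg_mul, Finset.sum_mul, add_mul, Finset.sum_add_distrib, Finset.sum_neg_distrib]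
    at h0
  linarith

/-- The curvature of a Ricci-flat metric is divergence-free. -/
theorem divergence_riemann (hG : IsMetricOn G Ω) (hy : y ∈ Ω)
    (hR : ∀ z ∈ Ω, ∀ i j, ricci G i j z = 0) (b m n : Fin 4) :
    ∑ a, ∑ r, gInv G y a r * covDReal G (riemann G) r a b m n y = 0 := by
  have h1 := hG.sum_gInv_mul_covDReal_riemann hy hR m b n
  have h2 := hG.sum_gInv_mul_covDReal_riemann hy hR n b m
  -- Contracted Bianchi: the divergence of R is the antisymmetrized derivative of the Ricci tensor.
  have h3 : ∑ a, ∑ r, gInv G y a r * covDReal G (riemann G) r a b m n y =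
      ∑ a, ∑ r, gInv G y a r * covDReal G (riemann G) m a b r n y -
      ∑ a, ∑ r, gInv G y a r * covDReal G (riemann G) n a b r m y := by
    simp only [← Finset.sum_sub_distrib]
    refine Finset.sum_congr rfl fun a _ => Finset.sum_congr rfl fun r _ => ?_
    have h := hG.covDReal_riemann_cyclic hy r a b m n
    rw [covDReal_riemann_swap_right hG.isOpen hy m a b r n] at h
    linear_combination gInv G y a r * h
  rw [h3, h1, h2, sub_zero]

end IsMetricOn

end Coord
end

noncomputable section
namespace Coord

variable {G : E4 → Matrix (Fin 4) (Fin 4) ℝ} {ep : Fin 4 → Fin 4 → Fin 4 → Fin 4 → E4 → ℝ}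
  {t : Fin 4 → E4 → ℝ} {Ω : Set E4} {y : E4}

/-! ### The dual of the curvature tensor -/

/-- The left Hodge dual `⋆R_{abmn}` of the curvature tensor. -/
def starRiemann (G : E4 → Matrix (Fin 4) (Fin 4) ℝ)
    (ep : Fin 4 → Fin 4 → Fin 4 → Fin 4 → E4 → ℝ) (a b m n : Fin 4) (y : E4) : ℝ :=
  hodgeMatrix G ep (G y * curv G m n y) y a b

theorem hodgeMatrix_sum {ι : Type*} (s : Finset ι) (w : ι → Matrix (Fin 4) (Fin 4) ℝ) :
    hodgeMatrix G ep (∑ i ∈ s, w i) y = ∑ i ∈ s, hodgeMatrix G ep (w i) y :=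
  map_sum (AddMonoidHom.mk' (fun w => hodgeMatrix G ep w y) hodgeMatrix_add) w s

theorem starRiemann_swap_left (a b m n : Fin 4) (y : E4) :
    starRiemann G ep b a m n y = -starRiemann G ep a b m n y :=
  congrFun (congrFun (hodgeMatrix_transpose (G y * curv G m n y)) a) b

/-- A closed form has a co-closed dual. Raising all three indices preserves the vanishing cyclic
sum, so `sum_leviCivita_cyclic` applies. The identity serves twice: with second Bianchi for the
divergence of ⋆R, with first Bianchi for its trace. -/
theorem sum_gInv_mul_star_eq_zero (P : Matrix (Fin 4) (Fin 4) ℝ)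
    (B : Fin 4 → Matrix (Fin 4) (Fin 4) ℝ) (hB : ∀ r c d, B r c d + B c d r + B d r c = 0)
    (b : Fin 4) : ∑ a, ∑ r, P a r * star (P * B r * P.transpose) a b = 0 := by
  have hrot : ∀ a c d : Fin 4, ∀ f : Fin 4 → Fin 4 → Fin 4 → ℝ,
      ∑ r, ∑ m, ∑ n, P a r * (P c m * P d n * f r m n) =
      ∑ r, ∑ m, ∑ n, P c r * (P d m * P a n * f n r m) := by
    intro a c d f
    rw [sum_rotate]
    exact Finset.sum_congr rfl fun m _ => Finset.sum_congr rfl fun n _ =>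
      Finset.sum_congr rfl fun r _ => by ring
  have hZ : ∀ a c d, (∑ r, ∑ m, ∑ n, P a r * (P c m * P d n * B r m n)) +
      (∑ r, ∑ m, ∑ n, P c r * (P d m * P a n * B r m n)) +
      (∑ r, ∑ m, ∑ n, P d r * (P a m * P c n * B r m n)) = 0 := by
    intro a c d
    rw [hrot a c d fun r m n => B r m n,
      (hrot d a c fun r m n => B r m n).trans (hrot a c d fun r m n => B n r m)]
    simp only [← Finset.sum_add_distrib]
    refine Finset.sum_eq_zero fun r _ => Finset.sum_eq_zero fun m _ =>
      Finset.sum_eq_zero fun n _ => ?_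
    linear_combination P c r * P d m * P a n * hB n r m
  have h := sum_leviCivita_cyclic _ hZ b
  have h2 : ∀ a, ∑ r, P a r * star (P * B r * P.transpose) a b = -(1 / 2) *
      ∑ c, ∑ d, (leviCivita b a c d : ℝ) * ∑ r, ∑ m, ∑ n, P a r * (P c m * P d n * B r m n) := by
    intro a
    simp only [star_apply, raise_apply, Finset.mul_sum]
    rw [sum_rotate]
    refine Finset.sum_congr rfl fun c _ => Finset.sum_congr rfl fun d _ =>
      Finset.sum_congr rfl fun r _ => Finset.sum_congr rfl fun m _ =>
      Finset.sum_congr rfl fun n _ => ?_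
    rw [leviCivita_swap_left b a]
    push_cast
    ring
  simp only [h2]
  rw [← Finset.mul_sum, h, mul_zero]

theorem sum_gInv_mul_hodgeMatrix_eq_zero
    (B : Fin 4 → Matrix (Fin 4) (Fin 4) ℝ) (hB : ∀ r c d, B r c d + B c d r + B d r c = 0)
    (b : Fin 4) : ∑ a, ∑ r, gInv G y a r * hodgeMatrix G ep (B r) y a b = 0 := by
  have h := congrArg (ep 0 1 2 3 y * ·) (sum_gInv_mul_star_eq_zero (G y)⁻¹ B hB b)
  simp only [Finset.mul_sum, mul_zero] at h
  rw [← h]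
  refine Finset.sum_congr rfl fun a _ => Finset.sum_congr rfl fun r _ => ?_
  simp only [hodgeMatrix, Matrix.smul_apply, smul_eq_mul, gInv]
  ring

theorem metric_mul_curv_eq (m n : Fin 4) :
    G y * curv G m n y = Matrix.of fun c d => riemann G c d m n y := by
  ext c d; exact (riemann_eq G m n c d y).symm

/-- The left and right duals of the curvature of a Ricci-flat metric agree. -/
theorem IsMetricOn.starRiemann_pair (hG : IsMetricOn G Ω) (hy : y ∈ Ω)
    (hR : ∀ i j, ricci G i j y = 0) (a b m n : Fin 4) :
    starRiemann G ep m n a b y = starRiemann G ep a b m n y := by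
  simp only [starRiemann, hodgeMatrix, Matrix.smul_apply]
  congr 1
  -- Apply the algebraic statement to the curvature with one pair raised; its mixed trace is the
  -- Ricci tensor with an index raised.
  refine star_comm_of_trace_eq_zero
    (fun m n => (G y)⁻¹ * (G y * curv G m n y) * ((G y)⁻¹).transpose) ?_ ?_ ?_ m n a b
  · intro m n
    rw [Matrix.transpose_mul, Matrix.transpose_mul, Matrix.transpose_transpose,
      hG.transpose_metric_mul_curv hy]
    simp only [Matrix.neg_mul, Matrix.mul_neg, Matrix.mul_assoc]
  · intro m n
    rw [curv_antisymm m n]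
    simp only [Matrix.neg_mul, Matrix.mul_neg]
  · intro d n
    simp only [metric_mul_curv_eq, raise_apply, Matrix.of_apply]
    have h : ∀ k, ∑ c, ∑ m, (G y)⁻¹ c m * riemann G m k c n y = ricci G k n y := by
      intro k
      rw [← hG.sum_gInv_mul_riemann_eq_ricci hy, Finset.sum_comm]
      exact Finset.sum_congr rfl fun a _ => Finset.sum_congr rfl fun r _ => by
        rw [← hG.gInv_symm hy r a]; rfl
    refine (sum_rotate _).trans (Finset.sum_comm.trans (Finset.sum_eq_zero fun k _ => ?_))
    have h2 : ∑ m, ∑ c, (G y)⁻¹ c m * (G y)⁻¹ d k * riemann G m k c n y =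
        (G y)⁻¹ d k * ricci G k n y := by
      rw [← h, Finset.sum_comm]
      simp only [Finset.mul_sum]
      exact Finset.sum_congr rfl fun a _ => Finset.sum_congr rfl fun r _ => by ring
    rw [h2, hR, mul_zero]

theorem IsVolumeOn.smooth_starRiemann (hep : IsVolumeOn G ep Ω) (hG : IsMetricOn G Ω)
    (a b m n : Fin 4) : ContDiffOn ℝ ∞ (starRiemann G ep a b m n) Ω :=
  hep.smooth_hodgeMatrix hG (hG.smooth.mul (hG.smooth_curv m n)) a b

/-- The dual acts on the first pair only and commutes with covariant differentiation there. The
corrections on the other pair are linear combinations of curvature 2-forms and pass through by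
linearity. -/
theorem IsVolumeOn.covDReal_starRiemann (hep : IsVolumeOn G ep Ω) (hG : IsMetricOn G Ω)
    (hy : y ∈ Ω) (r a b m n : Fin 4) :
    covDReal G (starRiemann G ep) r a b m n y =
      hodgeMatrix G ep (Matrix.of fun c d => covDReal G (riemann G) r c d m n y) y a b := by
  have hw := (hG.smooth.mul (hG.smooth_curv m n)).diffAt hG.isOpen hy
  have h1 : pd r (starRiemann G ep a b m n) y = _ :=
    congrFun (congrFun (hep.pdMatrix_hodgeMatrix hG hy hw r) a) b
  have h2 : (Matrix.of fun c d => covDReal G (riemann G) r c d m n y) =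
      (pdMatrix r (fun z => G z * curv G m n z) y - (conn G r y).transpose * (G y * curv G m n y)
        - (G y * curv G m n y) * conn G r y)
      - ∑ l, (christoffel G l r m y • (G y * curv G l n y)
        + christoffel G l r n y • (G y * curv G m l y)) := by
    ext c d
    have e1 : pdMatrix r (fun z => G z * curv G m n z) y c d = pd r (riemann G c d m n) y :=
      (pd_congr_on hG.isOpen hy (fun z _ => riemann_eq G m n c d z) r).symm
    rw [Matrix.sub_apply, Matrix.sub_apply, Matrix.sub_apply, e1, Matrix.mul_apply,
      Matrix.mul_apply (M := G y * curv G m n y), Matrix.sum_apply]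
    simp only [Matrix.add_apply, Matrix.smul_apply, smul_eq_mul, ← riemann_eq, Matrix.of_apply,
      covDReal, Matrix.transpose_apply, conn_apply, Finset.sum_add_distrib]
    have e2 : ∑ j, riemann G c j m n y * christoffel G j r d y =
      ∑ j, christoffel G j r d y * riemann G c j m n y :=
      Finset.sum_congr rfl fun j _ => mul_comm _ _
    rw [e2]
    ring
  rw [h2, hodgeMatrix_sub, hodgeMatrix_sum, Matrix.sub_apply, Matrix.sum_apply]
  simp only [hodgeMatrix_add, hodgeMatrix_smul, Matrix.add_apply, Matrix.smul_apply, smul_eq_mul]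
  rw [covDReal, h1, Matrix.add_apply, Matrix.add_apply, Matrix.mul_apply,
    Matrix.mul_apply (M := hodgeMatrix G ep (G y * curv G m n y) y)]
  simp only [Matrix.transpose_apply, conn_apply, Finset.sum_add_distrib, starRiemann]
  have e2 : ∑ j, hodgeMatrix G ep (G y * curv G m n y) y a j * christoffel G j r b y =
      ∑ j, christoffel G j r b y * hodgeMatrix G ep (G y * curv G m n y) y a j :=
      Finset.sum_congr rfl fun j _ => mul_comm _ _
  rw [e2]
  ring

/-- The second Bianchi identity, moved by pair symmetry to the pair on which the dual acts. -/
theorem IsVolumeOn.divergence_starRiemann (hep : IsVolumeOn G ep Ω) (hG : IsMetricOn G Ω)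
    (hy : y ∈ Ω) (b m n : Fin 4) :
    ∑ a, ∑ r, gInv G y a r * covDReal G (starRiemann G ep) r a b m n y = 0 := by
  simp only [hep.covDReal_starRiemann hG hy]
  refine sum_gInv_mul_hodgeMatrix_eq_zero
    (fun r => Matrix.of fun c d => covDReal G (riemann G) r c d m n y) (fun r c d => ?_) b
  simp only [Matrix.of_apply]
  rw [← hG.covDReal_riemann_pair hy r c d, ← hG.covDReal_riemann_pair hy c d r,
    ← hG.covDReal_riemann_pair hy d r c]
  exact hG.covDReal_riemann_cyclic hy r m n c d

/-- The first Bianchi identity in dual form. It is the imaginary part of the statement that 𝓕 is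
divergence-free. -/
theorem IsMetricOn.sum_gInv_mul_starRiemann (hG : IsMetricOn G Ω) (hy : y ∈ Ω) (l b : Fin 4) :
    ∑ a, ∑ r, gInv G y a r * starRiemann G ep l r a b y = 0 := by
  have h := sum_gInv_mul_hodgeMatrix_eq_zero (G := G) (ep := ep) (y := y)
    (fun r => Matrix.of fun c d => riemann G c d r b y) (fun r c d => by
      simp only [Matrix.of_apply]
      rw [← hG.riemann_pair hy c d, ← hG.riemann_pair hy d r, ← hG.riemann_pair hy r c]
      have h := hG.riemann_cyclic hy b r c d
      rw [hG.riemann_swap_left hy r b, hG.riemann_swap_left hy c b,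
        hG.riemann_swap_left hy d b] at h
      linarith) l
  rw [Finset.sum_comm]
  rw [← neg_eq_zero, ← Finset.sum_neg_distrib, ← h]
  refine Finset.sum_congr rfl fun r _ => ?_
  rw [← Finset.sum_neg_distrib]
  refine Finset.sum_congr rfl fun a _ => ?_
  rw [starRiemann_swap_left r l, starRiemann, metric_mul_curv_eq, hG.gInv_symm hy a r]
  ring

/-! ### Killing fields -/

/-- The components `T_b = g_{bc} T^c`. -/
def lower (G : E4 → Matrix (Fin 4) (Fin 4) ℝ) (t : Fin 4 → E4 → ℝ) (b : Fin 4) (y : E4) : ℝ :=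
  ∑ c, G y b c * t c y

/-- The matrix of components `F_{ab} = D_a T_b`. -/
def killingForm (G : E4 → Matrix (Fin 4) (Fin 4) ℝ) (t : Fin 4 → E4 → ℝ) (y : E4) :
    Matrix (Fin 4) (Fin 4) ℝ :=
  Matrix.of fun a b => covDLower G t a b y

/-- `t` is a smooth Killing field on `Ω`. -/
structure IsKillingOn (G : E4 → Matrix (Fin 4) (Fin 4) ℝ) (t : Fin 4 → E4 → ℝ) (Ω : Set E4) :
    Prop where
  smooth : ∀ i, ContDiffOn ℝ ∞ (t i) Ω
  killing : ∀ z ∈ Ω, ∀ a b, covDLower G t a b z + covDLower G t b a z = 0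

theorem covDLower_eq (a b : Fin 4) (y : E4) : covDLower G t a b y =
    pd a (lower G t b) y - ∑ k, christoffel G k a b y * lower G t k y := rfl

namespace IsKillingOn

theorem smooth_lower (hT : IsKillingOn G t Ω) (hG : IsMetricOn G Ω) (b : Fin 4) :
    ContDiffOn ℝ ∞ (lower G t b) Ω :=
  ContDiffOn.sum fun c _ => (hG.smooth b c).mul (hT.smooth c)

theorem smooth_killingForm (hT : IsKillingOn G t Ω) (hG : IsMetricOn G Ω) :
    MatrixSmoothOn (killingForm G t) Ω := fun a b =>
  (contDiffOn_pd hG.isOpen (hT.smooth_lower hG b) a).sub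
    (ContDiffOn.sum fun k _ => (hG.smooth_conn a k b).mul (hT.smooth_lower hG k))

theorem killingForm_transpose (hT : IsKillingOn G t Ω) (hy : y ∈ Ω) :
    (killingForm G t y).transpose = -killingForm G t y := by
  ext a b
  have := hT.killing y hy a b
  simp only [killingForm, Matrix.transpose_apply, Matrix.neg_apply, Matrix.of_apply]
  linarith

/-- The covariant derivative `D_m D_a T_b`. -/
def _root_.Coord.covDKillingForm (G : E4 → Matrix (Fin 4) (Fin 4) ℝ) (t : Fin 4 → E4 → ℝ)
    (m a b : Fin 4) (y : E4) : ℝ :=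
  pd m (covDLower G t a b) y - ∑ l, (christoffel G l m a y * covDLower G t l b y
    + christoffel G l m b y * covDLower G t a l y)

/-- The Ricci identity for the 1-form `T_b`. -/
theorem covDKillingForm_comm (hT : IsKillingOn G t Ω) (hG : IsMetricOn G Ω) (hy : y ∈ Ω)
    (m a b : Fin 4) : covDKillingForm G t m a b y - covDKillingForm G t a m b y =
      -∑ k, riemannUp G k b m a y * lower G t k y := by
  have hl : ∀ k, DifferentiableAt ℝ (lower G t k) y := fun k =>
    differentiableAt_of_contDiffOn hG.isOpen (hT.smooth_lower hG k) hy
  have hc : ∀ k i j, DifferentiableAt ℝ (christoffel G k i j) y := fun k i j =>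
    differentiableAt_of_contDiffOn hG.isOpen (hG.smooth_conn i k j) hy
  have h1 : ∀ m a, pd m (covDLower G t a b) y = pd m (pd a (lower G t b)) y -
      ∑ k, (pd m (christoffel G k a b) y * lower G t k y
        + christoffel G k a b y * pd m (lower G t k) y) := by
    intro m a
    have e : covDLower G t a b = fun z =>
      pd a (lower G t b) z - ∑ k, christoffel G k a b z * lower G t k z := rfl
    rw [e, pd_sub (differentiableAt_of_contDiffOn hG.isOpen
      (contDiffOn_pd hG.isOpen (hT.smooth_lower hG b) a) hy)
      (.fun_sum fun k _ => (hc k a b).fun_mul (hl k)),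
      pd_sum _ fun k _ => (hc k a b).fun_mul (hl k)]
    congr 1
    exact Finset.sum_congr rfl fun k _ => pd_mul (hc k a b) (hl k) m
  simp only [covDKillingForm, h1, riemannUp, covDLower_eq]
  rw [pd_comm hG.isOpen (hT.smooth_lower hG b) hy m a]
  simp only [hG.christoffel_symm hy _ a m]
  simp only [Fin.sum_univ_four]
  ring

theorem sum_riemannUp_mul_lower (hG : IsMetricOn G Ω) (hy : y ∈ Ω) (b m a : Fin 4) :
    ∑ k, riemannUp G k b m a y * lower G t k y = ∑ c, t c y * riemann G c b m a y := by
  simp only [lower, riemann, Finset.mul_sum]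
  rw [Finset.sum_comm]
  exact Finset.sum_congr rfl fun c _ => Finset.sum_congr rfl fun k _ => by
    rw [hG.symm_apply hy k c]; ring

/-- A Killing field satisfies `D_m D_a T_b = R_{cmab} T^c`. -/
theorem covDKillingForm_eq (hT : IsKillingOn G t Ω) (hG : IsMetricOn G Ω) (hy : y ∈ Ω)
    (m a b : Fin 4) : covDKillingForm G t m a b y = ∑ c, t c y * riemann G c m a b y := by
  have hs : ∀ m a b, covDKillingForm G t m b a y = -covDKillingForm G t m a b y := by
    intro m a b
    have h1 : ∀ z ∈ Ω, ∀ a b, covDLower G t b a z = -covDLower G t a b z := fun z hz a b => by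
      linarith [hT.killing z hz a b]
    simp only [covDKillingForm]
    rw [pd_congr_on hG.isOpen hy (fun z hz => h1 z hz a b), pd_neg]
    simp only [h1 y hy _ b, h1 y hy a]
    rw [neg_sub, ← sub_eq_zero]
    simp only [Fin.sum_univ_four]
    ring
  have hr := fun m a b => hT.covDKillingForm_comm hG hy m a b
  simp only [sum_riemannUp_mul_lower hG hy] at hr
  have hcyc : ∑ c, t c y * riemann G c m a b y + ∑ c, t c y * riemann G c a b m y +
      ∑ c, t c y * riemann G c b m a y = 0 := by
    rw [← Finset.sum_add_distrib, ← Finset.sum_add_distrib]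
    refine Finset.sum_eq_zero fun c _ => ?_
    linear_combination t c y * hG.riemann_cyclic hy c m a b
  -- Three cyclic copies of the Ricci identity, together with the antisymmetry of DF in its last two
  -- indices, determine D_m F_ab; the first Bianchi identity collapses the curvature terms to one.
  linarith [hr m a b, hr a b m, hr b m a, hs m a b, hs a b m, hs b m a]

theorem pdMatrix_killingForm (hT : IsKillingOn G t Ω) (hG : IsMetricOn G Ω) (hy : y ∈ Ω)
    (m : Fin 4) :
    pdMatrix m (killingForm G t) y - (conn G m y).transpose * killingForm G t y
      - killingForm G t y * conn G m y =
    ∑ c, t c y • Matrix.of fun a b => riemann G c m a b y := by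
  ext a b
  have h := hT.covDKillingForm_eq hG hy m a b
  rw [Matrix.sub_apply, Matrix.sub_apply, Matrix.sum_apply, Matrix.mul_apply, Matrix.mul_apply]
  simp only [Matrix.smul_apply, smul_eq_mul, Matrix.of_apply]
  rw [← h, covDKillingForm, Finset.sum_add_distrib]
  have e2 : ∑ j, killingForm G t y a j * conn G m y j b =
      ∑ l, christoffel G l m b y * covDLower G t a l y :=
      Finset.sum_congr rfl fun j _ => mul_comm _ _
  rw [e2, sub_sub]
  rfl

/-- The dual passes through the derivative and lands on the second pair of R_{cmab}. Ricci-flatness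
enters here, to trade this right dual for the left dual occurring in 𝓡. -/
theorem pdMatrix_hodge_killingForm (hT : IsKillingOn G t Ω) (hG : IsMetricOn G Ω)
    (hep : IsVolumeOn G ep Ω) (hy : y ∈ Ω) (hR : ∀ i j, ricci G i j y = 0) (m : Fin 4) :
    pdMatrix m (fun z => hodgeMatrix G ep (killingForm G t z) z) y
      - (conn G m y).transpose * hodgeMatrix G ep (killingForm G t y) y
      - hodgeMatrix G ep (killingForm G t y) y * conn G m y =
    ∑ c, t c y • Matrix.of fun a b => starRiemann G ep c m a b y := by
  rw [hep.pdMatrix_hodgeMatrix hG hy ((hT.smooth_killingForm hG).diffAt hG.isOpen hy),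
    hT.pdMatrix_killingForm hG hy, hodgeMatrix_sum]
  simp only [hodgeMatrix_smul]
  have h : ∀ X B C : Matrix (Fin 4) (Fin 4) ℝ, X + B + C - B - C = X := by intros; abel
  rw [h]
  refine Finset.sum_congr rfl fun c _ => congrArg _ ?_
  ext a b
  rw [Matrix.of_apply, ← hG.starRiemann_pair hy hR c m a b, starRiemann, metric_mul_curv_eq]
  simp only [hG.riemann_pair hy c m]

end IsKillingOn

end Coord
end

noncomputable section
namespace Coord

variable {G : E4 → Matrix (Fin 4) (Fin 4) ℝ} {ep : Fin 4 → Fin 4 → Fin 4 → Fin 4 → E4 → ℝ}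
  {t : Fin 4 → E4 → ℝ} {Ω : Set E4} {y : E4}

/-! ### Self-dual 2-forms -/

theorem star_star {𝕜 : Type*} [Field 𝕜] [CharZero 𝕜] (w : Matrix (Fin 4) (Fin 4) 𝕜)
    (hw : w.transpose = -w) : star (star w) = w := by
  ext a b
  have hab : w b a = -w a b := congrFun (congrFun hw a) b
  have h : ∀ m n, ∑ c, ∑ d, (leviCivita a b c d : 𝕜) * (leviCivita c d m n : 𝕜) =
      2 * ((if a = m then 1 else 0) * (if b = n then 1 else 0) -
        (if a = n then 1 else 0) * (if b = m then 1 else 0)) := by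
    intro m n
    have := congrArg (Int.cast (R := 𝕜)) (leviCivita_contract a b m n)
    push_cast at this
    exact this
  have h2 : star (star w) a b = 1 / 4 * ∑ m, ∑ n,
      (∑ c, ∑ d, (leviCivita a b c d : 𝕜) * (leviCivita c d m n : 𝕜)) * w m n := by
    simp only [star_apply, Finset.mul_sum, Finset.sum_mul]
    rw [sum_pair_comm]
    refine Finset.sum_congr rfl fun c _ => Finset.sum_congr rfl fun d _ =>
      Finset.sum_congr rfl fun m _ => Finset.sum_congr rfl fun n _ => by ring
  rw [h2]
  simp only [h]
  simp [mul_sub, sub_mul, Finset.sum_sub_distrib]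
  rw [hab]
  ring

/-- The finite counterpart of `star_derivation`: `star` is GL(4)-equivariant up to a determinant, by
the Leibniz formula applied to P. -/
theorem mul_star_mul_transpose {𝕜 : Type*} [Field 𝕜] (P X : Matrix (Fin 4) (Fin 4) 𝕜) :
    P * star (P.transpose * X * P) * P.transpose = P.det • star X := by
  ext a b
  have h0 : ∀ m n, (P.transpose * X * P) m n = ∑ k, ∑ l, P k m * P l n * X k l := fun m n => by
    simpa using raise_apply P.transpose X m n
  rw [raise_apply]
  simp only [star_apply, h0, Matrix.smul_apply, smul_eq_mul, Finset.mul_sum]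
  have h1 : ∀ k l, P.det * (1 / 2 * ((leviCivita a b k l : 𝕜) * X k l)) =
      ∑ c, ∑ d, ∑ m, ∑ n, P a c * P b d *
        (1 / 2 * ((leviCivita c d m n : 𝕜) * (P k m * P l n * X k l))) := by
    intro k l
    have h := congrArg (· * (1 / 2 * X k l)) (sum_leviCivita_mul_matrix P a b k l)
    simp only [Finset.sum_mul] at h
    rw [show P.det * (1 / 2 * ((leviCivita a b k l : 𝕜) * X k l)) =
      (leviCivita a b k l : 𝕜) * P.det * (1 / 2 * X k l) by ring, ← h]
    exact Finset.sum_congr rfl fun c _ => Finset.sum_congr rfl fun d _ =>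
      Finset.sum_congr rfl fun m _ => Finset.sum_congr rfl fun n _ => by ring
  simp only [h1]
  refine Eq.symm ((sum_pair_comm _).trans ?_)
  exact Finset.sum_congr rfl fun c _ => Finset.sum_congr rfl fun d _ => sum_pair_comm _

/-- `star` itself is an involution on 2-forms. The sign comes from ε₀₁₂₃² = -det G, that is, from
the Lorentzian signature; it makes ±i the eigenvalues of ⋆. -/
theorem hodgeMatrix_hodgeMatrix (hep : IsVolumeOn G ep Ω) (hG : IsMetricOn G Ω) (hy : y ∈ Ω)
    (w : Matrix (Fin 4) (Fin 4) ℝ) (hw : w.transpose = -w) :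
    hodgeMatrix G ep (hodgeMatrix G ep w y) y = -w := by
  have h := mul_star_mul_transpose (G y)⁻¹ w
  rw [hG.inv_symm hy] at h
  simp only [hodgeMatrix, hG.inv_symm hy, Matrix.mul_smul, Matrix.smul_mul, star_smul, h]
  rw [star_star w hw, smul_smul, smul_smul, ← sq, hep.sq_eq y hy, Matrix.det_nonsing_inv,
    Ring.inverse_eq_inv', neg_mul, mul_inv_cancel₀ (hG.det_ne_zero y hy), neg_one_smul]

/-- The inverse metric as a complex matrix. -/
def gInvC (G : E4 → Matrix (Fin 4) (Fin 4) ℝ) (y : E4) : Matrix (Fin 4) (Fin 4) ℂ :=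
  Matrix.of fun a b => (gInv G y a b : ℂ)

/-- The metric as a complex matrix. -/
def metricC (G : E4 → Matrix (Fin 4) (Fin 4) ℝ) (y : E4) : Matrix (Fin 4) (Fin 4) ℂ :=
  Matrix.of fun a b => (G y a b : ℂ)

/-- `w + i ⋆w`. -/
def selfDualPart (G : E4 → Matrix (Fin 4) (Fin 4) ℝ)
    (ep : Fin 4 → Fin 4 → Fin 4 → Fin 4 → E4 → ℝ) (w : Matrix (Fin 4) (Fin 4) ℝ) (y : E4) :
    Matrix (Fin 4) (Fin 4) ℂ :=
  Matrix.of fun a b => (w a b : ℂ) + Complex.I * (hodgeMatrix G ep w y a b : ℂ)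

/-- A complex 2-form `w` is self-dual if `⋆w = -i w`. -/
structure IsSelfDual (G : E4 → Matrix (Fin 4) (Fin 4) ℝ)
    (ep : Fin 4 → Fin 4 → Fin 4 → Fin 4 → E4 → ℝ) (w : Matrix (Fin 4) (Fin 4) ℂ) (y : E4) :
    Prop where
  antisymm : w.transpose = -w
  eq_star : w = (Complex.I * (ep 0 1 2 3 y : ℂ)) • star (gInvC G y * w * gInvC G y)

theorem metricC_eq_map : metricC G y = (G y).map Complex.ofRealHom := rfl

theorem gInvC_eq_map : gInvC G y = ((G y)⁻¹).map Complex.ofRealHom := rfl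

theorem star_map (X : Matrix (Fin 4) (Fin 4) ℝ) :
    star (X.map Complex.ofRealHom) = (star X).map Complex.ofRealHom := by
  ext a b
  simp [star_apply]

namespace IsMetricOn

theorem gInvC_mul_metricC (hG : IsMetricOn G Ω) (hy : y ∈ Ω) : gInvC G y * metricC G y = 1 := by
  rw [gInvC_eq_map, metricC_eq_map, ← Matrix.map_mul, hG.inv_mul hy]
  simp

theorem metricC_mul_gInvC (hG : IsMetricOn G Ω) (hy : y ∈ Ω) : metricC G y * gInvC G y = 1 := by
  rw [gInvC_eq_map, metricC_eq_map, ← Matrix.map_mul, hG.mul_inv hy]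
  simp

theorem gInvC_transpose (hG : IsMetricOn G Ω) (hy : y ∈ Ω) :
    (gInvC G y).transpose = gInvC G y := by
  ext a b
  simp only [gInvC, Matrix.transpose_apply, Matrix.of_apply, hG.gInv_symm hy b a]

theorem metricC_transpose (hG : IsMetricOn G Ω) (hy : y ∈ Ω) :
    (metricC G y).transpose = metricC G y := by
  ext a b
  simp only [metricC, Matrix.transpose_apply, Matrix.of_apply, hG.symm_apply hy b a]

end IsMetricOn

/-- Since ⋆⋆ = -1, i⋆(w + i⋆w) = i⋆w + w. -/
theorem isSelfDual_selfDualPart (hep : IsVolumeOn G ep Ω) (hG : IsMetricOn G Ω) (hy : y ∈ Ω)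
    (w : Matrix (Fin 4) (Fin 4) ℝ) (hw : w.transpose = -w) :
    IsSelfDual G ep (selfDualPart G ep w y) y := by
  have hsd : selfDualPart G ep w y = w.map Complex.ofRealHom +
      Complex.I • (hodgeMatrix G ep w y).map Complex.ofRealHom := rfl
  have hH : ∀ v : Matrix (Fin 4) (Fin 4) ℝ, (ep 0 1 2 3 y : ℂ) •
      star (gInvC G y * v.map Complex.ofRealHom * gInvC G y) =
      (hodgeMatrix G ep v y).map Complex.ofRealHom := by
    intro v
    rw [gInvC_eq_map, ← Matrix.map_mul, ← Matrix.map_mul, star_map, hodgeMatrix, hG.inv_symm hy]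
    ext a b
    simp
  refine ⟨?_, ?_⟩
  · ext a b
    have h1 : w b a = -w a b := congrFun (congrFun hw a) b
    have h2 : hodgeMatrix G ep w y b a = -hodgeMatrix G ep w y a b :=
      congrFun (congrFun (hodgeMatrix_transpose w) a) b
    simp only [Matrix.transpose_apply, selfDualPart, Matrix.of_apply, Matrix.neg_apply, h1, h2]
    push_cast
    ring
  · rw [mul_smul, hsd, Matrix.mul_add, Matrix.add_mul, Matrix.mul_smul, Matrix.smul_mul, star_add,
      star_smul, smul_add, smul_comm _ Complex.I, hH, hH, hodgeMatrix_hodgeMatrix hep hG hy w hw,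
      smul_add, smul_smul, Complex.I_mul_I, add_comm]
    ext a b
    simp

theorem IsSelfDual.smul {w : Matrix (Fin 4) (Fin 4) ℂ} (hw : IsSelfDual G ep w y) (k : ℂ) :
    IsSelfDual G ep (k • w) y := by
  refine ⟨?_, ?_⟩
  · rw [Matrix.transpose_smul, hw.antisymm, smul_neg]
  · rw [Matrix.mul_smul, Matrix.smul_mul, star_smul, smul_comm, ← hw.eq_star]

/-- The anticommutator of two self-dual 2-forms is a multiple of the metric. -/
theorem IsSelfDual.anticomm {A B : Matrix (Fin 4) (Fin 4) ℂ} (hA : IsSelfDual G ep A y)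
    (hB : IsSelfDual G ep B y) (hG : IsMetricOn G Ω) (hy : y ∈ Ω) :
    A * gInvC G y * B + B * gInvC G y * A =
      (-(1 / 2) * ∑ c, ∑ d, A c d * (gInvC G y * B * gInvC G y) c d) • metricC G y := by
  have hup : ∀ w : Matrix (Fin 4) (Fin 4) ℂ, w.transpose = -w →
      (gInvC G y * w * gInvC G y).transpose = -(gInvC G y * w * gInvC G y) := by
    intro w hw
    rw [Matrix.transpose_mul, Matrix.transpose_mul, hG.gInvC_transpose hy, hw]
    simp only [Matrix.neg_mul, Matrix.mul_neg, Matrix.mul_assoc]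
  set X := gInvC G y * A * gInvC G y with hX
  set Y := gInvC G y * B * gInvC G y with hY
  have h := star_mul_add_star_mul X Y (hup A hA.antisymm) (hup B hB.antisymm)
  -- Self-duality reads A = iε₀₁₂₃ `star` X and B = iε₀₁₂₃ `star` Y, so scaling the real-type
  -- identity `h` by iε₀₁₂₃ removes every `star`.
  have h1 : A * Y.transpose + B * X.transpose =
      (1 / 2 * ∑ c, ∑ d, A c d * Y c d) • (1 : Matrix (Fin 4) (Fin 4) ℂ) := by
    ext s b
    have hs := congrArg ((Complex.I * (ep 0 1 2 3 y : ℂ)) * ·) (h s b)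
    have hAe : ∀ i j, A i j = (Complex.I * (ep 0 1 2 3 y : ℂ)) * star X i j := fun i j =>
      congrFun (congrFun hA.eq_star i) j
    have hBe : ∀ i j, B i j = (Complex.I * (ep 0 1 2 3 y : ℂ)) * star Y i j := fun i j =>
      congrFun (congrFun hB.eq_star i) j
    rw [Matrix.add_apply, Matrix.mul_apply, Matrix.mul_apply, ← Finset.sum_add_distrib]
    simp only [Matrix.transpose_apply, Matrix.smul_apply, Matrix.one_apply, smul_eq_mul, hAe, hBe]
    simp only [Finset.mul_sum] at hs ⊢
    simp only [Finset.sum_mul]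
    refine Eq.trans ?_ (hs.trans ?_)
    · exact Finset.sum_congr rfl fun r _ => by ring
    · exact Finset.sum_congr rfl fun c _ => Finset.sum_congr rfl fun d _ => by ring
  rw [hup A hA.antisymm, hup B hB.antisymm] at h1
  have h2 := congrArg (· * metricC G y) h1
  simp only [Matrix.add_mul, hY, Matrix.mul_neg, Matrix.neg_mul, Matrix.mul_assoc,
    hG.gInvC_mul_metricC hy, Matrix.mul_one, Matrix.smul_mul, Matrix.one_mul] at h2
  rw [neg_mul, neg_smul]
  simp only [Matrix.mul_assoc]
  rw [hY, Matrix.mul_assoc, ← h2, neg_add, neg_neg, neg_neg]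

/-! ### The tensors `𝓕` and `𝓘` -/

/-- `𝓘_{··mn}` as a matrix. -/
def matII (G : E4 → Matrix (Fin 4) (Fin 4) ℝ)
    (ep : Fin 4 → Fin 4 → Fin 4 → Fin 4 → E4 → ℝ) (m n : Fin 4) (y : E4) :
    Matrix (Fin 4) (Fin 4) ℂ := Matrix.of fun a b => II G ep a b m n y

/-- `𝓕` as a matrix. -/
def matFF (G : E4 → Matrix (Fin 4) (Fin 4) ℝ)
    (ep : Fin 4 → Fin 4 → Fin 4 → Fin 4 → E4 → ℝ) (t : Fin 4 → E4 → ℝ) (y : E4) :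
    Matrix (Fin 4) (Fin 4) ℂ := Matrix.of fun a b => FF G ep t a b y

theorem matFF_apply (a b : Fin 4) : matFF G ep t y a b = FF G ep t a b y := rfl

theorem IsVolumeOn.matFF_eq (hep : IsVolumeOn G ep Ω) (hy : y ∈ Ω) :
    matFF G ep t y = selfDualPart G ep (killingForm G t y) y := by
  ext a b
  have h := hep.hodge_eq hy (killingForm G t y) a b
  exact congrArg (fun x : ℝ => (covDLower G t a b y : ℂ) + Complex.I * (x : ℂ)) h

/-- For fixed m, n, the metric part of 𝓘 is a decomposable 2-form whose Hodge dual is ε_{··mn}.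
Hence 𝓘 is self-dual in its first pair. -/
theorem IsVolumeOn.matII_eq (hep : IsVolumeOn G ep Ω) (hG : IsMetricOn G Ω) (hy : y ∈ Ω)
    (m n : Fin 4) : matII G ep m n y = (1 / 4 : ℂ) • selfDualPart G ep
      (Matrix.of fun a b => G y a m * G y b n - G y a n * G y b m) y := by
  have hg : ∀ c m, ∑ k, (G y)⁻¹ c k * G y k m = if c = m then 1 else 0 := fun c m => by
    rw [← Matrix.mul_apply, hG.inv_mul hy, Matrix.one_apply]
  have h1 : ∀ c d, ((G y)⁻¹ * (Matrix.of fun a b => G y a m * G y b n - G y a n * G y b m) *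
      ((G y)⁻¹).transpose) c d = (if c = m then 1 else 0) * (if d = n then 1 else 0) -
        (if c = n then 1 else 0) * (if d = m then 1 else 0) := by
    intro c d
    rw [raise_apply, ← hg, ← hg, ← hg, ← hg]
    simp only [Finset.sum_mul_sum, ← Finset.sum_sub_distrib, Matrix.of_apply]
    exact Finset.sum_congr rfl fun k _ => Finset.sum_congr rfl fun l _ => by ring
  have h2 : ∀ a b, hodgeMatrix G ep (Matrix.of fun a b => G y a m * G y b n - G y a n * G y b m) y
      a b = ep a b m n y := by
    intro a b
    rw [hodgeMatrix, Matrix.smul_apply, star_apply]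
    simp only [h1]
    rw [hep.eq_mul y hy a b m n]
    simp [mul_sub, Finset.sum_sub_distrib, leviCivita_swap_right a b m n]
    ring
  ext a b
  simp only [matII, selfDualPart, II, Matrix.smul_apply, Matrix.of_apply, h2, smul_eq_mul]
  ring

theorem IsVolumeOn.isSelfDual_matII (hep : IsVolumeOn G ep Ω) (hG : IsMetricOn G Ω) (hy : y ∈ Ω)
    (m n : Fin 4) : IsSelfDual G ep (matII G ep m n y) y := by
  rw [hep.matII_eq hG hy]
  refine (isSelfDual_selfDualPart hep hG hy _ ?_).smul _
  ext a b
  simp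
  ring

theorem IsVolumeOn.isSelfDual_matFF (hep : IsVolumeOn G ep Ω) (hG : IsMetricOn G Ω)
    (hT : IsKillingOn G t Ω) (hy : y ∈ Ω) : IsSelfDual G ep (matFF G ep t y) y := by
  rw [hep.matFF_eq hy]
  exact isSelfDual_selfDualPart hep hG hy _ (hT.killingForm_transpose hy)

theorem IsMetricOn.matFFup_eq (hG : IsMetricOn G Ω) (hy : y ∈ Ω) (a b : Fin 4) :
    (gInvC G y * matFF G ep t y * gInvC G y) a b = FFup G ep t a b y := by
  have h := fun P w : Matrix (Fin 4) (Fin 4) ℂ => raise_apply P w a b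
  have h2 := h (gInvC G y) (matFF G ep t y)
  rw [hG.gInvC_transpose hy] at h2
  exact h2

theorem IsMetricOn.matFFmixed_eq (hG : IsMetricOn G Ω) (hy : y ∈ Ω) (a b : Fin 4) :
    (matFF G ep t y * gInvC G y) a b = FFmixed G ep t a b y := by
  rw [Matrix.mul_apply, FFmixed]
  refine Finset.sum_congr rfl fun c _ => ?_
  rw [mul_comm, hG.gInv_symm hy b c]
  rfl

theorem IsVolumeOn.II_pair (hep : IsVolumeOn G ep Ω) (hG : IsMetricOn G Ω) (hy : y ∈ Ω)
    (a b m n : Fin 4) : II G ep m n a b y = II G ep a b m n y := by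
  simp only [II]
  rw [hep.eq_mul y hy m n, hep.eq_mul y hy a b, leviCivita_pair_swap a b m n,
    hG.symm_apply hy m a, hG.symm_apply hy n b, hG.symm_apply hy m b, hG.symm_apply hy n a,
    mul_comm (G y b m)]

/-- `𝓘` acts as the identity on self-dual forms. -/
theorem IsVolumeOn.sum_II_mul_FFup (hep : IsVolumeOn G ep Ω) (hG : IsMetricOn G Ω)
    (hT : IsKillingOn G t Ω) (hy : y ∈ Ω) (m n : Fin 4) :
    ∑ a, ∑ b, II G ep a b m n y * FFup G ep t a b y = FF G ep t m n y := by
  have hF := hep.isSelfDual_matFF hG hT hy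
  have h1 := congrFun (congrFun hF.eq_star m) n
  rw [Matrix.smul_apply, star_apply] at h1
  have h2 : ∀ m n, ∑ a, ∑ b, (G y a m : ℂ) * (G y b n : ℂ) * FFup G ep t a b y =
      FF G ep t m n y := by
    intro m n
    have h := raise_apply (metricC G y) (gInvC G y * matFF G ep t y * gInvC G y) m n
    simp only [hG.metricC_transpose hy, Matrix.mul_assoc, hG.gInvC_mul_metricC hy,
      Matrix.mul_one] at h
    rw [← Matrix.mul_assoc, hG.metricC_mul_gInvC hy, Matrix.one_mul, matFF_apply] at h
    rw [h]
    simp only [← Matrix.mul_assoc, hG.matFFup_eq hy]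
    exact Finset.sum_congr rfl fun a _ => Finset.sum_congr rfl fun b _ => by
      rw [hG.symm_apply hy a m, hG.symm_apply hy b n]; rfl
  have h3 := h2 n m
  have h4 : FF G ep t n m y = -FF G ep t m n y := congrFun (congrFun hF.antisymm m) n
  rw [h4] at h3
  have h5 := h2 m n
  simp only [hG.matFFup_eq hy, matFF_apply] at h1
  have h6 : ∀ a b, II G ep a b m n y * FFup G ep t a b y =
      1 / 4 * ((G y a m : ℂ) * (G y b n : ℂ) * FFup G ep t a b y)
      - 1 / 4 * ((G y a n : ℂ) * (G y b m : ℂ) * FFup G ep t a b y)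
      + 1 / 4 * (Complex.I * (ep 0 1 2 3 y : ℂ) *
        ((leviCivita m n a b : ℂ) * FFup G ep t a b y)) := by
    intro a b
    rw [II, hep.eq_mul y hy a b m n, leviCivita_pair_swap m n a b]
    push_cast
    ring
  -- The two metric terms give ½𝓕 by antisymmetry, and the ε term gives the other ½𝓕 by
  -- self-duality.
  simp only [h6, Finset.sum_add_distrib, Finset.sum_sub_distrib, ← Finset.mul_sum, h5, h3]
  rw [smul_eq_mul] at h1
  linear_combination (-1 / 2 : ℂ) * h1

end Coord
end

noncomputable section
namespace Coord

variable {G : E4 → Matrix (Fin 4) (Fin 4) ℝ} {ep : Fin 4 → Fin 4 → Fin 4 → Fin 4 → E4 → ℝ}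
  {t : Fin 4 → E4 → ℝ} {h : E4 → ℂ} {Ω : Set E4} {y : E4}

/-! ### The contraction on the right-hand side -/

/-- `T^s S_{srcd} [𝓕_b^r δ^c_m δ^d_n + ⅔ 𝓘^r_{bmn} 𝓕^{cd}]`. -/
def killingContraction (G : E4 → Matrix (Fin 4) (Fin 4) ℝ)
    (ep : Fin 4 → Fin 4 → Fin 4 → Fin 4 → E4 → ℝ) (t : Fin 4 → E4 → ℝ)
    (S : Fin 4 → Fin 4 → Fin 4 → Fin 4 → ℂ) (b m n : Fin 4) (y : E4) : ℂ :=
  ∑ s, ∑ r, (t s y : ℂ) * (S s r m n * FFmixed G ep t b r y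
    + 2 / 3 * (∑ c, ∑ d, S s r c d * FFup G ep t c d y)
      * ∑ l, (gInv G y r l : ℂ) * II G ep l b m n y)

theorem killingContraction_add (S S' : Fin 4 → Fin 4 → Fin 4 → Fin 4 → ℂ) (b m n : Fin 4) :
    killingContraction G ep t (fun s r c d => S s r c d + S' s r c d) b m n y =
      killingContraction G ep t S b m n y + killingContraction G ep t S' b m n y := by
  simp only [killingContraction, ← Finset.sum_add_distrib, add_mul]
  refine Finset.sum_congr rfl fun s _ => Finset.sum_congr rfl fun r _ => ?_
  simp only [Finset.sum_add_distrib]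
  ring

theorem killingContraction_smul (k : ℂ) (S : Fin 4 → Fin 4 → Fin 4 → Fin 4 → ℂ) (b m n : Fin 4) :
    killingContraction G ep t (fun s r c d => k * S s r c d) b m n y =
      k * killingContraction G ep t S b m n y := by
  simp only [killingContraction, Finset.mul_sum (s := Finset.univ) (a := k)]
  refine Finset.sum_congr rfl fun s _ => Finset.sum_congr rfl fun r _ => ?_
  simp only [mul_assoc, ← Finset.mul_sum]
  ring

theorem mainTerm_eq (b m n : Fin 4) : mainTerm G ep t h b m n y =
    -6 * (h y)⁻¹ * killingContraction G ep t (fun s r c d => SS G ep t h s r c d y) b m n y := by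
  rw [mainTerm, killingContraction]
  congr 1
  refine Finset.sum_congr rfl fun s _ => Finset.sum_congr rfl fun r _ => ?_
  have h1 : ∀ A B : ℂ, ∑ c, ∑ d, (t s y : ℂ) * SS G ep t h s r c d y *
      (A * (if c = m then 1 else 0) * (if d = n then 1 else 0) + 2 / 3 * B * FFup G ep t c d y) =
      (t s y : ℂ) * (SS G ep t h s r m n y * A +
        2 / 3 * (∑ c, ∑ d, SS G ep t h s r c d y * FFup G ep t c d y) * B) := by
    intro A B
    have e : ∑ c, ∑ d, (t s y : ℂ) * SS G ep t h s r c d y *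
        (A * (if c = m then 1 else 0) * (if d = n then 1 else 0)) =
        (t s y : ℂ) * SS G ep t h s r m n y * A := by simp
    simp only [mul_add, Finset.sum_add_distrib]
    rw [e, Finset.mul_sum, Finset.sum_mul, Finset.mul_sum]
    simp only [Finset.mul_sum, Finset.sum_mul]
    congr 1
    · ring
    · exact Finset.sum_congr rfl fun c _ => Finset.sum_congr rfl fun d _ => by ring
  exact h1 _ _

theorem FFsq_eq (hG : IsMetricOn G Ω) (hy : y ∈ Ω) : FFsq G ep t y =
    ∑ c, ∑ d, matFF G ep t y c d * (gInvC G y * matFF G ep t y * gInvC G y) c d := by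
  simp only [hG.matFFup_eq hy]
  rfl

/-- The algebraic identity for the terms of second order in `h⁻¹`. -/
theorem killingContraction_QQ (hG : IsMetricOn G Ω) (hep : IsVolumeOn G ep Ω)
    (hT : IsKillingOn G t Ω) (hy : y ∈ Ω) (b m n : Fin 4) :
    6 * killingContraction G ep t (fun s r c d => QQ G ep t s r c d y) b m n y =
      -∑ r, (∑ l, (gInv G y r l : ℂ) * ernst G ep t l y) * QQ G ep t r b m n y := by
  have hF := hep.isSelfDual_matFF hG hT hy
  have hJ := hep.isSelfDual_matII hG hy m n
  have hFF := hF.anticomm hF hG hy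
  have hJF := hJ.anticomm hF hG hy
  rw [← FFsq_eq hG hy] at hFF
  have hI : ∑ c, ∑ d, matII G ep m n y c d * (gInvC G y * matFF G ep t y * gInvC G y) c d =
      FF G ep t m n y := by
    simp only [hG.matFFup_eq hy]
    exact hep.sum_II_mul_FFup hG hT hy m n
  rw [hI] at hJF
  -- Contracting 𝓠 with 𝓕 leaves 𝓕²𝓕 - ⅓𝓕²𝓕. Together with the ⅔ in the contraction this is the
  -- source of the 4/9 in `hL`.
  have hQ : ∀ s r, ∑ c, ∑ d, QQ G ep t s r c d y * FFup G ep t c d y =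
      2 / 3 * FFsq G ep t y * FF G ep t s r y := by
    intro s r
    have h1 : ∑ c, ∑ d, II G ep s r c d y * FFup G ep t c d y = FF G ep t s r y := by
      rw [← hep.sum_II_mul_FFup hG hT hy s r]
      exact Finset.sum_congr rfl fun c _ => Finset.sum_congr rfl fun d _ => by
        rw [hep.II_pair hG hy c d]
    have h2 : ∀ c d, QQ G ep t s r c d y * FFup G ep t c d y =
        FF G ep t s r y * (FF G ep t c d y * FFup G ep t c d y) -
          1 / 3 * FFsq G ep t y * (II G ep s r c d y * FFup G ep t c d y) := by
      intro c d; rw [QQ]; ring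
    simp only [h2, Finset.sum_sub_distrib, ← Finset.mul_sum, h1]
    rw [show ∑ c, ∑ d, FF G ep t c d y * FFup G ep t c d y = FFsq G ep t y from rfl]
    ring
  have eFF : ∀ s, ∑ r, FF G ep t s r y * FFmixed G ep t b r y =
      -(matFF G ep t y * gInvC G y * matFF G ep t y) s b := by
    intro s
    have h1 : matFF G ep t y * gInvC G y * matFF G ep t y =
        -(matFF G ep t y * (matFF G ep t y * gInvC G y).transpose) := by
      rw [Matrix.transpose_mul, hF.antisymm, hG.gInvC_transpose hy, Matrix.mul_neg,
        Matrix.mul_neg, neg_neg, Matrix.mul_assoc]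
    rw [h1, Matrix.neg_apply, neg_neg, Matrix.mul_apply]
    exact Finset.sum_congr rfl fun r _ => by
      rw [Matrix.transpose_apply, hG.matFFmixed_eq hy, matFF_apply]
  have eJF : ∀ s, ∑ r, II G ep s r m n y * FFmixed G ep t b r y =
      -(matII G ep m n y * gInvC G y * matFF G ep t y) s b := by
    intro s
    have h1 : matII G ep m n y * gInvC G y * matFF G ep t y =
        -(matII G ep m n y * (matFF G ep t y * gInvC G y).transpose) := by
      rw [Matrix.transpose_mul, hF.antisymm, hG.gInvC_transpose hy, Matrix.mul_neg,
        Matrix.mul_neg, neg_neg, Matrix.mul_assoc]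
    rw [h1, Matrix.neg_apply, neg_neg, Matrix.mul_apply]
    exact Finset.sum_congr rfl fun r _ => by
      rw [Matrix.transpose_apply, hG.matFFmixed_eq hy]; rfl
  have eFJ : ∀ s, ∑ r, FF G ep t s r y * (∑ l, (gInv G y r l : ℂ) * II G ep l b m n y) =
      (matFF G ep t y * gInvC G y * matII G ep m n y) s b := by
    intro s
    rw [Matrix.mul_assoc, Matrix.mul_apply]
    exact Finset.sum_congr rfl fun r _ => by rw [Matrix.mul_apply]; rfl
  have eFJ' : ∀ s, ∑ r, (∑ l, (gInv G y r l : ℂ) * FF G ep t s l y) * II G ep r b m n y =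
      (matFF G ep t y * gInvC G y * matII G ep m n y) s b := by
    intro s
    rw [Matrix.mul_apply]
    exact Finset.sum_congr rfl fun r _ => by rw [hG.matFFmixed_eq hy]; rfl
  have eFF' : ∀ s, ∑ r, (∑ l, (gInv G y r l : ℂ) * FF G ep t s l y) * FF G ep t r b y =
      (matFF G ep t y * gInvC G y * matFF G ep t y) s b := by
    intro s
    rw [Matrix.mul_apply]
    exact Finset.sum_congr rfl fun r _ => by rw [hG.matFFmixed_eq hy]; rfl
  have hL : killingContraction G ep t (fun s r c d => QQ G ep t s r c d y) b m n y =
      ∑ s, (t s y : ℂ) * ((∑ r, FF G ep t s r y * FFmixed G ep t b r y) * FF G ep t m n y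
        - 1 / 3 * FFsq G ep t y * (∑ r, II G ep s r m n y * FFmixed G ep t b r y)
        + 4 / 9 * FFsq G ep t y *
          ∑ r, FF G ep t s r y * (∑ l, (gInv G y r l : ℂ) * II G ep l b m n y)) := by
    simp only [killingContraction, hQ]
    refine Finset.sum_congr rfl fun s _ => ?_
    rw [← Finset.mul_sum]
    congr 1
    rw [Finset.sum_mul, Finset.mul_sum, Finset.mul_sum, ← Finset.sum_sub_distrib,
      ← Finset.sum_add_distrib]
    refine Finset.sum_congr rfl fun r _ => ?_
    rw [QQ]
    ring
  have hRr : ∑ r, (∑ l, (gInv G y r l : ℂ) * ernst G ep t l y) * QQ G ep t r b m n y =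
      ∑ s, (t s y : ℂ) * (2 *
        ((∑ r, (∑ l, (gInv G y r l : ℂ) * FF G ep t s l y) * FF G ep t r b y) * FF G ep t m n y
        - 1 / 3 * FFsq G ep t y *
          ∑ r, (∑ l, (gInv G y r l : ℂ) * FF G ep t s l y) * II G ep r b m n y)) := by
    have h1 : ∀ r, (∑ l, (gInv G y r l : ℂ) * ernst G ep t l y) * QQ G ep t r b m n y =
        ∑ s, (t s y : ℂ) * (2 * ∑ l, (gInv G y r l : ℂ) * FF G ep t s l y)
          * QQ G ep t r b m n y := by
      intro r
      rw [← Finset.sum_mul]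
      congr 1
      simp only [ernst, Finset.mul_sum]
      rw [Finset.sum_comm]
      exact Finset.sum_congr rfl fun s _ => Finset.sum_congr rfl fun l _ => by ring
    simp only [h1]
    rw [Finset.sum_comm]
    refine Finset.sum_congr rfl fun s _ => ?_
    rw [Finset.sum_mul, Finset.mul_sum Finset.univ _ (1 / 3 * FFsq G ep t y),
      ← Finset.sum_sub_distrib, Finset.mul_sum, Finset.mul_sum]
    refine Finset.sum_congr rfl fun r _ => ?_
    rw [QQ]
    ring
  rw [hL, hRr, Finset.mul_sum, ← Finset.sum_neg_distrib]
  refine Finset.sum_congr rfl fun s _ => ?_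
  rw [eFF, eJF, eFJ, eFJ', eFF']
  have k1 := congrFun (congrFun hFF s) b
  have k2 := congrFun (congrFun hJF s) b
  rw [Matrix.add_apply, Matrix.smul_apply, smul_eq_mul] at k1 k2
  -- With J = 𝓘_{··mn}, the two sides differ by T^s times -4(𝓕𝓕)_{sb}𝓕_{mn} + 2𝓕²(J𝓕 + 𝓕J)_{sb}. By
  -- the anticommutators these terms are +𝓕²𝓕_{mn}g_{sb} and -𝓕²𝓕_{mn}g_{sb}; the coefficient ⅔ is
  -- what balances them.
  linear_combination (-2 * (t s y : ℂ) * FF G ep t m n y) * k1 +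
    (2 * (t s y : ℂ) * FFsq G ep t y) * k2

end Coord
end

noncomputable section
namespace Coord

variable {G : E4 → Matrix (Fin 4) (Fin 4) ℝ} {ep : Fin 4 → Fin 4 → Fin 4 → Fin 4 → E4 → ℝ}
  {t : Fin 4 → E4 → ℝ} {h : E4 → ℂ} {Ω : Set E4} {y : E4}

/-! ### Covariant derivatives of the complex tensors -/

theorem contDiffOn_ofReal {f : E4 → ℝ} (hf : ContDiffOn ℝ ∞ f Ω) :
    ContDiffOn ℝ ∞ (fun z => (f z : ℂ)) Ω :=
  Complex.ofRealCLM.contDiff.comp_contDiffOn hf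

theorem contDiffOn_ofReal_add_I_mul {f g : E4 → ℝ} (hf : ContDiffOn ℝ ∞ f Ω)
    (hg : ContDiffOn ℝ ∞ g Ω) : ContDiffOn ℝ ∞ (fun z => (f z : ℂ) + Complex.I * (g z : ℂ)) Ω :=
  (contDiffOn_ofReal hf).add (contDiffOn_const.mul (contDiffOn_ofReal hg))

theorem pd_ofReal_add_I_mul {f g : E4 → ℝ} (hf : DifferentiableAt ℝ f y)
    (hg : DifferentiableAt ℝ g y) (i : Fin 4) :
    pd i (fun z => (f z : ℂ) + Complex.I * (g z : ℂ)) y =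
      ((pd i f y : ℝ) : ℂ) + Complex.I * ((pd i g y : ℝ) : ℂ) := by
  have hC : ∀ {f : E4 → ℝ}, DifferentiableAt ℝ f y → DifferentiableAt ℝ (fun z => (f z : ℂ)) y :=
    fun hf => Complex.ofRealCLM.differentiableAt.comp y hf
  rw [pd_add (hC hf) ((hC hg).const_mul _), pd_const_mul (hC hg), pd_ofReal hf, pd_ofReal hg]

theorem IsVolumeOn.RR_eq (hep : IsVolumeOn G ep Ω) (hy : y ∈ Ω) (a b m n : Fin 4) :
    RR G ep a b m n y = (riemann G a b m n y : ℂ)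
      + Complex.I * (starRiemann G ep a b m n y : ℂ) := by
  rw [RR, starRiemann, metric_mul_curv_eq, ← hep.hodge_eq hy]
  rfl

theorem IsVolumeOn.smooth_RR (hep : IsVolumeOn G ep Ω) (hG : IsMetricOn G Ω) (a b m n : Fin 4) :
    ContDiffOn ℝ ∞ (RR G ep a b m n) Ω :=
  (contDiffOn_ofReal_add_I_mul (hG.smooth_riemann a b m n)
    (hep.smooth_starRiemann hG a b m n)).congr fun _ hz => hep.RR_eq hz a b m n

theorem IsVolumeOn.FF_eq (hep : IsVolumeOn G ep Ω) (hy : y ∈ Ω) (a b : Fin 4) :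
    FF G ep t a b y = (killingForm G t y a b : ℂ)
      + Complex.I * (hodgeMatrix G ep (killingForm G t y) y a b : ℂ) :=
  congrFun (congrFun (hep.matFF_eq (t := t) hy) a) b

theorem IsVolumeOn.smooth_FF (hep : IsVolumeOn G ep Ω) (hG : IsMetricOn G Ω)
    (hT : IsKillingOn G t Ω) (a b : Fin 4) : ContDiffOn ℝ ∞ (FF G ep t a b) Ω :=
  (contDiffOn_ofReal_add_I_mul (hT.smooth_killingForm hG a b)
    (hep.smooth_hodgeMatrix hG (hT.smooth_killingForm hG) a b)).congr fun _ hz => hep.FF_eq hz a b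

theorem IsVolumeOn.smooth_ep (hep : IsVolumeOn G ep Ω) (a b m n : Fin 4) :
    ContDiffOn ℝ ∞ (ep a b m n) Ω :=
  (contDiffOn_const.mul hep.smooth).congr fun z hz => hep.eq_mul z hz a b m n

theorem IsVolumeOn.smooth_II (hep : IsVolumeOn G ep Ω) (hG : IsMetricOn G Ω) (a b m n : Fin 4) :
    ContDiffOn ℝ ∞ (II G ep a b m n) Ω := by
  have h := contDiffOn_ofReal_add_I_mul (((hG.smooth a m).mul (hG.smooth b n)).sub
    ((hG.smooth a n).mul (hG.smooth b m))) (hep.smooth_ep a b m n)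
  exact h.div_const 4

theorem IsVolumeOn.smooth_FFup (hep : IsVolumeOn G ep Ω) (hG : IsMetricOn G Ω)
    (hT : IsKillingOn G t Ω) (a b : Fin 4) : ContDiffOn ℝ ∞ (FFup G ep t a b) Ω :=
  ContDiffOn.sum fun c _ => ContDiffOn.sum fun d _ =>
    ((contDiffOn_ofReal (hG.smooth_inv a c)).mul (contDiffOn_ofReal (hG.smooth_inv b d))).mul
      (hep.smooth_FF hG hT c d)

theorem IsVolumeOn.smooth_FFsq (hep : IsVolumeOn G ep Ω) (hG : IsMetricOn G Ω)
    (hT : IsKillingOn G t Ω) : ContDiffOn ℝ ∞ (FFsq G ep t) Ω :=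
  ContDiffOn.sum fun c _ => ContDiffOn.sum fun d _ =>
    (hep.smooth_FF hG hT c d).mul (hep.smooth_FFup hG hT c d)

theorem IsVolumeOn.smooth_QQ (hep : IsVolumeOn G ep Ω) (hG : IsMetricOn G Ω)
    (hT : IsKillingOn G t Ω) (a b m n : Fin 4) : ContDiffOn ℝ ∞ (QQ G ep t a b m n) Ω :=
  ((hep.smooth_FF hG hT a b).mul (hep.smooth_FF hG hT m n)).sub
    ((contDiffOn_const.mul (hep.smooth_FFsq hG hT)).mul (hep.smooth_II hG a b m n))

/-- `𝓡` is divergence-free for a Ricci-flat metric. -/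
theorem divergence_RR (hG : IsMetricOn G Ω) (hep : IsVolumeOn G ep Ω) (hy : y ∈ Ω)
    (hR : ∀ z ∈ Ω, ∀ i j, ricci G i j z = 0) (b m n : Fin 4) :
    divergence G (RR G ep) b m n y = 0 := by
  have h1 : ∀ r a, covD G (RR G ep) r a b m n y =
      ((covDReal G (riemann G) r a b m n y : ℝ) : ℂ) +
      Complex.I * ((covDReal G (starRiemann G ep) r a b m n y : ℝ) : ℂ) := by
    intro r a
    rw [covD, covDReal, covDReal, pd_congr_on hG.isOpen hy (fun z hz => hep.RR_eq hz a b m n),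
      pd_ofReal_add_I_mul (differentiableAt_of_contDiffOn hG.isOpen (hG.smooth_riemann a b m n) hy)
      (differentiableAt_of_contDiffOn hG.isOpen (hep.smooth_starRiemann hG a b m n) hy)]
    simp only [hep.RR_eq hy, Fin.sum_univ_four]
    push_cast
    ring
  simp only [divergence, h1, mul_add, Finset.sum_add_distrib]
  have e1 := congrArg (fun x : ℝ => (x : ℂ)) (hG.divergence_riemann hy hR b m n)
  have e2 := congrArg (fun x : ℝ => Complex.I * (x : ℂ)) (hep.divergence_starRiemann hG hy b m n)
  simp only [Complex.ofReal_sum, Complex.ofReal_mul, Complex.ofReal_zero, Finset.mul_sum,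
    mul_zero] at e1 e2
  rw [e1, zero_add, ← e2]
  exact Finset.sum_congr rfl fun a _ => Finset.sum_congr rfl fun r _ => by ring

/-- `T^c 𝓡_{cmab}`, the covariant derivative of `𝓕`. -/
def killingRR (G : E4 → Matrix (Fin 4) (Fin 4) ℝ)
    (ep : Fin 4 → Fin 4 → Fin 4 → Fin 4 → E4 → ℝ) (t : Fin 4 → E4 → ℝ) (m a b : Fin 4) (y : E4) :
    ℂ := ∑ c, (t c y : ℂ) * RR G ep c m a b y

/-- `D_m 𝓕_{ab} = T^c 𝓡_{cmab}`. -/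
theorem pd_FF (hG : IsMetricOn G Ω) (hep : IsVolumeOn G ep Ω) (hT : IsKillingOn G t Ω)
    (hy : y ∈ Ω) (hR : ∀ z ∈ Ω, ∀ i j, ricci G i j z = 0) (m a b : Fin 4) :
    pd m (FF G ep t a b) y = killingRR G ep t m a b y +
      ∑ l, ((christoffel G l m a y : ℂ) * FF G ep t l b y
        + (christoffel G l m b y : ℂ) * FF G ep t a l y) := by
  have hk := hT.smooth_killingForm hG
  have h1 := congrFun (congrFun (hT.pdMatrix_killingForm hG hy m) a) b
  have h2 := congrFun (congrFun (hT.pdMatrix_hodge_killingForm hG hep hy (hR y hy) m) a) b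
  rw [Matrix.sub_apply, Matrix.sub_apply, Matrix.sum_apply, Matrix.mul_apply, Matrix.mul_apply,
    pdMatrix_apply, sub_sub, sub_eq_iff_eq_add] at h1 h2
  rw [pd_congr_on hG.isOpen hy (fun z hz => hep.FF_eq hz a b),
    pd_ofReal_add_I_mul (differentiableAt_of_contDiffOn hG.isOpen (hk a b) hy)
    (differentiableAt_of_contDiffOn hG.isOpen (hep.smooth_hodgeMatrix hG hk a b) hy), h1, h2]
  simp only [killingRR, hep.RR_eq hy, hep.FF_eq hy, Fin.sum_univ_four, Matrix.transpose_apply,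
    conn_apply, Matrix.smul_apply, Matrix.of_apply, smul_eq_mul]
  push_cast
  ring

/-- The covariant derivative of `𝓘` vanishes. -/
theorem pd_II (hG : IsMetricOn G Ω) (hep : IsVolumeOn G ep Ω) (hy : y ∈ Ω) (r a b m n : Fin 4) :
    pd r (II G ep a b m n) y =
      ∑ l, ((christoffel G l r a y : ℂ) * II G ep l b m n y
        + (christoffel G l r b y : ℂ) * II G ep a l m n y
        + (christoffel G l r m y : ℂ) * II G ep a b l n y
        + (christoffel G l r n y : ℂ) * II G ep a b m l y) := by
  have hg : ∀ a m, DifferentiableAt ℝ (fun z => G z a m) y := hG.smooth.diffAt hG.isOpen hy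
  have he : DifferentiableAt ℝ (ep a b m n) y :=
    differentiableAt_of_contDiffOn hG.isOpen (hep.smooth_ep a b m n) hy
  have hdg : ∀ a m, pd r (fun z => G z a m) y = ∑ l, (christoffel G l r a y * G y l m
      + G y a l * christoffel G l r m y) := by
    intro a m
    have h1 := congrFun (congrFun (hG.pdMatrix_metric hy r) a) m
    rw [Matrix.add_apply, Matrix.mul_apply, Matrix.mul_apply, ← Finset.sum_add_distrib] at h1
    exact h1
  have hde : pd r (ep a b m n) y = ∑ l, (christoffel G l r a y * ep l b m n y
      + christoffel G l r b y * ep a l m n y + christoffel G l r m y * ep a b l n y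
      + christoffel G l r n y * ep a b m l y) := by
    rw [pd_congr_on hG.isOpen hy (fun z hz => hep.eq_mul z hz a b m n),
      pd_const_mul (differentiableAt_of_contDiffOn hG.isOpen hep.smooth hy), hep.pd_eq hG hy]
    have h1 := congrArg (· * ep 0 1 2 3 y) (trace_mul_leviCivita (conn G r y) a b m n)
    simp only [Finset.sum_mul] at h1
    rw [← mul_assoc, mul_comm _ (Matrix.trace _), h1]
    refine Finset.sum_congr rfl fun l _ => ?_
    rw [hep.eq_mul y hy l b m n, hep.eq_mul y hy a l m n, hep.eq_mul y hy a b l n,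
      hep.eq_mul y hy a b m l]
    simp only [conn_apply]
    ring
  have h0 : II G ep a b m n = fun z => (1 / 4 : ℂ) *
      (((G z a m * G z b n - G z a n * G z b m : ℝ) : ℂ) + Complex.I * (ep a b m n z : ℂ)) := by
    funext z; rw [II]; ring
  have hd1 : DifferentiableAt ℝ (fun z => G z a m * G z b n - G z a n * G z b m) y :=
    ((hg a m).fun_mul (hg b n)).fun_sub ((hg a n).fun_mul (hg b m))
  have hd2 : DifferentiableAt ℝ (fun z =>
      ((G z a m * G z b n - G z a n * G z b m : ℝ) : ℂ) + Complex.I * (ep a b m n z : ℂ)) y :=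
    (Complex.ofRealCLM.differentiableAt.comp y hd1).add
      ((Complex.ofRealCLM.differentiableAt.comp y he).const_mul _)
  rw [h0, pd_const_mul hd2,
    pd_ofReal_add_I_mul hd1 he, pd_sub ((hg a m).fun_mul (hg b n)) ((hg a n).fun_mul (hg b m)),
    pd_mul (hg a m) (hg b n), pd_mul (hg a n) (hg b m), hdg, hdg, hdg, hdg, hde]
  simp only [II, Fin.sum_univ_four]
  push_cast
  ring

/-- Written as a trace, 𝓕² involves the connection only through a commutator, which is traceless;
the two occurrences of D𝓕 contribute equally by transposition. -/
theorem pd_FFsq (hG : IsMetricOn G Ω) (hep : IsVolumeOn G ep Ω) (hT : IsKillingOn G t Ω)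
    (hy : y ∈ Ω) (hR : ∀ z ∈ Ω, ∀ i j, ricci G i j z = 0) (m : Fin 4) :
    pd m (FFsq G ep t) y =
      2 * ∑ c, ∑ d, killingRR G ep t m c d y * FFup G ep t c d y := by
  have hPs : MatrixSmoothOn (gInvC G) Ω := fun a b => contDiffOn_ofReal (hG.smooth_inv a b)
  have hFs : MatrixSmoothOn (matFF G ep t) Ω := fun a b => hep.smooth_FF hG hT a b
  have hP := hPs.diffAt hG.isOpen hy
  have hF := hFs.diffAt hG.isOpen hy
  set A : Matrix (Fin 4) (Fin 4) ℂ := (conn G m y).map Complex.ofRealHom with hA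
  set Δ : Matrix (Fin 4) (Fin 4) ℂ := Matrix.of fun a b => killingRR G ep t m a b y with hΔ
  have hdP : pdMatrix m (gInvC G) y = -(A * gInvC G y + gInvC G y * A.transpose) := by
    have h1 : pdMatrix m (gInvC G) y =
        (pdMatrix m (fun z => (G z)⁻¹) y).map Complex.ofRealHom := by
      ext a b
      exact pd_ofReal (hG.smooth_inv.diffAt hG.isOpen hy a b) m
    rw [h1, hG.pdMatrix_inv hy, gInvC_eq_map, hA]
    ext a b
    simp [Matrix.mul_apply]
  have hdF : pdMatrix m (matFF G ep t) y =
      Δ + A.transpose * matFF G ep t y + matFF G ep t y * A := by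
    ext a b
    have h1 := pd_FF hG hep hT hy hR m a b
    rw [Finset.sum_add_distrib, ← add_assoc] at h1
    rw [Matrix.add_apply, Matrix.add_apply, Matrix.mul_apply, Matrix.mul_apply]
    refine h1.trans ?_
    congr 1
    exact Finset.sum_congr rfl fun l _ => mul_comm _ _
  have htr : ∀ z, FFsq G ep t z = Matrix.trace ((matFF G ep t z).transpose *
      (gInvC G z * matFF G ep t z * (gInvC G z).transpose)) := by
    intro z
    simp only [Matrix.trace, Matrix.diag_apply, Matrix.mul_apply (M := Matrix.transpose _),
      raise_apply]
    rw [Finset.sum_comm]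
    rfl
  have hU := (hP.mul hF).mul hP.transpose
  have hX := hF.transpose.mul hU
  have h1 : pd m (FFsq G ep t) y = Matrix.trace (pdMatrix m (fun z => (matFF G ep t z).transpose *
      (gInvC G z * matFF G ep t z * (gInvC G z).transpose)) y) := by
    rw [show FFsq G ep t = _ from funext htr]
    exact pd_sum _ (fun i _ => hX i i) m
  rw [h1, pdMatrix_mul hF.transpose hU, pdMatrix_mul (hP.mul hF) hP.transpose, pdMatrix_mul hP hF,
    pdMatrix_transpose, pdMatrix_transpose, hdP, hdF]
  have hPt := hG.gInvC_transpose hy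
  set P := gInvC G y
  set F := matFF G ep t y
  have e1 : (Δ + A.transpose * F + F * A).transpose * (P * F * P.transpose) + F.transpose *
      ((-(A * P + P * A.transpose) * F + P * (Δ + A.transpose * F + F * A)) * P.transpose
        + P * F * (-(A * P + P * A.transpose)).transpose) =
      Δ.transpose * (P * F * P) + F.transpose * (P * Δ * P)
      + (A.transpose * (F.transpose * P * F * P) - (F.transpose * P * F * P) * A.transpose) := by
    simp only [Matrix.transpose_neg, Matrix.transpose_add, Matrix.transpose_mul,
      Matrix.transpose_transpose, hPt]
    noncomm_ring
  have e2 : Matrix.trace (F.transpose * (P * Δ * P)) = Matrix.trace (Δ.transpose * (P * F * P)) := by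
    rw [← Matrix.trace_transpose]
    simp only [Matrix.transpose_mul, Matrix.transpose_transpose, hPt]
    rw [Matrix.mul_assoc, Matrix.mul_assoc, Matrix.trace_mul_comm, Matrix.mul_assoc,
      Matrix.mul_assoc, Matrix.trace_mul_comm]
  rw [e1, Matrix.trace_add, Matrix.trace_add, Matrix.trace_sub, e2,
    Matrix.trace_mul_comm A.transpose, sub_self, add_zero, ← two_mul]
  congr 1
  simp only [Matrix.trace, Matrix.diag_apply, Matrix.mul_apply (M := Δ.transpose)]
  rw [Finset.sum_comm]
  exact Finset.sum_congr rfl fun c _ => Finset.sum_congr rfl fun d _ => by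
    rw [hG.matFFup_eq hy]; rfl

end Coord
end

/-! ### Divergences of 𝓠 and 𝓢. -/

noncomputable section
namespace Coord

variable {G : E4 → Matrix (Fin 4) (Fin 4) ℝ} {ep : Fin 4 → Fin 4 → Fin 4 → Fin 4 → E4 → ℝ}
  {t : Fin 4 → E4 → ℝ} {h : E4 → ℂ} {Ω : Set E4} {y : E4}

/-- The product rule with D𝓘 = 0 and D𝓕 given by `killingRR`; all connection terms cancel. -/
theorem covD_QQ (hG : IsMetricOn G Ω) (hep : IsVolumeOn G ep Ω) (hT : IsKillingOn G t Ω)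
    (hy : y ∈ Ω) (hR : ∀ z ∈ Ω, ∀ i j, ricci G i j z = 0) (r a b m n : Fin 4) :
    covD G (QQ G ep t) r a b m n y =
      killingRR G ep t r a b y * FF G ep t m n y + FF G ep t a b y * killingRR G ep t r m n y
      - 2 / 3 * (∑ c, ∑ d, killingRR G ep t r c d y * FFup G ep t c d y) * II G ep a b m n y := by
  have hF : ∀ a b, DifferentiableAt ℝ (FF G ep t a b) y := fun a b =>
    differentiableAt_of_contDiffOn hG.isOpen (hep.smooth_FF hG hT a b) hy
  have hs : DifferentiableAt ℝ (FFsq G ep t) y :=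
    differentiableAt_of_contDiffOn hG.isOpen (hep.smooth_FFsq hG hT) hy
  have hI : DifferentiableAt ℝ (II G ep a b m n) y :=
    differentiableAt_of_contDiffOn hG.isOpen (hep.smooth_II hG a b m n) hy
  have h1 : pd r (QQ G ep t a b m n) y =
      pd r (FF G ep t a b) y * FF G ep t m n y + FF G ep t a b y * pd r (FF G ep t m n) y
      - (1 / 3 * pd r (FFsq G ep t) y * II G ep a b m n y
        + 1 / 3 * FFsq G ep t y * pd r (II G ep a b m n) y) := by
    have h0 : QQ G ep t a b m n = fun z => FF G ep t a b z * FF G ep t m n z -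
      1 / 3 * FFsq G ep t z * II G ep a b m n z := rfl
    rw [h0, pd_sub ((hF a b).fun_mul (hF m n)) ((hs.const_mul _).fun_mul hI),
      pd_mul (hF a b) (hF m n), pd_mul (hs.const_mul _) hI, pd_const_mul hs]
  rw [covD, h1, pd_FF hG hep hT hy hR, pd_FF hG hep hT hy hR, pd_FFsq hG hep hT hy hR,
    pd_II hG hep hy]
  -- This scalar is made opaque so that expanding sums over four indices touches only the connection
  -- terms.
  generalize ∑ c, ∑ d, killingRR G ep t r c d y * FFup G ep t c d y = K
  simp only [QQ, Fin.sum_univ_four]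
  ring

/-- `𝓕` is divergence-free. -/
theorem sum_gInv_mul_killingRR (hG : IsMetricOn G Ω) (hep : IsVolumeOn G ep Ω)
    (hy : y ∈ Ω) (hR : ∀ z ∈ Ω, ∀ i j, ricci G i j z = 0) (b : Fin 4) :
    ∑ a, ∑ r, (gInv G y a r : ℂ) * killingRR G ep t r a b y = 0 := by
  have h1 : ∀ c, ∑ a, ∑ r, (gInv G y a r : ℂ) * RR G ep c r a b y = 0 := by
    intro c
    -- The real part of the trace is minus the Ricci tensor; the imaginary part vanishes by the
    -- first Bianchi identity.
    have e1 : ∑ a, ∑ r, gInv G y a r * riemann G c r a b y = 0 := by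
      have h2 := hG.sum_gInv_mul_riemann_eq_ricci hy c b
      rw [hR y hy] at h2
      rw [Finset.sum_comm, ← neg_eq_zero, ← Finset.sum_neg_distrib, ← h2]
      refine Finset.sum_congr rfl fun r _ => ?_
      rw [← Finset.sum_neg_distrib]
      refine Finset.sum_congr rfl fun a _ => ?_
      rw [hG.riemann_swap_left hy r c, hG.gInv_symm hy a r]
      ring
    have e2 := hG.sum_gInv_mul_starRiemann (ep := ep) hy c b
    have e1' := congrArg (fun x : ℝ => (x : ℂ)) e1
    have e2' := congrArg (fun x : ℝ => Complex.I * (x : ℂ)) e2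
    simp only [Complex.ofReal_sum, Complex.ofReal_mul, Complex.ofReal_zero, Finset.mul_sum,
      mul_zero] at e1' e2'
    simp only [hep.RR_eq hy, mul_add, Finset.sum_add_distrib]
    rw [e1', zero_add, ← e2']
    exact Finset.sum_congr rfl fun a _ => Finset.sum_congr rfl fun r _ => by ring
  simp only [killingRR, Finset.mul_sum]
  rw [← sum_rotate]
  refine Finset.sum_eq_zero fun c _ => ?_
  rw [← mul_zero (t c y : ℂ), ← h1 c]
  simp only [Finset.mul_sum]
  exact Finset.sum_congr rfl fun a _ => Finset.sum_congr rfl fun r _ => by ring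

/-- Of the three terms of D𝓠, the one with D^α𝓕_{αβ} drops out. The other two are the two terms of
K(𝓡); the sign of the first comes from the antisymmetry of 𝓕. -/
theorem divergence_QQ (hG : IsMetricOn G Ω) (hep : IsVolumeOn G ep Ω) (hT : IsKillingOn G t Ω)
    (hy : y ∈ Ω) (hR : ∀ z ∈ Ω, ∀ i j, ricci G i j z = 0) (b m n : Fin 4) :
    divergence G (QQ G ep t) b m n y =
      -killingContraction G ep t (fun s r c d => RR G ep s r c d y) b m n y := by
  have hanti : ∀ a b, FF G ep t a b y = -FF G ep t b a y := fun a b =>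
    congrFun (congrFun (hep.isSelfDual_matFF hG hT hy).antisymm b) a
  have hmixed : ∀ r, ∑ a, (gInv G y a r : ℂ) * FF G ep t a b y = -FFmixed G ep t b r y := by
    intro r
    rw [FFmixed, ← Finset.sum_neg_distrib]
    exact Finset.sum_congr rfl fun a _ => by rw [hanti a b, hG.gInv_symm hy a r]; ring
  have hII : ∀ r, ∑ a, (gInv G y a r : ℂ) * II G ep a b m n y =
      ∑ l, (gInv G y r l : ℂ) * II G ep l b m n y := by
    intro r
    exact Finset.sum_congr rfl fun a _ => by rw [hG.gInv_symm hy a r]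
  have h1 : divergence G (QQ G ep t) b m n y =
      (∑ a, ∑ r, (gInv G y a r : ℂ) * killingRR G ep t r a b y) * FF G ep t m n y +
      ∑ r, ((∑ a, (gInv G y a r : ℂ) * FF G ep t a b y) * killingRR G ep t r m n y -
        2 / 3 * (∑ c, ∑ d, killingRR G ep t r c d y * FFup G ep t c d y) *
          ∑ a, (gInv G y a r : ℂ) * II G ep a b m n y) := by
    simp only [divergence, covD_QQ hG hep hT hy hR]
    rw [Finset.sum_comm, Finset.sum_comm (f := fun a r => (gInv G y a r : ℂ) *
      killingRR G ep t r a b y), Finset.sum_mul, ← Finset.sum_add_distrib]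
    refine Finset.sum_congr rfl fun r _ => ?_
    rw [Finset.sum_mul, Finset.sum_mul, Finset.mul_sum Finset.univ _ (2 / 3 * _),
      ← Finset.sum_sub_distrib, ← Finset.sum_add_distrib]
    exact Finset.sum_congr rfl fun a _ => by ring
  rw [h1, sum_gInv_mul_killingRR hG hep hy hR, zero_mul, zero_add, killingContraction,
    Finset.sum_comm, ← Finset.sum_neg_distrib]
  refine Finset.sum_congr rfl fun r _ => ?_
  rw [hmixed, hII]
  have h2 : ∑ c, ∑ d, killingRR G ep t r c d y * FFup G ep t c d y =
      ∑ s, (t s y : ℂ) * ∑ c, ∑ d, RR G ep s r c d y * FFup G ep t c d y := by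
    simp only [killingRR, Finset.sum_mul, Finset.mul_sum]
    rw [← sum_rotate]
    exact Finset.sum_congr rfl fun s _ => Finset.sum_congr rfl fun c _ =>
      Finset.sum_congr rfl fun d _ => by ring
  generalize ∑ l, (gInv G y r l : ℂ) * II G ep l b m n y = J
  rw [h2, killingRR, Finset.mul_sum, Finset.mul_sum, Finset.sum_mul, ← Finset.sum_sub_distrib,
    ← Finset.sum_neg_distrib]
  exact Finset.sum_congr rfl fun s _ => by ring

theorem pd_inv (hh : DifferentiableAt ℝ h y) (h0 : h y ≠ 0) (r : Fin 4) :
    pd r (fun z => (h z)⁻¹) y = -((h y) ^ 2)⁻¹ * pd r h y := by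
  have h1 : pd r (fun z => (h z)⁻¹ * h z) y = 0 := by
    -- Continuity keeps h nonzero near y, so h⁻¹h is locally constant and the product rule can be
    -- solved for the derivative of h⁻¹.
    have : (fun z => (h z)⁻¹ * h z) =ᶠ[𝓝 y] fun _ => 1 := by
      filter_upwards [hh.continuousAt.eventually_ne h0] with z hz using inv_mul_cancel₀ hz
    rw [pd_congr this, pd_const]
  have hi : DifferentiableAt ℝ (fun z => (h z)⁻¹) y := hh.inv h0
  rw [pd_mul hi hh] at h1
  field_simp at h1 ⊢
  linear_combination h1

theorem differentiableAt_SS (hG : IsMetricOn G Ω) (hep : IsVolumeOn G ep Ω)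
    (hT : IsKillingOn G t Ω) (hy : y ∈ Ω) (hh : DifferentiableAt ℝ h y) (h0 : h y ≠ 0)
    (a b m n : Fin 4) : DifferentiableAt ℝ (SS G ep t h a b m n) y :=
  (differentiableAt_of_contDiffOn hG.isOpen (hep.smooth_RR hG a b m n) hy).add
    (((hh.inv h0).const_mul 6).mul
      (differentiableAt_of_contDiffOn hG.isOpen (hep.smooth_QQ hG hT a b m n) hy))

theorem covD_SS (hG : IsMetricOn G Ω) (hep : IsVolumeOn G ep Ω)
    (hT : IsKillingOn G t Ω) (hy : y ∈ Ω) (hh : DifferentiableAt ℝ h y) (h0 : h y ≠ 0)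
    (r a b m n : Fin 4) : covD G (SS G ep t h) r a b m n y =
      covD G (RR G ep) r a b m n y + 6 * (h y)⁻¹ * covD G (QQ G ep t) r a b m n y
      - 6 * ((h y) ^ 2)⁻¹ * (pd r h y * QQ G ep t a b m n y) := by
  have h1 : pd r (SS G ep t h a b m n) y = pd r (RR G ep a b m n) y +
      (6 * (-((h y) ^ 2)⁻¹ * pd r h y) * QQ G ep t a b m n y
        + 6 * (h y)⁻¹ * pd r (QQ G ep t a b m n) y) := by
    have hQ := differentiableAt_of_contDiffOn hG.isOpen (hep.smooth_QQ hG hT a b m n) hy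
    have hi : DifferentiableAt ℝ (fun z => (h z)⁻¹) y := hh.inv h0
    have e : SS G ep t h a b m n =
      fun z => RR G ep a b m n z + 6 * (h z)⁻¹ * QQ G ep t a b m n z := rfl
    rw [e, pd_add (differentiableAt_of_contDiffOn hG.isOpen (hep.smooth_RR hG a b m n) hy)
      ((hi.const_mul 6).fun_mul hQ), pd_mul (hi.const_mul 6) hQ, pd_const_mul hi, pd_inv hh h0]
  simp only [covD, h1, SS, Fin.sum_univ_four]
  ring

/-- Sort by powers of h⁻¹: the K(𝓡) terms agree by `divergence_QQ`, the Dh terms agree by the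
quotient rule, and the surplus K(𝓠) term cancels the Ernst part of the error term by
`killingContraction_QQ`. -/
theorem divergence_SS (hG : IsMetricOn G Ω) (hep : IsVolumeOn G ep Ω)
    (hT : IsKillingOn G t Ω) (hy : y ∈ Ω) (hR : ∀ z ∈ Ω, ∀ i j, ricci G i j z = 0)
    (hh : DifferentiableAt ℝ h y) (h0 : h y ≠ 0) (b m n : Fin 4) :
    divergence G (SS G ep t h) b m n y =
      mainTerm G ep t h b m n y + errorTerm G ep t h b m n y := by
  have h1 : divergence G (SS G ep t h) b m n y = divergence G (RR G ep) b m n y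
      + 6 * (h y)⁻¹ * divergence G (QQ G ep t) b m n y
      - 6 * ((h y) ^ 2)⁻¹ *
        ∑ r, (∑ l, (gInv G y r l : ℂ) * pd l h y) * QQ G ep t r b m n y := by
    simp only [divergence, covD_SS hG hep hT hy hh h0, Finset.mul_sum, Finset.sum_mul,
      ← Finset.sum_add_distrib, ← Finset.sum_sub_distrib]
    exact Finset.sum_congr rfl fun a _ => Finset.sum_congr rfl fun r _ => by ring
  have h2 : errorTerm G ep t h b m n y = -6 * ((h y) ^ 2)⁻¹ *
      (∑ r, (∑ l, (gInv G y r l : ℂ) * pd l h y) * QQ G ep t r b m n y +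
      ∑ r, (∑ l, (gInv G y r l : ℂ) * ernst G ep t l y) * QQ G ep t r b m n y) := by
    simp only [errorTerm, EE, mul_add, add_mul, Finset.sum_add_distrib]
  have h3 : mainTerm G ep t h b m n y = -6 * (h y)⁻¹ *
      (killingContraction G ep t (fun s r c d => RR G ep s r c d y) b m n y
        + 6 * (h y)⁻¹ * killingContraction G ep t (fun s r c d => QQ G ep t s r c d y) b m n y) := by
    rw [mainTerm_eq, ← killingContraction_smul (6 * (h y)⁻¹), ← killingContraction_add]
    rfl
  have h4 := killingContraction_QQ hG hep hT hy b m n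
  rw [h1, h2, h3, divergence_RR hG hep hy hR, divergence_QQ hG hep hT hy hR]
  linear_combination (6 * ((h y) ^ 2)⁻¹) * h4

end Coord
end

noncomputable section

/-! ### Components in charts of the maximal atlas -/

section Spacetime

variable {M : Type*} [TopologicalSpace M] [ChartedSpace E4 M] [IsManifold (𝓡 4) ∞ M]

omit [IsManifold (𝓡 4) ∞ M] in
theorem maximalAtlas_mdifferentiable {e : OpenPartialHomeomorph M E4}
    (he : e ∈ IsManifold.maximalAtlas (𝓡 4) ∞ M) : e.MDifferentiable (𝓡 4) (𝓡 4) :=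
  ⟨(contMDiffOn_of_mem_maximalAtlas he).mdifferentiableOn (by simp),
    (contMDiffOn_symm_of_mem_maximalAtlas he).mdifferentiableOn (by simp)⟩

/-- The coordinate vector fields are smooth. -/
theorem contMDiffOn_coordVec {e : OpenPartialHomeomorph M E4}
    (he : e ∈ IsManifold.maximalAtlas (𝓡 4) ∞ M) (i : Fin 4) :
    ContMDiffOn (𝓡 4) (𝓡 4).tangent ∞
      (fun z => (⟨e.symm z, coordVec e z i⟩ : TangentBundle (𝓡 4) M)) e.target := by
  have : IsManifold (𝓡 4) 1 M := IsManifold.of_le (n := ∞) (by simp)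
  have h1 := (contMDiffOn_symm_of_mem_maximalAtlas he).contMDiffOn_tangentMapWithin (m := ∞)
    (by simp) e.open_target.uniqueMDiffOn
  have h2 : ContMDiffOn (𝓡 4) (𝓡 4).tangent ∞
      (fun z : E4 => (⟨z, (EuclideanSpace.single i (1 : ℝ) : E4)⟩ : TangentBundle (𝓡 4) E4))
      e.target :=
    contMDiffOn_vectorSpace_iff_contDiffOn.mpr contDiffOn_const
  refine (h1.comp h2 fun z hz => hz).congr fun z hz => ?_
  simp only [Function.comp, tangentMapWithin, mfderivWithin_of_isOpen e.open_target hz]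
  rfl

theorem contDiffOn_metricComp
    {g : ∀ p : M, TangentSpace (𝓡 4) p →L[ℝ] TangentSpace (𝓡 4) p →L[ℝ] ℝ}
    (hg : IsLorentzMetric g) {e : OpenPartialHomeomorph M E4}
    (he : e ∈ IsManifold.maximalAtlas (𝓡 4) ∞ M) :
    Coord.MatrixSmoothOn (metricComp g e) e.target := by
  intro i j
  have hb := contMDiffOn_symm_of_mem_maximalAtlas he
  have h1 := hg.smooth.comp_contMDiffOn hb
  have h := ContMDiffOn.clm_bundle_apply₂ (F₁ := E4) (F₂ := E4) (F₃ := ℝ)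
    (E₃ := fun _ : M => ℝ) h1 (contMDiffOn_coordVec he i) (contMDiffOn_coordVec he j)
  have h2 : ContMDiffOn (𝓡 4) 𝓘(ℝ) ∞ (fun z => g (e.symm z) (coordVec e z i) (coordVec e z j)) e.target := by
    intro z hz
    have h3 := h z hz
    simp only [Bundle.contMDiffWithinAt_totalSpace] at h3
    exact h3.2
  exact h2.contDiffOn

theorem contDiffOn_vecComp {T : ∀ p : M, TangentSpace (𝓡 4) p}
    (hT : ContMDiff (𝓡 4) (𝓡 4).tangent ∞ (fun p => (⟨p, T p⟩ : TangentBundle (𝓡 4) M)))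
    {e : OpenPartialHomeomorph M E4} (he : e ∈ IsManifold.maximalAtlas (𝓡 4) ∞ M) (i : Fin 4) :
    ContDiffOn ℝ ∞ (vecComp T e i) e.target := by
  have : IsManifold (𝓡 4) 1 M := IsManifold.of_le (n := ∞) (by simp)
  have h1 := (contMDiffOn_of_mem_maximalAtlas he).contMDiffOn_tangentMapWithin (m := ∞)
    (by simp) e.open_source.uniqueMDiffOn
  have h2 := hT.comp_contMDiffOn (contMDiffOn_symm_of_mem_maximalAtlas he)
  have h3 := h1.comp h2 fun z hz => e.map_target hz
  have h4 := (contMDiff_snd_tangentBundle_modelSpace E4 (𝓡 4) (n := ∞)).comp_contMDiffOn h3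
  have h5 := h4.contDiffOn
  have h6 : ContDiffOn ℝ ∞ (fun z => (show E4 from mfderiv (𝓡 4) (𝓡 4) e (e.symm z)
      (T (e.symm z)))) e.target := by
    refine h5.congr fun z hz => ?_
    simp only [Function.comp, tangentMapWithin,
      mfderivWithin_of_isOpen e.open_source (e.map_target hz)]
    rfl
  exact (EuclideanSpace.proj i : E4 →L[ℝ] ℝ).contDiff.comp_contDiffOn h6

theorem map_eq_sum_smul_single {V : Type*} [AddCommGroup V] [Module ℝ V] (L : E4 →ₗ[ℝ] V)
    (u : E4) : L u = ∑ i, u i • L (EuclideanSpace.single i (1 : ℝ)) := by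
  conv_lhs => rw [← (EuclideanSpace.basisFun (Fin 4) ℝ).sum_repr u]
  simp [map_sum, map_smul]

theorem bilin_sum_smul {V : Type*} [AddCommGroup V] [Module ℝ V] [TopologicalSpace V]
    (B : V →L[ℝ] V →L[ℝ] ℝ) (x : Fin 4 → V) (c d : Fin 4 → ℝ) :
    B (∑ i, c i • x i) (∑ j, d j • x j) = ∑ i, ∑ j, c i * B (x i) (x j) * d j := by
  simp only [map_sum, map_smul, _root_.sum_apply, _root_.smul_apply,
    smul_eq_mul, Finset.mul_sum]
  rw [Finset.sum_comm]
  exact Finset.sum_congr rfl fun i _ => Finset.sum_congr rfl fun j _ => by ring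

/-- Coordinate vectors span the tangent space, so an orthonormal frame has a coefficient matrix C
with C g Cᵀ = diag(-1,1,1,1). The determinant of the right side is -1, hence det g ≠ 0. -/
theorem det_metricComp_ne_zero
    {g : ∀ p : M, TangentSpace (𝓡 4) p →L[ℝ] TangentSpace (𝓡 4) p →L[ℝ] ℝ}
    (hg : IsLorentzMetric g) {e : OpenPartialHomeomorph M E4}
    (he : e ∈ IsManifold.maximalAtlas (𝓡 4) ∞ M) {y : E4} (hy : y ∈ e.target) :
    (metricComp g e y).det ≠ 0 := by
  obtain ⟨v, hv⟩ := hg.exists_frame (e.symm y)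
  have hsurj : ∀ w : TangentSpace (𝓡 4) (e.symm y),
      ∃ c : Fin 4 → ℝ, w = ∑ i, c i • coordVec e y i := by
    intro w
    obtain ⟨u, hu⟩ := (maximalAtlas_mdifferentiable he).symm.mfderiv_surjective (x := y) hy w
    exact ⟨fun i => (show E4 from u) i, hu.symm.trans
      (map_eq_sum_smul_single (mfderiv (𝓡 4) (𝓡 4) e.symm y).toLinearMap u)⟩
  choose c hc using fun j => hsurj (v j)
  have h : Matrix.of c * metricComp g e y * (Matrix.of c).transpose =
      Matrix.diagonal fun i : Fin 4 => if i = 0 then (-1 : ℝ) else 1 := by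
    ext i j
    rw [Matrix.diagonal_apply, ← hv i j, hc i, hc j, bilin_sum_smul, Matrix.mul_apply]
    simp only [Matrix.mul_apply, Finset.sum_mul, Matrix.transpose_apply]
    exact Finset.sum_comm
  intro h0
  have h2 := congrArg Matrix.det h
  rw [Matrix.det_mul, Matrix.det_mul, h0, Matrix.det_diagonal] at h2
  simp at h2

theorem isMetricOn_metricComp
    {g : ∀ p : M, TangentSpace (𝓡 4) p →L[ℝ] TangentSpace (𝓡 4) p →L[ℝ] ℝ}
    (hg : IsLorentzMetric g) {e : OpenPartialHomeomorph M E4}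
    (he : e ∈ IsManifold.maximalAtlas (𝓡 4) ∞ M) :
    Coord.IsMetricOn (metricComp g e) e.target where
  isOpen := e.open_target
  smooth := contDiffOn_metricComp hg he
  symm z _ := by ext i j; exact hg.symm _ _ _
  det_ne_zero z hz := det_metricComp_ne_zero hg he hz

omit [IsManifold (𝓡 4) ∞ M] in
theorem isVolumeOn_formComp
    {g : ∀ p : M, TangentSpace (𝓡 4) p →L[ℝ] TangentSpace (𝓡 4) p →L[ℝ] ℝ}
    {ε : ∀ p : M, TangentSpace (𝓡 4) p [⋀^Fin 4]→ₗ[ℝ] ℝ} (hε : IsVolumeForm g ε)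
    {e : OpenPartialHomeomorph M E4} (he : e ∈ IsManifold.maximalAtlas (𝓡 4) ∞ M) :
    Coord.IsVolumeOn (metricComp g e) (formComp ε e) e.target := by
  have h0 : ∀ z, formComp ε e 0 1 2 3 z = ε (e.symm z) (coordVec e z) := by
    intro z
    rw [formComp]
    congr 1
    ext i : 1
    fin_cases i <;> rfl
  refine ⟨hε.smooth e he 0 1 2 3, fun z _ a b c d => ?_, fun z _ => ?_⟩
  · rw [h0]
    exact (ε (e.symm z)).apply_eq_leviCivita_mul (coordVec e z) a b c d
  · rw [h0, hε.sq_eq]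
    rfl

theorem isKillingOn_vecComp
    {g : ∀ p : M, TangentSpace (𝓡 4) p →L[ℝ] TangentSpace (𝓡 4) p →L[ℝ] ℝ}
    {T : ∀ p : M, TangentSpace (𝓡 4) p} (hT : IsKilling g T)
    {e : OpenPartialHomeomorph M E4} (he : e ∈ IsManifold.maximalAtlas (𝓡 4) ∞ M) :
    Coord.IsKillingOn (metricComp g e) (vecComp T e) e.target :=
  ⟨contDiffOn_vecComp hT.smooth he, hT.killing e he⟩

omit [IsManifold (𝓡 4) ∞ M] in
theorem differentiableAt_comp_symm {h : M → ℂ} {e : OpenPartialHomeomorph M E4}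
    (he : e ∈ IsManifold.maximalAtlas (𝓡 4) ∞ M) {y : E4} (hy : y ∈ e.target)
    (hh : MDifferentiableAt (𝓡 4) 𝓘(ℝ, ℂ) h (e.symm y)) :
    DifferentiableAt ℝ (h ∘ e.symm) y :=
  (hh.comp y ((maximalAtlas_mdifferentiable he).mdifferentiableAt_symm hy)).differentiableAt

end Spacetime

end

/-! ### The two statements in an arbitrary chart of the maximal atlas. -/

theorem mainTheorem2 {M : Type*} [TopologicalSpace M] [ChartedSpace E4 M] [IsManifold (𝓡 4) ∞ M]
    (g : ∀ p : M, TangentSpace (𝓡 4) p →L[ℝ] TangentSpace (𝓡 4) p →L[ℝ] ℝ)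
    (hg : IsLorentzMetric g) (hvac : IsVacuum g)
    (ε : ∀ p : M, TangentSpace (𝓡 4) p [⋀^Fin 4]→ₗ[ℝ] ℝ) (hε : IsVolumeForm g ε)
    (T : ∀ p : M, TangentSpace (𝓡 4) p) (hT : IsKilling g T) :
    (∀ (h : M → ℂ), ∀ e ∈ IsManifold.maximalAtlas (𝓡 4) ∞ M, ∀ y ∈ e.target,
      MDifferentiableAt (𝓡 4) 𝓘(ℝ, ℂ) h (e.symm y) → h (e.symm y) ≠ 0 →
        (∀ a b m n, DifferentiableAt ℝ
          (Coord.SS (metricComp g e) (formComp ε e) (vecComp T e) (h ∘ e.symm) a b m n) y) ∧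
        ∀ b m n,
          Coord.divergence (metricComp g e)
              (Coord.SS (metricComp g e) (formComp ε e) (vecComp T e) (h ∘ e.symm)) b m n y =
            Coord.mainTerm (metricComp g e) (formComp ε e) (vecComp T e) (h ∘ e.symm) b m n y
            + Coord.errorTerm (metricComp g e) (formComp ε e) (vecComp T e) (h ∘ e.symm) b m n y) ∧
    (∀ (U : Set M) (σ : M → ℂ), IsOpen U → IsErnstPotentialOn g ε T U σ →
      ∀ e ∈ IsManifold.maximalAtlas (𝓡 4) ∞ M, ∀ y ∈ e.target, e.symm y ∈ U → σ (e.symm y) ≠ 1 →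
        (∀ a b m n, DifferentiableAt ℝ
          (Coord.SS (metricComp g e) (formComp ε e) (vecComp T e)
            ((fun p => 1 - σ p) ∘ e.symm) a b m n) y) ∧
        (∀ r, Coord.EE (metricComp g e) (formComp ε e) (vecComp T e)
          ((fun p => 1 - σ p) ∘ e.symm) r y = 0) ∧
        ∀ b m n,
          Coord.errorTerm (metricComp g e) (formComp ε e) (vecComp T e)
            ((fun p => 1 - σ p) ∘ e.symm) b m n y = 0 ∧
          Coord.divergence (metricComp g e)
              (Coord.SS (metricComp g e) (formComp ε e) (vecComp T e)
                ((fun p => 1 - σ p) ∘ e.symm)) b m n y =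
            Coord.mainTerm (metricComp g e) (formComp ε e) (vecComp T e)
              ((fun p => 1 - σ p) ∘ e.symm) b m n y) := by
  have key : ∀ (h : M → ℂ), ∀ e ∈ IsManifold.maximalAtlas (𝓡 4) ∞ M, ∀ y ∈ e.target,
      MDifferentiableAt (𝓡 4) 𝓘(ℝ, ℂ) h (e.symm y) → h (e.symm y) ≠ 0 →
        (∀ a b m n, DifferentiableAt ℝ
          (Coord.SS (metricComp g e) (formComp ε e) (vecComp T e) (h ∘ e.symm) a b m n) y) ∧
        ∀ b m n,
          Coord.divergence (metricComp g e)
              (Coord.SS (metricComp g e) (formComp ε e) (vecComp T e) (h ∘ e.symm)) b m n y =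
            Coord.mainTerm (metricComp g e) (formComp ε e) (vecComp T e) (h ∘ e.symm) b m n y
            + Coord.errorTerm (metricComp g e) (formComp ε e) (vecComp T e) (h ∘ e.symm)
              b m n y := by
    intro h e he y hy hh h0
    have hG := isMetricOn_metricComp hg he
    have hep := isVolumeOn_formComp hε he
    have hK := isKillingOn_vecComp hT he
    have hd := differentiableAt_comp_symm he hy hh
    exact ⟨Coord.differentiableAt_SS hG hep hK hy hd h0,
      Coord.divergence_SS hG hep hK hy (hvac e he) hd h0⟩
  refine ⟨key, fun U σ _ hσ e he y hy hyU h1 => ?_⟩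
  have hd := differentiableAt_comp_symm he hy (hσ.mdifferentiableAt _ hyU)
  have hm : MDifferentiableAt (𝓡 4) 𝓘(ℝ, ℂ) (fun p => 1 - σ p) (e.symm y) :=
    mdifferentiableAt_const.sub (hσ.mdifferentiableAt _ hyU)
  obtain ⟨hS, hdiv⟩ := key (fun p => 1 - σ p) e he y hy hm (sub_ne_zero.mpr (Ne.symm h1))
  have hE : ∀ r, Coord.EE (metricComp g e) (formComp ε e) (vecComp T e)
      ((fun p => 1 - σ p) ∘ e.symm) r y = 0 := by
    intro r
    have h2 : Coord.pd r ((fun p => 1 - σ p) ∘ e.symm) y = -Coord.pd r (σ ∘ e.symm) y := by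
      have := Coord.pd_sub (f := fun _ => (1 : ℂ)) (differentiableAt_const _) hd r
      rw [Coord.pd_const, zero_sub] at this
      exact this
    rw [Coord.EE, h2, hσ.deriv_eq e he y hy hyU r, neg_add_cancel]
  have hErr : ∀ b m n, Coord.errorTerm (metricComp g e) (formComp ε e) (vecComp T e)
      ((fun p => 1 - σ p) ∘ e.symm) b m n y = 0 := by
    intro b m n
    simp [Coord.errorTerm, hE]
  refine ⟨hS, hE, fun b m n => ⟨hErr b m n, ?_⟩⟩
  rw [hdiv, hErr, add_zero]
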